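/- Let $n\ge 1$, let $\mathbb K$ be $\mathbb R$ or $\mathbb C$, and let $\mathbb R^{n+1}_+=\{(x,y): x\in\mathbb R^n,\ y>0\}$. Let $\mathcal{CL}_{0,n}$ be the Clifford algebra over $\mathbb K$ generated by $e_1,\dots,e_n$ with $e_je_k+e_ke_j=-2\delta_{jk}$, with linear basis $e_A=e_{i_1}\cdots e_{i_l}$ for $A=\{i_1<\dots<i_l\}\subseteq\{1,\dots,n\}$ ($e_\emptyset=1$), scalar part $\mathrm{Sc}\big(\sum_A a_Ae_A\big)=a_\emptyset$ and norm $\big|\sum_A a_A e_A\big|=\big(\sum_A|a_A|^2\big)^{1/2}$. For $\mathcal{CL}_{0,n}$-valued functions of $(x,y)$ put $$D=\tfrac12\Big(\partial_y+\sum_{k=1}^n e_k\,\partial_{x_k}\Big),\qquad \bar D=\tfrac12\Big(\partial_y-\sum_{k=1}^n e_k\,\partial_{x_k}\Big),$$ where the $e_k$ multiply from the left; $F$ is called left-monogenic if it is of class $C^1$ and $DF=0$. Let $\omega_n=2\pi^{\frac{n+1}2}/\Gamma\big(\tfrac{n+1}2\big)$ be the surface area of the unit sphere $S^n$. Let $u:\mathbb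 R^{n+1}_+\to\mathbb K$ belong to the Dirichlet space $\mathcal D(\mathbb R^{n+1}_+)$, that is, $u$ is harmonic in $\mathbb R^{n+1}_+$, $\sup_{y>0}\int_{\mathbb R^n}|u(x,y)|^2dx<\infty$ and $\int_{\mathbb R^{n+1}_+}|\nabla u|^2\,dx\,dy<\infty$. Let $f$ be its boundary function: $f(x)=\lim_{y\to0^+}u(x,y)$ for almost every $x\in\mathbb R^n$. Let $F$ be the canonical left-monogenic extension of $u$, $$F=u+\sum_{k=1}^n v_k e_k,\qquad v_k(x,y)=\frac{2}{\omega_n}\int_{\mathbb R^n}\frac{t_k-x_k}{(y^2+|t-x|^2)^{\frac{n+1}2}}\,f(t)\,dt,$$ where $v_k$ is the harmonic extension of the $k$-th Riesz transform of $f$. Then $F$ is left-monogenic in $\mathbb R^{n+1}_+$ with scalar part $u$, $f\in L^2(\mathbb R^n)$, and, with $\hat f$ the ($L^2$) Fourier transform given by $\hat f(t)=\int_{\mathbb R^n}e^{2\pi i x\cdot t}f(x)\,dx$, $$\int_{\mathbb R^{n+1}_+}|\nabla u|^2\,dx\,dy=2\pi\int_{\mathbb R^n}|t|\,|\hat f(t)|^2\,dt=\int_{\mathbb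 R^{n+1}_+}|\bar DF|^2\,dx\,dy=\frac1{\omega_n}\int_{\mathbb R^n}\int_{\mathbb R^n}\frac{|f(t_1)-f(t_2)|^2}{|t_1-t_2|^{n+1}}\,dt_1\,dt_2 ,$$ all four quantities being finite. -/

import Mathlib

open MeasureTheory Filter Topology
open scoped ENNReal FourierTransform

noncomputable section

/-! ### The Clifford algebra with `e_j e_k + e_k e_j = -2 δ_{jk}` -/

/-- The quadratic form `x ↦ -(x_1² + ⋯ + x_n²)` on `𝕜ⁿ`. -/
def negSumSq (𝕜 : Type*) [RCLike 𝕜] (n : ℕ) : QuadraticForm 𝕜 (Fin n → 𝕜) :=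
  QuadraticMap.weightedSumSquares 𝕜 (fun _ : Fin n => (-1 : 𝕜))

/-- The real (`𝕜 = ℝ`) or complex (`𝕜 = ℂ`) Clifford algebra generated by `e_1, …, e_n`. -/
abbrev Cl (𝕜 : Type*) [RCLike 𝕜] (n : ℕ) : Type _ := CliffordAlgebra (negSumSq 𝕜 n)

/-- The generator `e_k`. -/
def cliffE (𝕜 : Type*) [RCLike 𝕜] {n : ℕ} (k : Fin n) : Cl 𝕜 n :=
  CliffordAlgebra.ι (negSumSq 𝕜 n) (Pi.single k 1)

/-- The canonical linear isomorphism onto the exterior algebra. -/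
def cliffEquivExterior (𝕜 : Type*) [RCLike 𝕜] (n : ℕ) :
    Cl 𝕜 n ≃ₗ[𝕜] ExteriorAlgebra 𝕜 (Fin n → 𝕜) :=
  letI : Invertible (2 : 𝕜) := invertibleOfNonzero two_ne_zero
  CliffordAlgebra.equivExterior (negSumSq 𝕜 n)

/-- The basis `(e_A)` of the Clifford algebra, indexed by the subsets `A` of `{1, …, n}`; by
`cliffBasis_apply`, `e_A = e_{i_1} ⋯ e_{i_l}` for `A = {i_1 < ⋯ < i_l}`. -/
def cliffBasis (𝕜 : Type*) [RCLike 𝕜] (n : ℕ) : Module.Basis (Finset (Fin n)) 𝕜 (Cl 𝕜 n) :=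
  ((Pi.basisFun 𝕜 (Fin n)).ExteriorAlgebra).map (cliffEquivExterior 𝕜 n).symm

theorem cliffEquivExterior_prod {𝕜 : Type*} [RCLike 𝕜] {n : ℕ} (l : List (Fin n))
    (hl : l.Nodup) :
    cliffEquivExterior 𝕜 n ((l.map (cliffE 𝕜)).prod)
      = (l.map (fun k => ExteriorAlgebra.ι 𝕜 (Pi.single k (1 : 𝕜)))).prod := by
  let _ : Invertible (2 : 𝕜) := invertibleOfNonzero two_ne_zero
  have contract : ∀ (d : Module.Dual 𝕜 (Fin n → 𝕜)) (l : List (Fin n)),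
      (∀ k ∈ l, d (Pi.single k 1) = 0) →
      CliffordAlgebra.contractLeft (Q := (0 : QuadraticForm 𝕜 (Fin n → 𝕜))) d
        ((l.map (fun k => CliffordAlgebra.ι (0 : QuadraticForm 𝕜 (Fin n → 𝕜))
          (Pi.single k (1 : 𝕜)))).prod) = 0 := by
    intro d l
    induction l with
    | nil => intro _; simp [CliffordAlgebra.contractLeft_one]
    | cons a l ih =>
      intro h
      rw [List.map_cons, List.prod_cons, CliffordAlgebra.contractLeft_ι_mul,
        h a (by simp), ih (fun k hk => h k (by simp [hk]))]
      simp
  induction l with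
  | nil =>
    simp [cliffEquivExterior]
  | cons a l ih =>
    have hl' := List.nodup_cons.1 hl
    have ih' := ih hl'.2
    rw [List.map_cons, List.prod_cons, List.map_cons, List.prod_cons, ← ih']
    refine (CliffordAlgebra.changeForm_ι_mul
      (CliffordAlgebra.changeForm.associated_neg_proof (Q := negSumSq 𝕜 n)) _ _).trans ?_
    change _ - CliffordAlgebra.contractLeft _ (cliffEquivExterior 𝕜 n _) = _
    rw [ih']
    have := contract (QuadraticMap.associated (R := 𝕜) (-negSumSq 𝕜 n) (Pi.single a 1)) l ?_
    · erw [this]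
      rw [sub_zero, ← ih']
      rfl
    · intro k hk
      have hak : a ≠ k := fun h => hl'.1 (h ▸ hk)
      have hka : k ≠ a := fun h => hak h.symm
      simp [QuadraticMap.associated_apply, negSumSq, QuadraticMap.weightedSumSquares_apply]
      rw [← Finset.sum_neg_distrib, ← Finset.sum_neg_distrib, ← Finset.sum_add_distrib,
        ← Finset.sum_add_distrib]
      refine Finset.sum_eq_zero fun x _ => ?_
      by_cases hx : x = a
      · subst hx; simp [hak]
      · simp [Pi.single_apply, hx]

theorem cliffBasis_apply {𝕜 : Type*} [RCLike 𝕜] {n : ℕ} (A : Finset (Fin n)) :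
    cliffBasis 𝕜 n A = ((A.sort (· ≤ ·)).map (cliffE 𝕜)).prod := by
  rw [cliffBasis, Module.Basis.map_apply, LinearEquiv.symm_apply_eq,
    cliffEquivExterior_prod _ (A.sort_nodup _), ExteriorAlgebra.basis_apply_ofCard _ rfl,
    ExteriorAlgebra.ιMulti_family, ExteriorAlgebra.ιMulti_apply,
    ← Finset.listMap_orderEmbOfFin_finRange A rfl, List.map_map, List.ofFn_eq_map]
  congr 2
  funext i
  simp [Set.powersetCard.ofFinEmbEquiv_symm_apply]

/-- The coordinate `x_A` of `x = ∑_A x_A e_A`. -/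
def cliffCoord {𝕜 : Type*} [RCLike 𝕜] {n : ℕ} (A : Finset (Fin n)) (x : Cl 𝕜 n) : 𝕜 :=
  (cliffBasis 𝕜 n).repr x A

/-- The scalar part `Sc x = x_∅`. -/
def cliffSc {𝕜 : Type*} [RCLike 𝕜] {n : ℕ} (x : Cl 𝕜 n) : 𝕜 := cliffCoord ∅ x

/-- The norm `|x| = (∑_A |x_A|²)^{1/2}`. -/
def cliffNorm {𝕜 : Type*} [RCLike 𝕜] {n : ℕ} (x : Cl 𝕜 n) : ℝ :=
  Real.sqrt (∑ A, ‖cliffCoord A x‖ ^ 2)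

/-! ### The upper half-space

A point of `ℝ^{n+1}` is `p = (p 0, p 1, …, p n)`, where `p 0 = y` is the vertical coordinate and
`p 1, …, p n` are the coordinates of the horizontal part `x ∈ ℝⁿ`. -/

/-- The open upper half-space `{(x, y) | x ∈ ℝⁿ, y > 0}`. -/
def upperHalf (n : ℕ) : Set (EuclideanSpace ℝ (Fin (n + 1))) := {p | 0 < p 0}

/-- The point `(x, y)` of `ℝ^{n+1}`. -/
def upperPoint {n : ℕ} (x : EuclideanSpace ℝ (Fin n)) (y : ℝ) :
    EuclideanSpace ℝ (Fin (n + 1)) :=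
  WithLp.toLp 2 (Fin.cons y (fun k => x k))

/-- The horizontal part `x` of the point `p = (x, y)`. -/
def horizontal {n : ℕ} (p : EuclideanSpace ℝ (Fin (n + 1))) : EuclideanSpace ℝ (Fin n) :=
  WithLp.toLp 2 (fun k => p k.succ)

/-- The partial derivative `∂g/∂x_i` of a scalar function on `ℝ^{n+1}`. -/
def partialD {𝕜 : Type*} [RCLike 𝕜] {n : ℕ} (i : Fin (n + 1))
    (g : EuclideanSpace ℝ (Fin (n + 1)) → 𝕜) (p : EuclideanSpace ℝ (Fin (n + 1))) : 𝕜 :=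
  fderiv ℝ g p (EuclideanSpace.single i 1)

/-- The gradient energy `∫_{ℝ^{n+1}_+} |∇u|²`, as an element of `[0, ∞]`. -/
def gradientEnergy {𝕜 : Type*} [RCLike 𝕜] {n : ℕ}
    (u : EuclideanSpace ℝ (Fin (n + 1)) → 𝕜) : ℝ≥0∞ :=
  ∫⁻ p in upperHalf n, ENNReal.ofReal (∑ i, ‖partialD i u p‖ ^ 2)

/-- The Dirichlet space of the upper half-space: the harmonic functions `u` of the Hardy space
`h²` (`sup_{y > 0} ‖u(·, y)‖_{L²} < ∞`) with finite gradient energy. -/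
structure MemDirichlet {𝕜 : Type*} [RCLike 𝕜] {n : ℕ}
    (u : EuclideanSpace ℝ (Fin (n + 1)) → 𝕜) : Prop where
  harmonic : InnerProductSpace.HarmonicOnNhd u (upperHalf n)
  hardy : (⨆ y : ℝ, ⨆ _ : 0 < y,
    eLpNorm (fun x : EuclideanSpace ℝ (Fin n) => u (upperPoint x y)) 2 volume) < ∞
  energy : gradientEnergy u < ∞

/-- `f` is the boundary function of `u`: `lim_{y → 0+} u(x, y) = f(x)` for almost every `x`. -/
def IsBoundaryFunction {𝕜 : Type*} [RCLike 𝕜] {n : ℕ}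
    (u : EuclideanSpace ℝ (Fin (n + 1)) → 𝕜) (f : EuclideanSpace ℝ (Fin n) → 𝕜) : Prop :=
  ∀ᵐ x : EuclideanSpace ℝ (Fin n),
    Tendsto (fun y : ℝ => u (upperPoint x y)) (𝓝[>] 0) (𝓝 (f x))

/-! ### Clifford-valued functions -/

/-- The partial derivative `∂F/∂x_i` of a Clifford-valued function, taken in coordinates. -/
def cliffPartial {𝕜 : Type*} [RCLike 𝕜] {n : ℕ} (i : Fin (n + 1))
    (F : EuclideanSpace ℝ (Fin (n + 1)) → Cl 𝕜 n) (p : EuclideanSpace ℝ (Fin (n + 1))) :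
    Cl 𝕜 n :=
  ∑ A, partialD i (fun q => cliffCoord A (F q)) p • cliffBasis 𝕜 n A

/-- The generalized Cauchy–Riemann operator `D F = ½ (∂_0 F + ∑_k e_k ∂_k F)`. -/
def cauchyRiemann {𝕜 : Type*} [RCLike 𝕜] {n : ℕ}
    (F : EuclideanSpace ℝ (Fin (n + 1)) → Cl 𝕜 n) (p : EuclideanSpace ℝ (Fin (n + 1))) :
    Cl 𝕜 n :=
  (1 / 2 : 𝕜) • (cliffPartial 0 F p + ∑ k : Fin n, cliffE 𝕜 k * cliffPartial k.succ F p)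

/-- The conjugate operator `D̄ F = ½ (∂_0 F - ∑_k e_k ∂_k F)`. -/
def cauchyRiemannBar {𝕜 : Type*} [RCLike 𝕜] {n : ℕ}
    (F : EuclideanSpace ℝ (Fin (n + 1)) → Cl 𝕜 n) (p : EuclideanSpace ℝ (Fin (n + 1))) :
    Cl 𝕜 n :=
  (1 / 2 : 𝕜) • (cliffPartial 0 F p - ∑ k : Fin n, cliffE 𝕜 k * cliffPartial k.succ F p)

/-- `F` is left-monogenic in `Ω`: it is of class `C¹` there and `D F = 0`. -/
def LeftMonogenicOn {𝕜 : Type*} [RCLike 𝕜] {n : ℕ}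
    (F : EuclideanSpace ℝ (Fin (n + 1)) → Cl 𝕜 n)
    (Ω : Set (EuclideanSpace ℝ (Fin (n + 1)))) : Prop :=
  (∀ A, ContDiffOn ℝ 1 (fun p => cliffCoord A (F p)) Ω) ∧ ∀ p ∈ Ω, cauchyRiemann F p = 0

/-- `ω_n = 2 π^{(n+1)/2} / Γ((n+1)/2)`, the surface area of the unit sphere of `ℝ^{n+1}`. -/
def sphereArea (n : ℕ) : ℝ :=
  2 * Real.pi ^ (((n : ℝ) + 1) / 2) / Real.Gamma (((n : ℝ) + 1) / 2)

/-- The harmonic conjugate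
`v_k(x, y) = (2/ω_n) ∫ (t_k - x_k) / (y² + |t - x|²)^{(n+1)/2} f(t) dt`, that is, the harmonic
extension of the `k`-th Riesz transform of `f`. -/
def rieszConjugate {𝕜 : Type*} [RCLike 𝕜] {n : ℕ} (f : EuclideanSpace ℝ (Fin n) → 𝕜)
    (k : Fin n) (p : EuclideanSpace ℝ (Fin (n + 1))) : 𝕜 :=
  (2 / sphereArea n) • ∫ t : EuclideanSpace ℝ (Fin n),
    ((t k - p k.succ) / (p 0 ^ 2 + ‖t - horizontal p‖ ^ 2) ^ (((n : ℝ) + 1) / 2)) • f t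

/-- The canonical left-monogenic extension `F = u + ∑_k v_k e_k` of `u`, where `f` is the boundary
function of `u`. -/
def canonicalExtension {𝕜 : Type*} [RCLike 𝕜] {n : ℕ}
    (u : EuclideanSpace ℝ (Fin (n + 1)) → 𝕜) (f : EuclideanSpace ℝ (Fin n) → 𝕜)
    (p : EuclideanSpace ℝ (Fin (n + 1))) : Cl 𝕜 n :=
  algebraMap 𝕜 (Cl 𝕜 n) (u p) + ∑ k : Fin n, rieszConjugate f k p • cliffE 𝕜 k

/-- The Fourier transform `f̂(t) = ∫ e^{2πi x·t} f(x) dx` of an `L²` function, in the sense of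
Plancherel. With this sign it is Mathlib's inverse Fourier transform. -/
def fourierL2 {n : ℕ} (f : EuclideanSpace ℝ (Fin n) → ℂ) (hf : MemLp f 2 volume) :
    EuclideanSpace ℝ (Fin n) → ℂ :=
  (𝓕⁻ (hf.toLp f) : Lp ℂ 2 (volume : Measure (EuclideanSpace ℝ (Fin n))))

end

noncomputable section

/-! ### The Fourier transform on `L¹ ∩ L²` -/

/-! Everything follows once `u` is known to be the Poisson extension of `f`, written on the Fourier
side as u(x,y) = ∫ e^{-2πi⟨t,x⟩ - 2π|t|y} f̂(t) dt. The sign convention makes f̂ the inverse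
transform in Mathlib's sense, so each slice u(·,y) is the forward transform of e^{-2πy|t|} f̂.

Identification of `u`. Finite energy bounds ∂_y u in L², so Cauchy-Schwarz on vertical segments
gives ‖u(·,b) - u(·,a)‖² ≤ (b-a)·energy. Fatou then yields f ∈ L² and u(·,y) → f in L²
(`lintegral_slice_sub_boundary_le`). The Fourier extension V of f̂ has the same L² limit, and w = u
- V is harmonic with bounded slices. Since w² is subharmonic, y ↦ ∫ w(x,y)² dx is convex in the weak
sense; a bounded convex function on (0,∞) tending to 0 at 0 and nonnegative must vanish. This is
`eq_zero_of_harmonic_of_tendsto_zero`, whence `MemDirichlet.eq_fourierExtension`.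

Energy. Differentiation multiplies the symbol by a linear expression in t whose components have
squared moduli summing to 8π²|t|². Plancherel on slices and ∫_0^∞ 8π²|t|² e^{-4π|t|y} dy = 2π|t|
give the Fourier formula (`gradientEnergy_fourierExtension`).

Monogenicity. Subordination to Gaussians identifies the transform of e^{-2πy|t|} with the Poisson
kernel. Thus u, -v_1, …, -v_n are the integrals of f against (2/ω_n) q_i/|q|^{n+1}, with q = (x - t,
y). Away from the origin these kernels have a symmetric Jacobian of trace zero, so the Riesz system
holds: DF = 0, and the same relations collapse D̄F to ∂_0 u - ∑ e_k ∂_k u, whose norm is |∇u|.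

Double integral. Expanding the square and using that P_y is even of mass one gives ∬
P_y(t₁-t₂)|f(t₁)-f(t₂)|² = 2∫(1 - e^{-2πy|t|})|f̂|² (`integral_poisson_mul_sq`). Divide by y and let
y → 0: the left side increases to (2/ω_n) times the Gagliardo integral, the right side converges to
2∫2π|t||f̂|² by domination.

Complex-valued Fourier analysis also covers 𝕜 = ℝ through the isometric inclusion into ℂ. -/

theorem eLpNorm_two_sq {α F : Type*} [MeasurableSpace α] [NormedAddCommGroup F] {μ : Measure α}
    (h : α → F) : eLpNorm h 2 μ ^ 2 = ∫⁻ x, ‖h x‖ₑ ^ 2 ∂μ := by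
  have := eLpNorm_nnreal_pow_eq_lintegral (f := h) (μ := μ) (p := 2) (by norm_num)
  simpa using this

section FourierLp

variable {E : Type*} [NormedAddCommGroup E] [InnerProductSpace ℝ E] [FiniteDimensional ℝ E]
  [MeasurableSpace E] [BorelSpace E]

open scoped InnerProductSpace ContDiff

theorem continuous_fourier_of_integrable {h : E → ℂ} (h1 : Integrable h) : Continuous (𝓕 h) :=
  VectorFourier.fourierIntegral_continuous Real.continuous_fourierChar
    (by exact continuous_inner) h1

/-- On `L¹ ∩ L²` the `L²` Fourier transform is given by the Fourier integral. -/
theorem fourier_toLp_ae_eq {h : E → ℂ} (h1 : Integrable h) (h2 : MemLp h 2) :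
    ((𝓕 (h2.toLp h) : Lp ℂ 2 (volume : Measure E)) : E → ℂ) =ᵐ[volume] 𝓕 h := by
  -- Both functions are locally integrable, so it suffices to pair them with smooth compactly
  -- supported φ. Both pairings equal ∫ 𝓕φ · h: for the L² transform because it agrees with the
  -- transform of tempered distributions, for the integral by Fubini.
  refine ae_eq_of_integral_contDiff_smul_eq
    ((Lp.memLp _).locallyIntegrable (by norm_num))
    (continuous_fourier_of_integrable h1).locallyIntegrable fun φ hφ hc => ?_
  have hg₁ : HasCompactSupport (Complex.ofRealCLM ∘ φ) := hc.comp_left rfl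
  have hg₂ : ContDiff ℝ ∞ (Complex.ofRealCLM ∘ φ) := by fun_prop
  set ψ := hg₁.toSchwartzMap hg₂ with hψ
  have hval : ∀ x, ψ x = (φ x : ℂ) := fun x => rfl
  have e1 := congrArg (fun T => T ψ) (Lp.fourier_toTemperedDistribution_eq (h2.toLp h))
  simp only [TemperedDistribution.fourier_apply, Lp.toTemperedDistribution_apply] at e1
  have e2 : ∫ x, (𝓕 ψ) x • (h2.toLp h) x = ∫ x, (𝓕 (ψ : E → ℂ)) x • h x := by
    refine integral_congr_ae ?_
    filter_upwards [h2.coeFn_toLp] with x hx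
    rw [hx, SchwartzMap.fourier_coe]
  have e3 : ∫ x, (𝓕 (ψ : E → ℂ)) x • h x = ∫ x, ψ x • (𝓕 h) x := by
    simpa using! (VectorFourier.integral_fourierIntegral_smul_eq_flip (L := innerₗ E)
      Real.continuous_fourierChar continuous_inner ψ.integrable h1)
  have key := e1.symm.trans (e2.trans e3)
  simpa [hval] using key

theorem lintegral_enorm_sq_fourier {h : E → ℂ} (h1 : Integrable h) (h2 : MemLp h 2) :
    ∫⁻ x, ‖𝓕 h x‖ₑ ^ 2 = ∫⁻ x, ‖h x‖ₑ ^ 2 := by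
  have key : eLpNorm (𝓕 h) 2 = eLpNorm h 2 := by
    rw [← eLpNorm_congr_ae (fourier_toLp_ae_eq h1 h2), ← eLpNorm_congr_ae h2.coeFn_toLp,
      ← Lp.enorm_def, ← Lp.enorm_def, ← ofReal_norm, ← ofReal_norm, Lp.norm_fourier_eq]
  rw [← eLpNorm_two_sq, ← eLpNorm_two_sq, key]

/-- Parseval's identity for the integral Fourier transform and the `L²` inverse transform. -/
theorem integral_conj_fourier_mul {b : E → ℂ} (h1 : Integrable b) (h2 : MemLp b 2)
    {f : E → ℂ} (hf : MemLp f 2) :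
    ∫ x, (starRingEnd ℂ) (𝓕 b x) * f x
      = ∫ t, (starRingEnd ℂ) (b t) * (𝓕⁻ (hf.toLp f) : Lp ℂ 2 (volume : Measure E)) t := by
  have h := Lp.inner_fourier_eq (h2.toLp b) (𝓕⁻ (hf.toLp f) : Lp ℂ 2 (volume : Measure E))
  rw [FourierTransform.fourier_fourierInv_eq, L2.inner_def, L2.inner_def] at h
  refine (integral_congr_ae ?_).trans (h.trans (integral_congr_ae ?_))
  · filter_upwards [fourier_toLp_ae_eq h1 h2, hf.coeFn_toLp] with x hx hx'
    rw [hx, hx', RCLike.inner_apply, mul_comm]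
  · filter_upwards [h2.coeFn_toLp] with x hx
    rw [hx, RCLike.inner_apply, mul_comm]

end FourierLp
/-! ### Coordinates of the upper half-space -/

section Coordinates

variable {n : ℕ}

@[simp] theorem upperPoint_zero (x : EuclideanSpace ℝ (Fin n)) (y : ℝ) : upperPoint x y 0 = y := rfl

@[simp] theorem upperPoint_succ (x : EuclideanSpace ℝ (Fin n)) (y : ℝ) (k : Fin n) :
    upperPoint x y k.succ = x k := rfl

@[simp] theorem horizontal_apply (p : EuclideanSpace ℝ (Fin (n + 1))) (k : Fin n) :
    horizontal p k = p k.succ := rfl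

@[simp] theorem horizontal_upperPoint (x : EuclideanSpace ℝ (Fin n)) (y : ℝ) :
    horizontal (upperPoint x y) = x := rfl

@[simp] theorem upperPoint_horizontal (p : EuclideanSpace ℝ (Fin (n + 1))) :
    upperPoint (horizontal p) (p 0) = p := by
  ext i
  refine Fin.cases ?_ (fun k => ?_) i <;> simp

@[simp] theorem mem_upperHalf {p : EuclideanSpace ℝ (Fin (n + 1))} :
    p ∈ upperHalf n ↔ 0 < p 0 := Iff.rfl

theorem isOpen_upperHalf : IsOpen (upperHalf n) :=
  isOpen_lt continuous_const (EuclideanSpace.proj (0 : Fin (n + 1))).continuous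

/-- The horizontal part as a continuous linear map. -/
def horizontalCLM (n : ℕ) : EuclideanSpace ℝ (Fin (n + 1)) →L[ℝ] EuclideanSpace ℝ (Fin n) :=
  LinearMap.toContinuousLinearMap
    { toFun := horizontal
      map_add' := fun _ _ => rfl
      map_smul' := fun _ _ => rfl }

@[simp] theorem horizontalCLM_apply (p : EuclideanSpace ℝ (Fin (n + 1))) :
    horizontalCLM n p = horizontal p := rfl

@[simp] theorem horizontal_single_zero (a : ℝ) :
    horizontal (EuclideanSpace.single (0 : Fin (n + 1)) a) = 0 := by
  ext k; simp

@[simp] theorem horizontal_single_succ (k : Fin n) (a : ℝ) :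
    horizontal (EuclideanSpace.single k.succ a) = EuclideanSpace.single k a := by
  ext j; simp

theorem continuous_upperPoint :
    Continuous (fun q : ℝ × EuclideanSpace ℝ (Fin n) => upperPoint q.2 q.1) := by
  refine (PiLp.continuous_toLp 2 _).comp (continuous_pi fun i => ?_)
  refine Fin.cases ?_ (fun k => ?_) i
  · exact continuous_fst
  · exact (EuclideanSpace.proj k).continuous.comp continuous_snd

/-- The identification of `ℝ × ℝⁿ` with `ℝ^{n+1}`. -/
def upperEquiv (n : ℕ) :
    (ℝ × EuclideanSpace ℝ (Fin n)) ≃ₜ EuclideanSpace ℝ (Fin (n + 1)) where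
  toFun q := upperPoint q.2 q.1
  invFun p := (p 0, horizontal p)
  left_inv _ := rfl
  right_inv p := upperPoint_horizontal p
  continuous_toFun := continuous_upperPoint
  continuous_invFun :=
    (EuclideanSpace.proj (0 : Fin (n + 1))).continuous.prodMk (horizontalCLM n).continuous

@[simp] theorem upperEquiv_apply (q : ℝ × EuclideanSpace ℝ (Fin n)) :
    upperEquiv n q = upperPoint q.2 q.1 := rfl

theorem measurePreserving_upperEquiv : MeasurePreserving (upperEquiv n) := by
  have h1 := (volume_preserving_piFinSuccAbove (fun _ : Fin (n + 1) => ℝ) 0).symm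
  have h2 := (MeasurePreserving.id (volume : Measure ℝ)).prod
    (PiLp.volume_preserving_ofLp (Fin n))
  have h3 := PiLp.volume_preserving_toLp (Fin (n + 1))
  have h4 := h3.comp (h1.comp h2)
  convert h4 using 1
  · funext q
    change upperPoint q.2 q.1 = WithLp.toLp 2 (Fin.insertNth 0 q.1 (fun k => q.2 k))
    rw [Fin.insertNth_zero']
    rfl
  · rfl

theorem measurableEmbedding_upperEquiv : MeasurableEmbedding (upperEquiv n) :=
  (upperEquiv n).measurableEmbedding

theorem lintegral_upperHalf {G : EuclideanSpace ℝ (Fin (n + 1)) → ℝ≥0∞}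
    (hG : AEMeasurable G (volume.restrict (upperHalf n))) :
    ∫⁻ p in upperHalf n, G p = ∫⁻ y in Set.Ioi (0 : ℝ), ∫⁻ x, G (upperPoint x y) := by
  have hpre : upperEquiv n ⁻¹' upperHalf n = Set.Ioi (0 : ℝ) ×ˢ Set.univ := by
    ext q; simp
  have hmp := (measurePreserving_upperEquiv (n := n)).restrict_preimage_emb
    measurableEmbedding_upperEquiv (upperHalf n)
  rw [← hmp.lintegral_comp_emb measurableEmbedding_upperEquiv]
  rw [hpre] at hmp ⊢
  have hG' := AEMeasurable.comp_quasiMeasurePreserving hG hmp.quasiMeasurePreserving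
  rw [Measure.volume_eq_prod, ← Measure.prod_restrict, Measure.restrict_univ] at hG' ⊢
  exact lintegral_prod _ hG'

end Coordinates
/-! ### Integration by parts against test functions -/

section Green

variable {E : Type*} [NormedAddCommGroup E] [NormedSpace ℝ E]

theorem contDiffOn_fderiv_apply {U : Set E} (hU : IsOpen U) {F : Type*} [NormedAddCommGroup F]
    [NormedSpace ℝ F] {A : E → F} (hA : ContDiffOn ℝ 2 A U) (v : E) :
    ContDiffOn ℝ 1 (fun x => fderiv ℝ A x v) U :=
  (hA.fderiv_of_isOpen hU (by norm_num)).clm_apply contDiffOn_const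

theorem contDiff_fderiv_apply {F : Type*} [NormedAddCommGroup F]
    [NormedSpace ℝ F] {A : E → F} (hA : ContDiff ℝ 2 A) (v : E) :
    ContDiff ℝ 1 (fun x => fderiv ℝ A x v) :=
  (hA.fderiv_right (by norm_num)).clm_apply contDiff_const

/-- Summed over an orthonormal frame, the last term vanishes for harmonic w and leaves Δ(w²) =
2|∇w|² ≥ 0, the source of all the convexity used below. -/
theorem fderiv_fderiv_sq {U : Set E} (hU : IsOpen U) {w : E → ℝ} (hw : ContDiffOn ℝ 2 w U) (v : E)
    {x : E} (hx : x ∈ U) :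
    fderiv ℝ (fun z => fderiv ℝ (fun z => w z ^ 2) z v) x v
      = 2 * fderiv ℝ w x v ^ 2 + 2 * w x * fderiv ℝ (fun z => fderiv ℝ w z v) x v := by
  have hd : ∀ z ∈ U, HasFDerivAt w (fderiv ℝ w z) z := fun z hz =>
    ((hw.differentiableOn two_ne_zero).differentiableAt (hU.mem_nhds hz)).hasFDerivAt
  have h1 : (fun z => fderiv ℝ (fun z => w z ^ 2) z v) =ᶠ[𝓝 x]
      fun z => 2 * (w z * fderiv ℝ w z v) := by
    filter_upwards [hU.mem_nhds hx] with z hz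
    rw [((hd z hz).pow 2).fderiv]
    simp; ring
  have h2 : HasFDerivAt (fun z => fderiv ℝ w z v) (fderiv ℝ (fun z => fderiv ℝ w z v) x) x :=
    (((contDiffOn_fderiv_apply hU hw v).differentiableOn one_ne_zero).differentiableAt
      (hU.mem_nhds hx)).hasFDerivAt
  have h3 : HasFDerivAt (fun z => 2 * (w z * fderiv ℝ w z v)) _ x := ((hd x hx).mul h2).const_mul 2
  rw [h1.fderiv_eq, h3.fderiv]
  simp; ring

variable [FiniteDimensional ℝ E] [MeasurableSpace E] [BorelSpace E] {μ : Measure E}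
  [μ.IsAddHaarMeasure]

theorem integrable_mul_of_continuousOn {X : Type*} [TopologicalSpace X] [T2Space X]
    [MeasurableSpace X] [BorelSpace X] {μ : Measure X} [IsFiniteMeasureOnCompacts μ] {U : Set X}
    {A Φ : X → ℝ} (hA : ContinuousOn A U)
    (hΦ : Continuous Φ) (hc : HasCompactSupport Φ) (hs : tsupport Φ ⊆ U) :
    Integrable (fun x => A x * Φ x) μ := by
  rw [← integrableOn_iff_integrable_of_support_subset (s := tsupport Φ)]
  · exact ((hA.mono hs).mul hΦ.continuousOn).integrableOn_compact hc
  · exact (Function.support_mul_subset_right _ _).trans subset_closure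

/-- There is no boundary term because Φ is compactly supported inside U; the values of A outside U
are never seen. -/
theorem integral_mul_fderiv_of_tsupport_subset {U : Set E} (hU : IsOpen U) {A Φ : E → ℝ} (v : E)
    (hA : ContDiffOn ℝ 1 A U) (hΦ : ContDiff ℝ 1 Φ) (hc : HasCompactSupport Φ)
    (hs : tsupport Φ ⊆ U) :
    ∫ x, A x * fderiv ℝ Φ x v ∂μ = - ∫ x, fderiv ℝ A x v * Φ x ∂μ := by
  refine integral_mul_fderiv_eq_neg_fderiv_mul_of_integrable ?_ ?_ ?_ ?_ ?_
  · exact integrable_mul_of_continuousOn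
      ((hA.continuousOn_fderiv_of_isOpen hU le_rfl).clm_apply continuousOn_const)
      hΦ.continuous hc hs
  · exact integrable_mul_of_continuousOn hA.continuousOn
      ((hΦ.continuous_fderiv one_ne_zero).clm_apply continuous_const) (hc.fderiv_apply (𝕜 := ℝ) v)
      ((tsupport_fderiv_apply_subset ℝ v).trans hs)
  · exact integrable_mul_of_continuousOn hA.continuousOn hΦ.continuous hc hs
  · exact fun x hx => (hA.differentiableOn one_ne_zero).differentiableAt (hU.mem_nhds (hs hx))
  · exact fun x _ => hΦ.differentiable one_ne_zero x

theorem integral_mul_fderiv_fderiv_of_tsupport_subset {U : Set E} (hU : IsOpen U) {A Ψ : E → ℝ}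
    (v : E) (hA : ContDiffOn ℝ 2 A U) (hΨ : ContDiff ℝ 2 Ψ) (hc : HasCompactSupport Ψ)
    (hs : tsupport Ψ ⊆ U) :
    ∫ x, A x * fderiv ℝ (fun z => fderiv ℝ Ψ z v) x v ∂μ
      = ∫ x, fderiv ℝ (fun z => fderiv ℝ A z v) x v * Ψ x ∂μ := by
  rw [integral_mul_fderiv_of_tsupport_subset hU v (hA.of_le (by norm_num))
      (contDiff_fderiv_apply hΨ v) (hc.fderiv_apply (𝕜 := ℝ) v)
      ((tsupport_fderiv_apply_subset ℝ v).trans hs),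
    integral_mul_fderiv_of_tsupport_subset hU v (contDiffOn_fderiv_apply hU hA v)
      (hΨ.of_le (by norm_num)) hc hs, neg_neg]

/-- Subharmonicity of the square of a harmonic function, in the weak sense. -/
theorem integral_sq_mul_laplacian_nonneg {ι : Type*} [Fintype ι] (e : ι → E) {U : Set E}
    (hU : IsOpen U) {w Ψ : E → ℝ} (hw : ContDiffOn ℝ 2 w U)
    (hharm : ∀ x ∈ U, ∑ i, fderiv ℝ (fun z => fderiv ℝ w z (e i)) x (e i) = 0)
    (hΨ : ContDiff ℝ 2 Ψ) (hc : HasCompactSupport Ψ) (hs : tsupport Ψ ⊆ U)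
    (hpos : ∀ x, 0 ≤ Ψ x) :
    0 ≤ ∫ x, w x ^ 2 * ∑ i, fderiv ℝ (fun z => fderiv ℝ Ψ z (e i)) x (e i) ∂μ := by
  have hw2 : ContDiffOn ℝ 2 (fun z => w z ^ 2) U := hw.pow 2
  have hint1 : ∀ i, Integrable
      (fun x => w x ^ 2 * fderiv ℝ (fun z => fderiv ℝ Ψ z (e i)) x (e i)) μ := fun i =>
    integrable_mul_of_continuousOn hw2.continuousOn
      (((contDiff_fderiv_apply hΨ (e i)).continuous_fderiv one_ne_zero).clm_apply
        continuous_const) ((hc.fderiv_apply (𝕜 := ℝ) _).fderiv_apply (𝕜 := ℝ) _)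
      ((tsupport_fderiv_apply_subset ℝ _).trans ((tsupport_fderiv_apply_subset ℝ _).trans hs))
  have hint2 : ∀ i, Integrable
      (fun x => fderiv ℝ (fun z => fderiv ℝ (fun z => w z ^ 2) z (e i)) x (e i) * Ψ x) μ := fun i =>
    integrable_mul_of_continuousOn
      (((contDiffOn_fderiv_apply hU hw2 (e i)).continuousOn_fderiv_of_isOpen hU le_rfl).clm_apply
        continuousOn_const) hΨ.continuous hc hs
  simp_rw [Finset.mul_sum]
  rw [integral_finsetSum _ fun i _ => hint1 i]
  -- Two integrations by parts move the Laplacian from Ψ onto w², where it is pointwise nonnegative.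
  simp_rw [integral_mul_fderiv_fderiv_of_tsupport_subset hU _ hw2 hΨ hc hs]
  rw [← integral_finsetSum _ fun i _ => hint2 i]
  refine integral_nonneg fun x => ?_
  by_cases hx : x ∈ U
  · simp_rw [← Finset.sum_mul]
    refine mul_nonneg ?_ (hpos x)
    simp_rw [fderiv_fderiv_sq hU hw _ hx]
    rw [Finset.sum_add_distrib, ← Finset.mul_sum, ← Finset.mul_sum, hharm x hx, mul_zero, add_zero]
    positivity
  · have : Ψ x = 0 := image_eq_zero_of_notMem_tsupport fun h => hx (hs h)
    simp [this]

end Green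
/-! ### Test functions in separated variables -/

section Separated

variable {n : ℕ}

theorem hasFDerivAt_separated {a : ℝ → ℝ} {b : EuclideanSpace ℝ (Fin n) → ℝ}
    (ha : Differentiable ℝ a) (hb : Differentiable ℝ b) (r : ℝ)
    (p : EuclideanSpace ℝ (Fin (n + 1))) :
    HasFDerivAt (fun p : EuclideanSpace ℝ (Fin (n + 1)) => a (p 0) * b (r • horizontal p))
      (a (p 0) • (fderiv ℝ b (r • horizontal p)).comp (r • horizontalCLM n)
        + b (r • horizontal p) • (deriv a (p 0) • EuclideanSpace.proj (0 : Fin (n + 1)))) p := by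
  have h1 : HasFDerivAt (fun p : EuclideanSpace ℝ (Fin (n + 1)) => a (p 0))
      (deriv a (p 0) • (EuclideanSpace.proj (0 : Fin (n + 1)) : _ →L[ℝ] ℝ)) p :=
    (ha (p 0)).hasDerivAt.comp_hasFDerivAt p
      (EuclideanSpace.proj (0 : Fin (n + 1)) : _ →L[ℝ] ℝ).hasFDerivAt
  have h2 : HasFDerivAt (fun p : EuclideanSpace ℝ (Fin (n + 1)) => b (r • horizontal p))
      ((fderiv ℝ b (r • horizontal p)).comp (r • horizontalCLM n)) p :=
    (hb (r • horizontal p)).hasFDerivAt.comp p (r • horizontalCLM n).hasFDerivAt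
  exact h1.mul h2

theorem fderiv_separated_zero {a : ℝ → ℝ} {b : EuclideanSpace ℝ (Fin n) → ℝ}
    (ha : Differentiable ℝ a) (hb : Differentiable ℝ b) (r : ℝ)
    (p : EuclideanSpace ℝ (Fin (n + 1))) :
    fderiv ℝ (fun p : EuclideanSpace ℝ (Fin (n + 1)) => a (p 0) * b (r • horizontal p)) p
      (EuclideanSpace.single 0 1) = deriv a (p 0) * b (r • horizontal p) := by
  rw [(hasFDerivAt_separated ha hb r p).fderiv]
  simp [mul_comm]

theorem fderiv_separated_succ {a : ℝ → ℝ} {b : EuclideanSpace ℝ (Fin n) → ℝ}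
    (ha : Differentiable ℝ a) (hb : Differentiable ℝ b) (r : ℝ) (k : Fin n)
    (p : EuclideanSpace ℝ (Fin (n + 1))) :
    fderiv ℝ (fun p : EuclideanSpace ℝ (Fin (n + 1)) => a (p 0) * b (r • horizontal p)) p
      (EuclideanSpace.single k.succ 1)
      = a (p 0) * (r * fderiv ℝ b (r • horizontal p) (EuclideanSpace.single k 1)) := by
  rw [(hasFDerivAt_separated ha hb r p).fderiv]
  simp

/-- The factor r² carried by the horizontal Laplacian is what makes the error from the horizontal
cut-off disappear when the cut-off is spread out, r → 0. -/
theorem sum_fderiv_fderiv_separated {a : ℝ → ℝ} {b : EuclideanSpace ℝ (Fin n) → ℝ}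
    (ha : ContDiff ℝ 2 a) (hb : ContDiff ℝ 2 b) (r : ℝ)
    (p : EuclideanSpace ℝ (Fin (n + 1))) :
    ∑ i, fderiv ℝ (fun z => fderiv ℝ
        (fun p : EuclideanSpace ℝ (Fin (n + 1)) => a (p 0) * b (r • horizontal p)) z
        (EuclideanSpace.single i 1)) p (EuclideanSpace.single i 1)
      = deriv (deriv a) (p 0) * b (r • horizontal p)
        + r ^ 2 * (a (p 0) * ∑ k, fderiv ℝ (fun z => fderiv ℝ b z (EuclideanSpace.single k 1))
            (r • horizontal p) (EuclideanSpace.single k 1)) := by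
  have ha1 : Differentiable ℝ a := ha.differentiable two_ne_zero
  have hb1 : Differentiable ℝ b := hb.differentiable two_ne_zero
  have ha2 : Differentiable ℝ (deriv a) :=
    ((contDiff_succ_iff_deriv (n := 1)).1 ha).2.2.differentiable one_ne_zero
  rw [Fin.sum_univ_succ]
  congr 1
  · simp_rw [fderiv_separated_zero ha1 hb1]
    exact fderiv_separated_zero ha2 hb1 r p
  · rw [Finset.mul_sum, Finset.mul_sum]
    refine Finset.sum_congr rfl fun k _ => ?_
    have hb2 : Differentiable ℝ (fun z => fderiv ℝ b z (EuclideanSpace.single k 1)) :=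
      (contDiff_fderiv_apply hb _).differentiable one_ne_zero
    simp_rw [fderiv_separated_succ ha1 hb1]
    rw [fderiv_separated_succ ha1 (hb2.const_mul r) r k p, fderiv_const_mul (hb2 _)]
    simp; ring

end Separated
/-! ### A convexity principle for harmonic functions on the half-space -/

section Strip

variable {n : ℕ}

/-- The horizontal strip `α ≤ y ≤ β`. -/
def strip (n : ℕ) (α β : ℝ) : Set (EuclideanSpace ℝ (Fin (n + 1))) := {p | p 0 ∈ Set.Icc α β}

theorem isClosed_strip (α β : ℝ) : IsClosed (strip n α β) :=
  isClosed_Icc.preimage (EuclideanSpace.proj (0 : Fin (n + 1))).continuous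

theorem strip_subset {α β : ℝ} (hα : 0 < α) : strip n α β ⊆ upperHalf n :=
  fun _ hp => hα.trans_le hp.1

theorem lintegral_strip_le {w : EuclideanSpace ℝ (Fin (n + 1)) → ℝ}
    (hw : ContinuousOn w (upperHalf n)) {α β : ℝ} (hα : 0 < α) {C : ℝ≥0∞}
    (hb : ∀ y ∈ Set.Icc α β, ∫⁻ x, ‖w (upperPoint x y)‖ₑ ^ 2 ≤ C) :
    ∫⁻ p in strip n α β, ‖w p‖ₑ ^ 2 ≤ C * ENNReal.ofReal (β - α) := by
  have hm : AEMeasurable ((strip n α β).indicator fun p => ‖w p‖ₑ ^ 2)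
      (volume.restrict (upperHalf n)) :=
    ((hw.aestronglyMeasurable isOpen_upperHalf.measurableSet).enorm.pow_const 2).indicator
      (isClosed_strip α β).measurableSet
  calc ∫⁻ p in strip n α β, ‖w p‖ₑ ^ 2
      = ∫⁻ p in upperHalf n, (strip n α β).indicator (fun p => ‖w p‖ₑ ^ 2) p := by
        rw [setLIntegral_indicator (isClosed_strip α β).measurableSet,
          Set.inter_eq_left.2 (strip_subset hα)]
    _ = ∫⁻ y in Set.Ioi (0 : ℝ), ∫⁻ x,
          (strip n α β).indicator (fun p => ‖w p‖ₑ ^ 2) (upperPoint x y) := lintegral_upperHalf hm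
    _ ≤ ∫⁻ y in Set.Ioi (0 : ℝ), (Set.Icc α β).indicator (fun _ => C) y := by
        refine lintegral_mono fun y => ?_
        by_cases hy : y ∈ Set.Icc α β
        · rw [Set.indicator_of_mem hy]
          refine le_trans (lintegral_mono fun x => ?_) (hb y hy)
          exact Set.indicator_le_self _ _ _
        · have : ∀ x : EuclideanSpace ℝ (Fin n), upperPoint x y ∉ strip n α β := fun x hx => hy hx
          simp [this]
    _ ≤ ∫⁻ y, (Set.Icc α β).indicator (fun _ => C) y := setLIntegral_le_lintegral _ _
    _ = C * ENNReal.ofReal (β - α) := by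
        rw [lintegral_indicator measurableSet_Icc, setLIntegral_const, Real.volume_Icc]

theorem integrableOn_sq_strip {w : EuclideanSpace ℝ (Fin (n + 1)) → ℝ}
    (hw : ContinuousOn w (upperHalf n)) {α β : ℝ} (hα : 0 < α) {C : ℝ≥0∞} (hC : C ≠ ∞)
    (hb : ∀ y ∈ Set.Icc α β, ∫⁻ x, ‖w (upperPoint x y)‖ₑ ^ 2 ≤ C) :
    IntegrableOn (fun p => w p ^ 2) (strip n α β) := by
  refine ⟨((hw.mono (strip_subset hα)).pow 2).aestronglyMeasurable
    (isClosed_strip α β).measurableSet, ?_⟩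
  rw [hasFiniteIntegral_iff_enorm]
  simp_rw [enorm_pow]
  exact (lintegral_strip_le hw hα hb).trans_lt (ENNReal.mul_lt_top hC.lt_top ENNReal.ofReal_lt_top)

theorem integrable_sq_mul_of_strip {w : EuclideanSpace ℝ (Fin (n + 1)) → ℝ}
    (hw : ContinuousOn w (upperHalf n)) {α β : ℝ} (hα : 0 < α) {C : ℝ≥0∞} (hC : C ≠ ∞)
    (hb : ∀ y ∈ Set.Icc α β, ∫⁻ x, ‖w (upperPoint x y)‖ₑ ^ 2 ≤ C)
    {κ : EuclideanSpace ℝ (Fin (n + 1)) → ℝ} (hκ : Continuous κ) {B : ℝ} (hB : ∀ p, ‖κ p‖ ≤ B)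
    (h0 : ∀ p ∉ strip n α β, κ p = 0) : Integrable (fun p => w p ^ 2 * κ p) := by
  rw [← integrableOn_iff_integrable_of_support_subset (s := strip n α β)]
  · exact (integrableOn_sq_strip hw hα hC hb).mul_bdd (c := B) hκ.aestronglyMeasurable
      (Eventually.of_forall hB)
  · intro p hp
    by_contra h
    exact hp (by simp [h0 p h])

/-- Converts bounds on individual slices into bounds on the vertical averages to which the weak
convexity applies. -/
theorem integral_sq_mul_le_of_strip {w : EuclideanSpace ℝ (Fin (n + 1)) → ℝ}
    (hw : ContinuousOn w (upperHalf n)) {α β : ℝ} (hα : 0 < α) (hαβ : α ≤ β) {C : ℝ} (hC : 0 ≤ C)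
    (hb : ∀ y ∈ Set.Icc α β, ∫⁻ x, ‖w (upperPoint x y)‖ₑ ^ 2 ≤ ENNReal.ofReal C)
    {κ : ℝ → ℝ} (hκ0 : ∀ y, 0 ≤ κ y) (hκ1 : ∀ y, κ y ≤ 1)
    (h0 : ∀ y ∉ Set.Icc α β, κ y = 0) : ∫ p, w p ^ 2 * κ (p 0) ≤ C * (β - α) := by
  have hi := integrableOn_sq_strip hw hα ENNReal.ofReal_ne_top hb
  have hS := (isClosed_strip (n := n) α β).measurableSet
  calc ∫ p, w p ^ 2 * κ (p 0)
      ≤ ∫ p, (strip n α β).indicator (fun p => w p ^ 2) p := by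
        refine integral_mono_of_nonneg
          (Eventually.of_forall fun p => mul_nonneg (sq_nonneg _) (hκ0 _))
          (hi.integrable_indicator hS) (Eventually.of_forall fun p => ?_)
        by_cases hp : p ∈ strip n α β
        · simpa [hp] using mul_le_of_le_one_right (sq_nonneg (w p)) (hκ1 (p 0))
        · simp [hp, h0 (p 0) hp]
    _ = (∫⁻ p in strip n α β, ‖w p‖ₑ ^ 2).toReal := by
        rw [integral_indicator hS, integral_eq_lintegral_of_nonneg_ae
          (Eventually.of_forall fun p => sq_nonneg _) hi.1]
        congr 2 with p
        rw [← enorm_pow, Real.enorm_eq_ofReal (sq_nonneg _)]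
    _ ≤ C * (β - α) := by
        refine ENNReal.toReal_le_of_le_ofReal (mul_nonneg hC (by linarith)) ?_
        rw [ENNReal.ofReal_mul hC]
        exact lintegral_strip_le hw hα hb

theorem deriv_deriv_eq_zero_of_notMem_Icc {η : ℝ → ℝ} {α β : ℝ}
    (hsupp : ∀ y ∉ Set.Icc α β, η y = 0) {y : ℝ} (hy : y ∉ Set.Icc α β) :
    deriv (deriv η) y = 0 := by
  have h1 : ∀ z ∉ Set.Icc α β, deriv η z = 0 := fun z hz => by
    have : η =ᶠ[𝓝 z] fun _ => 0 := by
      filter_upwards [isClosed_Icc.isOpen_compl.mem_nhds hz] with t ht using hsupp t ht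
    rw [this.deriv_eq, deriv_const]
  have : deriv η =ᶠ[𝓝 y] fun _ => 0 := by
    filter_upwards [isClosed_Icc.isOpen_compl.mem_nhds hy] with t ht using h1 t ht
  rw [this.deriv_eq, deriv_const]

/-- Weak convexity of `y ↦ ∫ w(x,y)² dx` for a harmonic function `w`. -/
theorem integral_sq_mul_deriv_deriv_nonneg {w : EuclideanSpace ℝ (Fin (n + 1)) → ℝ}
    (hw : ContDiffOn ℝ 2 w (upperHalf n))
    (hharm : ∀ p ∈ upperHalf n, ∑ i, fderiv ℝ (fun z => fderiv ℝ w z (EuclideanSpace.single i 1)) p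
      (EuclideanSpace.single i 1) = 0) {α β : ℝ} (hα : 0 < α) {C : ℝ≥0∞} (hC : C ≠ ∞)
    (hb : ∀ y ∈ Set.Icc α β, ∫⁻ x, ‖w (upperPoint x y)‖ₑ ^ 2 ≤ C)
    {η : ℝ → ℝ} (hη : ContDiff ℝ 2 η) (hpos : ∀ y, 0 ≤ η y)
    (hsupp : ∀ y ∉ Set.Icc α β, η y = 0) :
    0 ≤ ∫ p, w p ^ 2 * deriv (deriv η) (p 0) := by
  have hηc : HasCompactSupport η := HasCompactSupport.intro isCompact_Icc hsupp
  have hη2 : Continuous (deriv (deriv η)) :=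
    ((contDiff_succ_iff_deriv (n := 1)).1 hη).2.2.continuous_deriv_one
  obtain ⟨C0, hC0⟩ := hηc.exists_bound_of_continuous hη.continuous
  obtain ⟨C2, hC2⟩ := (HasCompactSupport.intro isCompact_Icc
    fun y hy => deriv_deriv_eq_zero_of_notMem_Icc hsupp hy).exists_bound_of_continuous hη2
  -- A function of the height alone is not compactly supported. The test functions are therefore
  -- η(y) χ(r x), to which subharmonicity applies for each r > 0.
  let χ : ContDiffBump (0 : EuclideanSpace ℝ (Fin n)) := ⟨1, 2, one_pos, one_lt_two⟩
  have hχ : ContDiff ℝ 2 χ := χ.contDiff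
  set Lχ : EuclideanSpace ℝ (Fin n) → ℝ := fun x =>
    ∑ k, fderiv ℝ (fun z => fderiv ℝ χ z (EuclideanSpace.single k 1)) x
      (EuclideanSpace.single k 1) with hLχ
  have hLχc : Continuous Lχ := continuous_finsetSum _ fun k _ =>
    ((contDiff_fderiv_apply hχ _).continuous_fderiv one_ne_zero).clm_apply continuous_const
  have hLχs : HasCompactSupport Lχ := by
    refine HasCompactSupport.of_support_subset_isCompact χ.hasCompactSupport ?_
    intro x hx
    by_contra hx'
    refine hx (Finset.sum_eq_zero fun k _ => ?_)
    refine image_eq_zero_of_notMem_tsupport (f := fun x => fderiv ℝ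
      (fun z => fderiv ℝ χ z (EuclideanSpace.single k 1)) x (EuclideanSpace.single k 1))
      fun h => hx' ?_
    exact (tsupport_fderiv_apply_subset ℝ _).trans (tsupport_fderiv_apply_subset ℝ _) h
  obtain ⟨CL, hCL⟩ := hLχs.exists_bound_of_continuous hLχc
  have hproj : Continuous fun p : EuclideanSpace ℝ (Fin (n + 1)) => p 0 :=
    (EuclideanSpace.proj (0 : Fin (n + 1))).continuous
  have hhor : Continuous (horizontal (n := n)) := (horizontalCLM n).continuous
  set r : ℕ → ℝ := fun m => 1 / ((m : ℝ) + 1) with hr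
  have hr0 : ∀ m, 0 < r m := fun m => by positivity
  have hr1 : ∀ m, r m ≤ 1 := fun m => by
    rw [hr, div_le_one (by positivity)]; simp
  have hrt : Tendsto r atTop (𝓝 0) := tendsto_one_div_add_atTop_nhds_zero_nat
  have hK : ∀ m, 0 ≤ ∫ p, w p ^ 2 * (deriv (deriv η) (p 0) * χ (r m • horizontal p)
      + r m ^ 2 * (η (p 0) * Lχ (r m • horizontal p))) := by
    intro m
    set K : Set (EuclideanSpace ℝ (Fin (n + 1))) :=
      upperEquiv n '' (Set.Icc α β ×ˢ Metric.closedBall 0 (2 / r m)) with hKdef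
    have hKc : IsCompact K :=
      (isCompact_Icc.prod (isCompact_closedBall _ _)).image (upperEquiv n).continuous
    have hout : ∀ p ∉ K, η (p 0) * χ (r m • horizontal p) = 0 := by
      intro p hp
      by_cases h1 : p 0 ∈ Set.Icc α β
      · have h2 : 2 / r m < ‖horizontal p‖ := by
          by_contra h
          exact hp ⟨(p 0, horizontal p), ⟨h1, by simpa using h⟩, upperPoint_horizontal p⟩
        rw [χ.zero_of_le_dist, mul_zero]
        rw [dist_zero_right, norm_smul, Real.norm_of_nonneg (hr0 m).le]
        rw [div_lt_iff₀ (hr0 m)] at h2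
        change 2 ≤ _
        linarith
      · rw [hsupp _ h1, zero_mul]
    have hKU : K ⊆ upperHalf n := by
      rintro _ ⟨q, hq, rfl⟩
      exact hα.trans_le hq.1.1
    have key := integral_sq_mul_laplacian_nonneg (μ := volume)
      (fun i => EuclideanSpace.single i (1 : ℝ)) isOpen_upperHalf hw hharm
      (Ψ := fun p => η (p 0) * χ (r m • horizontal p))
      ((hη.comp (EuclideanSpace.proj (0 : Fin (n + 1)) : _ →L[ℝ] ℝ).contDiff).mul
        (hχ.comp (r m • horizontalCLM n).contDiff))
      (HasCompactSupport.intro hKc hout)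
      ((closure_minimal (Function.support_subset_iff'.2 hout) hKc.isClosed).trans hKU)
      (fun p => mul_nonneg (hpos _) χ.nonneg)
    simpa only [sum_fderiv_fderiv_separated hη hχ] using key
  have hbd : ∀ m p, ‖deriv (deriv η) (p 0) * χ (r m • horizontal p)
      + r m ^ 2 * (η (p 0) * Lχ (r m • horizontal p))‖ ≤ C2 + C0 * CL := by
    intro m p
    refine (norm_add_le _ _).trans (add_le_add ?_ ?_)
    · rw [norm_mul, Real.norm_of_nonneg χ.nonneg]
      exact (mul_le_of_le_one_right (norm_nonneg _) χ.le_one).trans (hC2 _)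
    · rw [norm_mul, norm_mul, Real.norm_of_nonneg (sq_nonneg _)]
      refine (mul_le_of_le_one_left (by positivity) (pow_le_one₀ (hr0 m).le (hr1 m))).trans ?_
      exact mul_le_mul (hC0 _) (hCL _) (norm_nonneg _) ((norm_nonneg _).trans (hC0 0))
  -- As r → 0, χ(r x) → 1 and the term with r² drops out. The domination is by a multiple of w² on
  -- the strip, integrable thanks to the slice bound.
  refine ge_of_tendsto' (tendsto_integral_of_dominated_convergence
    (fun p => (strip n α β).indicator (fun p => w p ^ 2) p * (C2 + C0 * CL)) ?_ ?_ ?_ ?_) hK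
  · intro m
    refine (integrable_sq_mul_of_strip hw.continuousOn hα hC hb ?_ (B := C2 + C0 * CL) ?_ ?_).1
    · have hh : Continuous fun p : EuclideanSpace ℝ (Fin (n + 1)) => r m • horizontal p :=
        (r m • horizontalCLM n).continuous
      exact ((hη2.comp hproj).mul (hχ.continuous.comp hh)).add
        (continuous_const.mul ((hη.continuous.comp hproj).mul (hLχc.comp hh)))
    · exact hbd m
    · intro p hp
      rw [deriv_deriv_eq_zero_of_notMem_Icc hsupp hp, hsupp _ hp]; ring
  · exact ((integrableOn_sq_strip hw.continuousOn hα hC hb).integrable_indicator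
      (isClosed_strip α β).measurableSet).mul_const _
  · intro m
    refine Eventually.of_forall fun p => ?_
    by_cases hp : p ∈ strip n α β
    · rw [Set.indicator_of_mem hp, norm_mul, Real.norm_of_nonneg (sq_nonneg _)]
      exact mul_le_mul_of_nonneg_left (hbd m p) (sq_nonneg _)
    · rw [deriv_deriv_eq_zero_of_notMem_Icc hsupp hp, hsupp _ hp]
      simp [hp]
  · refine Eventually.of_forall fun p => ?_
    have ht : Tendsto (fun m => r m • horizontal p) atTop (𝓝 0) := by
      simpa using hrt.smul_const (horizontal p)
    have t1 : Tendsto (fun m => χ (r m • horizontal p)) atTop (𝓝 1) := by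
      have := (hχ.continuous.tendsto 0).comp ht
      rwa [χ.one_of_mem_closedBall (by simp [χ])] at this
    have t2 : Tendsto (fun m => Lχ (r m • horizontal p)) atTop (𝓝 (Lχ 0)) :=
      (hLχc.tendsto 0).comp ht
    have := ((t1.const_mul (deriv (deriv η) (p 0))).add
      ((hrt.pow 2).mul (t2.const_mul (η (p 0))))).const_mul (w p ^ 2)
    simpa using this

end Strip
/-! ### Uniqueness of harmonic functions with vanishing boundary values -/

section Uniqueness

/-- A bump supported in `[1, 2]`. -/
def bumpOneTwo (s : ℝ) : ℝ := max 0 ((s - 1) * (2 - s))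

theorem continuous_bumpOneTwo : Continuous bumpOneTwo := by unfold bumpOneTwo; fun_prop

theorem bumpOneTwo_nonneg (s : ℝ) : 0 ≤ bumpOneTwo s := le_max_left _ _

theorem bumpOneTwo_le_one (s : ℝ) : bumpOneTwo s ≤ 1 :=
  max_le zero_le_one (by nlinarith [sq_nonneg (s - 3 / 2)])

theorem bumpOneTwo_of_le {s : ℝ} (hs : s ≤ 1) : bumpOneTwo s = 0 :=
  max_eq_left (by nlinarith)

theorem bumpOneTwo_of_ge {s : ℝ} (hs : 2 ≤ s) : bumpOneTwo s = 0 :=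
  max_eq_left (by nlinarith)

/-- The primitive of `bumpOneTwo`. -/
def bumpPrimitive (y : ℝ) : ℝ := ∫ s in (0 : ℝ)..y, bumpOneTwo s

/-- The second primitive of `bumpOneTwo`: it vanishes on `(-∞, 1]` and is affine on `[2, ∞)`. -/
def bumpPrimitive₂ (y : ℝ) : ℝ := ∫ s in (0 : ℝ)..y, bumpPrimitive s

theorem hasDerivAt_bumpPrimitive (y : ℝ) : HasDerivAt bumpPrimitive (bumpOneTwo y) y :=
  continuous_bumpOneTwo.integral_hasStrictDerivAt 0 y |>.hasDerivAt

theorem continuous_bumpPrimitive : Continuous bumpPrimitive :=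
  continuous_iff_continuousAt.2 fun y => (hasDerivAt_bumpPrimitive y).continuousAt

theorem hasDerivAt_bumpPrimitive₂ (y : ℝ) : HasDerivAt bumpPrimitive₂ (bumpPrimitive y) y :=
  continuous_bumpPrimitive.integral_hasStrictDerivAt 0 y |>.hasDerivAt

theorem bumpPrimitive_of_le {y : ℝ} (hy : y ≤ 1) : bumpPrimitive y = 0 := by
  refine intervalIntegral.integral_zero_ae (Eventually.of_forall fun s hs => ?_)
  refine bumpOneTwo_of_le (hs.2.trans (max_le zero_le_one hy))

theorem bumpPrimitive₂_of_le {y : ℝ} (hy : y ≤ 1) : bumpPrimitive₂ y = 0 := by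
  refine intervalIntegral.integral_zero_ae (Eventually.of_forall fun s hs => ?_)
  refine bumpPrimitive_of_le (hs.2.trans (max_le zero_le_one hy))

theorem bumpPrimitive_of_ge {y : ℝ} (hy : 2 ≤ y) : bumpPrimitive y = bumpPrimitive 2 := by
  have h := intervalIntegral.integral_add_adjacent_intervals
    (continuous_bumpOneTwo.intervalIntegrable 0 2 (μ := volume))
    (continuous_bumpOneTwo.intervalIntegrable 2 y)
  have h0 : ∫ s in (2 : ℝ)..y, bumpOneTwo s = 0 :=
    intervalIntegral.integral_zero_ae (Eventually.of_forall fun s hs => bumpOneTwo_of_ge (by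
      rw [Set.uIoc_of_le hy] at hs; exact hs.1.le))
  unfold bumpPrimitive
  rw [← h, h0, add_zero]

theorem bumpPrimitive₂_of_ge {y : ℝ} (hy : 2 ≤ y) :
    bumpPrimitive₂ y = bumpPrimitive₂ 2 + bumpPrimitive 2 * (y - 2) := by
  have h := intervalIntegral.integral_add_adjacent_intervals
    (continuous_bumpPrimitive.intervalIntegrable 0 2 (μ := volume))
    (continuous_bumpPrimitive.intervalIntegrable 2 y)
  have h0 : ∫ s in (2 : ℝ)..y, bumpPrimitive s = ∫ s in (2 : ℝ)..y, bumpPrimitive 2 :=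
    intervalIntegral.integral_congr_ae (Eventually.of_forall fun s hs => bumpPrimitive_of_ge (by
      rw [Set.uIoc_of_le hy] at hs; exact hs.1.le))
  rw [intervalIntegral.integral_const, smul_eq_mul] at h0
  unfold bumpPrimitive₂
  rw [← h, h0]; ring

theorem deriv_bumpPrimitive₂ : deriv bumpPrimitive₂ = bumpPrimitive :=
  funext fun y => (hasDerivAt_bumpPrimitive₂ y).deriv

theorem deriv_bumpPrimitive : deriv bumpPrimitive = bumpOneTwo :=
  funext fun y => (hasDerivAt_bumpPrimitive y).deriv

theorem contDiff_bumpPrimitive₂ : ContDiff ℝ 2 bumpPrimitive₂ := by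
  refine (contDiff_succ_iff_deriv (n := 1)).2
    ⟨fun y => (hasDerivAt_bumpPrimitive₂ y).differentiableAt, by simp, ?_⟩
  rw [deriv_bumpPrimitive₂, contDiff_one_iff_deriv, deriv_bumpPrimitive]
  exact ⟨fun y => (hasDerivAt_bumpPrimitive y).differentiableAt, continuous_bumpOneTwo⟩

theorem convexOn_bumpPrimitive₂ : ConvexOn ℝ Set.univ bumpPrimitive₂ := by
  refine Monotone.convexOn_univ_of_deriv
    (fun y => (hasDerivAt_bumpPrimitive₂ y).differentiableAt) ?_
  rw [deriv_bumpPrimitive₂]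
  refine monotone_of_deriv_nonneg (fun y => (hasDerivAt_bumpPrimitive y).differentiableAt) ?_
  rw [deriv_bumpPrimitive]
  exact bumpOneTwo_nonneg

/-- The tent-like test function with kinks at `σ₁, σ₂, σ₃`. -/
def tentTest (σ₁ σ₂ σ₃ y : ℝ) : ℝ :=
  (σ₃ - σ₂) / (σ₃ - σ₁) * σ₁ * bumpPrimitive₂ (σ₁⁻¹ * y) - σ₂ * bumpPrimitive₂ (σ₂⁻¹ * y)
    + (σ₂ - σ₁) / (σ₃ - σ₁) * σ₃ * bumpPrimitive₂ (σ₃⁻¹ * y)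

variable {σ₁ σ₂ σ₃ : ℝ}

theorem contDiff_tentTest : ContDiff ℝ 2 (tentTest σ₁ σ₂ σ₃) := by
  have h : ∀ σ : ℝ, ContDiff ℝ 2 fun y => bumpPrimitive₂ (σ * y) := fun σ =>
    contDiff_bumpPrimitive₂.comp (contDiff_const.mul contDiff_id)
  exact (((contDiff_const.mul (h _)).sub (contDiff_const.mul (h _))).add
    (contDiff_const.mul (h _)))

/-- The prefactors σ normalise each piece: the second derivative of σ `bumpPrimitive₂` (y/σ) is σ⁻¹
`bumpOneTwo` (y/σ), a weight of σ-independent mass on [σ, 2σ]. Pairing with w² hence compares three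
averages at scales σ₁, σ₂, σ₃. -/
theorem deriv_deriv_tentTest (h₁ : σ₁ ≠ 0) (h₂ : σ₂ ≠ 0) (h₃ : σ₃ ≠ 0) (y : ℝ) :
    deriv (deriv (tentTest σ₁ σ₂ σ₃)) y
      = (σ₃ - σ₂) / (σ₃ - σ₁) * (σ₁⁻¹ * bumpOneTwo (σ₁⁻¹ * y)) - σ₂⁻¹ * bumpOneTwo (σ₂⁻¹ * y)
        + (σ₂ - σ₁) / (σ₃ - σ₁) * (σ₃⁻¹ * bumpOneTwo (σ₃⁻¹ * y)) := by
  have hl : ∀ σ y : ℝ, HasDerivAt (fun y => σ * y) σ y := fun σ y => by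
    simpa using (hasDerivAt_id y).const_mul σ
  have d1 : ∀ σ y : ℝ, HasDerivAt (fun y => bumpPrimitive₂ (σ * y)) (bumpPrimitive (σ * y) * σ) y :=
    fun σ y => (hasDerivAt_bumpPrimitive₂ _).comp y (hl σ y)
  have d2 : ∀ σ y : ℝ, HasDerivAt (fun y => bumpPrimitive (σ * y)) (bumpOneTwo (σ * y) * σ) y :=
    fun σ y => (hasDerivAt_bumpPrimitive _).comp y (hl σ y)
  have e1 : deriv (tentTest σ₁ σ₂ σ₃) = fun y =>
      (σ₃ - σ₂) / (σ₃ - σ₁) * bumpPrimitive (σ₁⁻¹ * y) - bumpPrimitive (σ₂⁻¹ * y)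
        + (σ₂ - σ₁) / (σ₃ - σ₁) * bumpPrimitive (σ₃⁻¹ * y) := by
    funext y
    have h : HasDerivAt (tentTest σ₁ σ₂ σ₃) _ y :=
      ((((d1 σ₁⁻¹ y).const_mul ((σ₃ - σ₂) / (σ₃ - σ₁) * σ₁)).sub ((d1 σ₂⁻¹ y).const_mul σ₂)).add
        ((d1 σ₃⁻¹ y).const_mul ((σ₂ - σ₁) / (σ₃ - σ₁) * σ₃)))
    rw [h.deriv]
    field_simp
  have h : HasDerivAt (fun y => (σ₃ - σ₂) / (σ₃ - σ₁) * bumpPrimitive (σ₁⁻¹ * y)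
      - bumpPrimitive (σ₂⁻¹ * y) + (σ₂ - σ₁) / (σ₃ - σ₁) * bumpPrimitive (σ₃⁻¹ * y)) _ y :=
    (((d2 σ₁⁻¹ y).const_mul ((σ₃ - σ₂) / (σ₃ - σ₁))).sub (d2 σ₂⁻¹ y)).add
        ((d2 σ₃⁻¹ y).const_mul ((σ₂ - σ₁) / (σ₃ - σ₁)))
  rw [e1, h.deriv]
  ring

/-- Jensen's inequality: y/σ₂ is the convex combination of y/σ₁ and y/σ₃ with weights λ₁σ₁/σ₂ and
λ₃σ₃/σ₂, where σ₂ = λ₁σ₁ + λ₃σ₃ and λ₁ + λ₃ = 1. -/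
theorem tentTest_nonneg (h₁ : 0 < σ₁) (h₁₂ : σ₁ < σ₂) (h₂₃ : σ₂ < σ₃) (y : ℝ) :
    0 ≤ tentTest σ₁ σ₂ σ₃ y := by
  have h₂ := h₁.trans h₁₂
  have h₃ := h₂.trans h₂₃
  have h₁₃ : 0 < σ₃ - σ₁ := by linarith
  have h₁₂' : 0 < σ₂ - σ₁ := by linarith
  have h₂₃' : 0 < σ₃ - σ₂ := by linarith
  have hJ := convexOn_bumpPrimitive₂.2 (Set.mem_univ (σ₁⁻¹ * y)) (Set.mem_univ (σ₃⁻¹ * y))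
    (show 0 ≤ (σ₃ - σ₂) / (σ₃ - σ₁) * σ₁ / σ₂ by positivity)
    (show 0 ≤ (σ₂ - σ₁) / (σ₃ - σ₁) * σ₃ / σ₂ by positivity) (by field_simp; ring)
  have e : ((σ₃ - σ₂) / (σ₃ - σ₁) * σ₁ / σ₂) • (σ₁⁻¹ * y)
      + ((σ₂ - σ₁) / (σ₃ - σ₁) * σ₃ / σ₂) • (σ₃⁻¹ * y) = σ₂⁻¹ * y := by
    simp only [smul_eq_mul]; field_simp; ring
  rw [e, smul_eq_mul, smul_eq_mul] at hJ
  have := mul_le_mul_of_nonneg_left hJ h₂.le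
  unfold tentTest
  have e2 : σ₂ * ((σ₃ - σ₂) / (σ₃ - σ₁) * σ₁ / σ₂ * bumpPrimitive₂ (σ₁⁻¹ * y)
      + (σ₂ - σ₁) / (σ₃ - σ₁) * σ₃ / σ₂ * bumpPrimitive₂ (σ₃⁻¹ * y))
      = (σ₃ - σ₂) / (σ₃ - σ₁) * σ₁ * bumpPrimitive₂ (σ₁⁻¹ * y)
        + (σ₂ - σ₁) / (σ₃ - σ₁) * σ₃ * bumpPrimitive₂ (σ₃⁻¹ * y) := by
    field_simp
  rw [e2] at this
  linarith

/-- Below σ₁ all three pieces vanish. Above 2σ₃ all are affine, with a common slope and with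
constant terms proportional to σ, so λ₁ + λ₃ = 1 and λ₁σ₁ + λ₃σ₃ = σ₂ cancel both parts. -/
theorem tentTest_eq_zero (h₁ : 0 < σ₁) (h₁₂ : σ₁ < σ₂) (h₂₃ : σ₂ < σ₃) {y : ℝ}
    (hy : y ∉ Set.Icc σ₁ (2 * σ₃)) : tentTest σ₁ σ₂ σ₃ y = 0 := by
  have h₂ := h₁.trans h₁₂
  have h₃ := h₂.trans h₂₃
  have h₁₃ : σ₃ - σ₁ ≠ 0 := by linarith
  unfold tentTest
  rcases lt_or_ge y σ₁ with h | h
  · have : ∀ σ, 0 < σ → y ≤ σ → σ⁻¹ * y ≤ 1 := fun σ hσ h => by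
      rw [inv_mul_le_iff₀ hσ]; linarith
    rw [bumpPrimitive₂_of_le (this σ₁ h₁ h.le), bumpPrimitive₂_of_le (this σ₂ h₂ (by linarith)),
      bumpPrimitive₂_of_le (this σ₃ h₃ (by linarith))]
    ring
  · have hy2 : 2 * σ₃ ≤ y := by
      by_contra h'
      exact hy ⟨h, by linarith⟩
    have : ∀ σ, 0 < σ → 2 * σ ≤ y → 2 ≤ σ⁻¹ * y := fun σ hσ h => by
      rw [le_inv_mul_iff₀ hσ]; linarith
    rw [bumpPrimitive₂_of_ge (this σ₁ h₁ (by linarith)),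
      bumpPrimitive₂_of_ge (this σ₂ h₂ (by linarith)), bumpPrimitive₂_of_ge (this σ₃ h₃ hy2)]
    field_simp
    ring

variable {n : ℕ}

/-- A harmonic function on the half-space with bounded slices in `L²` that tend to zero in `L²` at
the boundary vanishes. -/
theorem eq_zero_of_harmonic_of_tendsto_zero {w : EuclideanSpace ℝ (Fin (n + 1)) → ℝ}
    (hw : ContDiffOn ℝ 2 w (upperHalf n))
    (hharm : ∀ p ∈ upperHalf n, ∑ i, fderiv ℝ (fun z => fderiv ℝ w z (EuclideanSpace.single i 1)) p
      (EuclideanSpace.single i 1) = 0) {C : ℝ≥0∞} (hC : C ≠ ∞)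
    (hb : ∀ y, 0 < y → ∫⁻ x, ‖w (upperPoint x y)‖ₑ ^ 2 ≤ C)
    (h0 : Tendsto (fun y => ∫⁻ x, ‖w (upperPoint x y)‖ₑ ^ 2) (𝓝[>] 0) (𝓝 0)) :
    ∀ p ∈ upperHalf n, w p = 0 := by
  have hproj : Continuous fun p : EuclideanSpace ℝ (Fin (n + 1)) => p 0 :=
    (EuclideanSpace.proj (0 : Fin (n + 1))).continuous
  -- Up to a fixed constant, T σ averages the slice integrals of w² over heights in [σ, 2σ].
  -- Convexity is known only weakly, so it is exploited through these averages.
  set T : ℝ → ℝ := fun σ => ∫ p, w p ^ 2 * (σ⁻¹ * bumpOneTwo (σ⁻¹ * p 0)) with hT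
  have hsupp : ∀ σ : ℝ, 0 < σ → ∀ y ∉ Set.Icc σ (2 * σ), bumpOneTwo (σ⁻¹ * y) = 0 := by
    intro σ hσ y hy
    rcases lt_or_ge y σ with h | h
    · exact bumpOneTwo_of_le (by rw [inv_mul_le_iff₀ hσ]; linarith)
    · refine bumpOneTwo_of_ge ?_
      rw [le_inv_mul_iff₀ hσ]
      by_contra h'
      exact hy ⟨h, by linarith⟩
  have hint : ∀ σ : ℝ, 0 < σ →
      Integrable fun p => w p ^ 2 * (σ⁻¹ * bumpOneTwo (σ⁻¹ * p 0)) := by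
    intro σ hσ
    refine integrable_sq_mul_of_strip hw.continuousOn hσ hC
      (fun y hy => hb y (hσ.trans_le hy.1)) (β := 2 * σ) (B := σ⁻¹)
      (continuous_const.mul (continuous_bumpOneTwo.comp (continuous_const.mul hproj))) ?_ ?_
    · intro p
      rw [norm_mul, Real.norm_of_nonneg (inv_nonneg.2 hσ.le),
        Real.norm_of_nonneg (bumpOneTwo_nonneg _)]
      exact mul_le_of_le_one_right (inv_nonneg.2 hσ.le) (bumpOneTwo_le_one _)
    · intro p hp
      rw [hsupp σ hσ _ hp, mul_zero]
  have hTle : ∀ σ B : ℝ, 0 < σ → 0 ≤ B →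
      (∀ y ∈ Set.Icc σ (2 * σ), ∫⁻ x, ‖w (upperPoint x y)‖ₑ ^ 2 ≤ ENNReal.ofReal B) → T σ ≤ B := by
    intro σ B hσ hB h
    have := integral_sq_mul_le_of_strip hw.continuousOn hσ (by linarith) hB h
      (κ := fun y => bumpOneTwo (σ⁻¹ * y)) (fun _ => bumpOneTwo_nonneg _)
      (fun _ => bumpOneTwo_le_one _) (hsupp σ hσ)
    have e : T σ = σ⁻¹ * ∫ p, w p ^ 2 * bumpOneTwo (σ⁻¹ * p 0) := by
      rw [hT, ← integral_const_mul]
      exact integral_congr_ae (Eventually.of_forall fun p => by ring)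
    rw [e, inv_mul_le_iff₀ hσ]
    linarith
  have hT0 : ∀ σ, 0 < σ → 0 ≤ T σ := fun σ hσ => integral_nonneg fun p =>
    mul_nonneg (sq_nonneg _) (mul_nonneg (inv_nonneg.2 hσ.le) (bumpOneTwo_nonneg _))
  -- Three-point convexity of T, obtained by inserting `tentTest` into the weak inequality.
  have hconv : ∀ σ₁ σ₂ σ₃ : ℝ, 0 < σ₁ → σ₁ < σ₂ → σ₂ < σ₃ →
      T σ₂ ≤ (σ₃ - σ₂) / (σ₃ - σ₁) * T σ₁ + (σ₂ - σ₁) / (σ₃ - σ₁) * T σ₃ := by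
    intro σ₁ σ₂ σ₃ h₁ h₁₂ h₂₃
    have h₂ := h₁.trans h₁₂
    have h₃ := h₂.trans h₂₃
    have h := integral_sq_mul_deriv_deriv_nonneg hw hharm h₁ hC
      (fun y hy => hb y (h₁.trans_le hy.1)) contDiff_tentTest
      (tentTest_nonneg h₁ h₁₂ h₂₃) (fun y hy => tentTest_eq_zero h₁ h₁₂ h₂₃ hy)
    simp_rw [deriv_deriv_tentTest h₁.ne' h₂.ne' h₃.ne'] at h
    have e : ∫ p, w p ^ 2 * ((σ₃ - σ₂) / (σ₃ - σ₁) * (σ₁⁻¹ * bumpOneTwo (σ₁⁻¹ * p 0))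
        - σ₂⁻¹ * bumpOneTwo (σ₂⁻¹ * p 0)
        + (σ₂ - σ₁) / (σ₃ - σ₁) * (σ₃⁻¹ * bumpOneTwo (σ₃⁻¹ * p 0)))
        = (σ₃ - σ₂) / (σ₃ - σ₁) * T σ₁ - T σ₂ + (σ₂ - σ₁) / (σ₃ - σ₁) * T σ₃ := by
      have hs : Integrable fun p =>
          (σ₃ - σ₂) / (σ₃ - σ₁) * (w p ^ 2 * (σ₁⁻¹ * bumpOneTwo (σ₁⁻¹ * p 0)))
            - w p ^ 2 * (σ₂⁻¹ * bumpOneTwo (σ₂⁻¹ * p 0)) :=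
        ((hint σ₁ h₁).const_mul _).sub (hint σ₂ h₂)
      rw [hT, ← integral_const_mul, ← integral_const_mul, ← integral_sub
        ((hint σ₁ h₁).const_mul _) (hint σ₂ h₂), ← integral_add hs ((hint σ₃ h₃).const_mul _)]
      exact integral_congr_ae (Eventually.of_forall fun p => by ring)
    rw [e] at h
    linarith
  have hTzero : ∀ σ, 0 < σ → T σ = 0 := by
    intro σ hσ
    -- A convex function that is small near 0 and bounded at infinity is small everywhere: compare σ
    -- with a very small σ₁ and a very large σ₃.
    refine le_antisymm (le_of_forall_pos_le_add fun ε hε => ?_) (hT0 σ hσ)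
    set M := C.toReal
    have hM0 : 0 ≤ M := ENNReal.toReal_nonneg
    have hM : ENNReal.ofReal M = C := ENNReal.ofReal_toReal hC
    have hev : ∀ᶠ y in 𝓝[>] (0 : ℝ),
        ∫⁻ x, ‖w (upperPoint x y)‖ₑ ^ 2 ≤ ENNReal.ofReal (ε / 2) :=
      h0.eventually_le_const (ENNReal.ofReal_pos.2 (by positivity))
    obtain ⟨δ, hδ, hδ'⟩ := (mem_nhdsGT_iff_exists_Ioc_subset).1 hev
    have hδ : 0 < δ := hδ
    -- With 2σ₁ ≤ δ the average at scale σ₁ only involves slices that are already below ε/2.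
    set σ₁ := min (δ / 2) (σ / 2)
    have h₁ : 0 < σ₁ := by positivity
    have h₁₂ : σ₁ < σ := (min_le_right _ _).trans_lt (by linarith)
    have hδ₁ : 2 * σ₁ ≤ δ := by linarith [min_le_left (δ / 2) (σ / 2)]
    -- Large enough that σM/(σ₃ - σ₁) ≤ ε/2; the final 1 keeps σ < σ₃ when M = 0.
    set σ₃ := σ + σ * M / (ε / 2) + 1
    have h₂₃ : σ < σ₃ := by
      have : 0 ≤ σ * M / (ε / 2) := by positivity
      simp only [σ₃]; linarith
    have hT1 : T σ₁ ≤ ε / 2 := hTle σ₁ _ h₁ (by positivity) fun y hy =>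
      hδ' ⟨h₁.trans_le hy.1, hy.2.trans hδ₁⟩
    have hT3 : T σ₃ ≤ M := hTle σ₃ M (hσ.trans h₂₃) hM0 fun y hy =>
      hM ▸ hb y ((hσ.trans h₂₃).trans_le hy.1)
    refine (hconv σ₁ σ σ₃ h₁ h₁₂ h₂₃).trans ?_
    have hd : 0 < σ₃ - σ₁ := by linarith
    have ha : (σ₃ - σ) / (σ₃ - σ₁) * T σ₁ ≤ ε / 2 := by
      refine (mul_le_of_le_one_left (hT0 _ h₁) ?_).trans hT1
      rw [div_le_one hd]; linarith
    have hb' : (σ - σ₁) / (σ₃ - σ₁) * T σ₃ ≤ ε / 2 := by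
      have h1 : 0 ≤ (σ - σ₁) / (σ₃ - σ₁) := div_nonneg (by linarith) hd.le
      refine (mul_le_mul_of_nonneg_left hT3 h1).trans ?_
      rw [div_mul_eq_mul_div, div_le_iff₀ hd]
      have e : ε / 2 * (σ * M / (ε / 2)) = σ * M := by field_simp
      have h2 : ε / 2 * (σ * M / (ε / 2)) ≤ ε / 2 * (σ₃ - σ₁) :=
        mul_le_mul_of_nonneg_left (by simp only [σ₃]; linarith) (by positivity)
      nlinarith
    linarith
  intro p hp
  have hp0 : 0 < p 0 := hp
  -- At this scale p 0 / σ = 3/2, inside the interval where the bump is strictly positive. Vanishing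
  -- of the average gives vanishing almost everywhere, and continuity gives it at p.
  have hσ : 0 < p 0 * (2 / 3) := by positivity
  have hae := (integral_eq_zero_iff_of_nonneg (fun q => mul_nonneg (sq_nonneg (w q))
    (mul_nonneg (inv_nonneg.2 hσ.le) (bumpOneTwo_nonneg _))) (hint _ hσ)).1 (hTzero _ hσ)
  set σ := p 0 * (2 / 3)
  have hcont : ContinuousOn (fun q : EuclideanSpace ℝ (Fin (n + 1)) =>
      w q ^ 2 * (σ⁻¹ * bumpOneTwo (σ⁻¹ * q 0))) (upperHalf n) :=
    (hw.continuousOn.pow 2).mul (continuous_const.mul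
      (continuous_bumpOneTwo.comp (continuous_const.mul hproj))).continuousOn
  have heq := Measure.eqOn_open_of_ae_eq (ae_restrict_of_ae hae) isOpen_upperHalf hcont
    continuousOn_const hp
  have hval : σ⁻¹ * p 0 = 3 / 2 := by simp only [σ]; field_simp
  have hne : σ⁻¹ * bumpOneTwo (σ⁻¹ * p 0) ≠ 0 := by
    rw [hval]
    refine mul_ne_zero (inv_ne_zero hσ.ne') ?_
    unfold bumpOneTwo
    norm_num
  simpa [hne] using (mul_eq_zero.1 heq).resolve_right hne

end Uniqueness
/-! ### Harmonic extension through the Fourier transform -/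

section FourierExtension

variable {n : ℕ}

/-- The linear functional `(x, y) ↦ -2π|t|y - 2πi⟨t, x⟩`. -/
def phase (t : EuclideanSpace ℝ (Fin n)) : EuclideanSpace ℝ (Fin (n + 1)) →L[ℝ] ℂ :=
  Complex.ofRealCLM.comp ((-(2 * Real.pi * ‖t‖)) • EuclideanSpace.proj (0 : Fin (n + 1)))
    - Complex.I • Complex.ofRealCLM.comp
      ((2 * Real.pi) • (innerSL ℝ t).comp (horizontalCLM n))

theorem phase_apply (t : EuclideanSpace ℝ (Fin n)) (p : EuclideanSpace ℝ (Fin (n + 1))) :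
    phase t p = ((-(2 * Real.pi * ‖t‖ * p 0) : ℝ) : ℂ)
      - Complex.I * ((2 * Real.pi * inner ℝ t (horizontal p) : ℝ) : ℂ) := by
  simp [phase]

theorem phase_single_zero (t : EuclideanSpace ℝ (Fin n)) :
    phase t (EuclideanSpace.single 0 1) = ((-(2 * Real.pi * ‖t‖) : ℝ) : ℂ) := by
  simp [phase_apply]

theorem phase_single_succ (t : EuclideanSpace ℝ (Fin n)) (k : Fin n) :
    phase t (EuclideanSpace.single k.succ 1) = -Complex.I * ((2 * Real.pi * t k : ℝ) : ℂ) := by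
  simp [phase_apply, EuclideanSpace.inner_single_right]

theorem norm_horizontal_le (p : EuclideanSpace ℝ (Fin (n + 1))) : ‖horizontal p‖ ≤ ‖p‖ := by
  rw [EuclideanSpace.norm_eq, EuclideanSpace.norm_eq]
  refine Real.sqrt_le_sqrt ?_
  rw [Fin.sum_univ_succ]
  simpa using sq_nonneg (p 0)

theorem norm_phase_le (t : EuclideanSpace ℝ (Fin n)) : ‖phase t‖ ≤ 4 * Real.pi * ‖t‖ := by
  refine ContinuousLinearMap.opNorm_le_bound _ (by positivity) fun p => ?_
  rw [phase_apply]
  refine (norm_sub_le _ _).trans ?_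
  rw [norm_mul, Complex.norm_I, one_mul, Complex.norm_real, Complex.norm_real, norm_neg, norm_mul,
    norm_mul (2 * Real.pi) (inner ℝ t _), Real.norm_of_nonneg (by positivity : 0 ≤ 2 * Real.pi * ‖t‖),
    Real.norm_of_nonneg (by positivity : 0 ≤ 2 * Real.pi)]
  have h1 : ‖p 0‖ ≤ ‖p‖ := PiLp.norm_apply_le p 0
  have h2 : ‖inner ℝ t (horizontal p)‖ ≤ ‖t‖ * ‖p‖ :=
    (norm_inner_le_norm _ _).trans (mul_le_mul_of_nonneg_left (norm_horizontal_le p) (norm_nonneg _))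
  have h3 := mul_le_mul_of_nonneg_left h1 (by positivity : 0 ≤ 2 * Real.pi * ‖t‖)
  have h4 := mul_le_mul_of_nonneg_left h2 (by positivity : 0 ≤ 2 * Real.pi)
  nlinarith

theorem norm_exp_phase (t : EuclideanSpace ℝ (Fin n)) (p : EuclideanSpace ℝ (Fin (n + 1))) :
    ‖Complex.exp (phase t p)‖ = Real.exp (-(2 * Real.pi * ‖t‖ * p 0)) := by
  rw [Complex.norm_exp, phase_apply]
  simp

theorem continuous_phase : Continuous (phase (n := n)) := by
  unfold phase
  have h1 : Continuous fun t : EuclideanSpace ℝ (Fin n) =>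
      (-(2 * Real.pi * ‖t‖)) • (EuclideanSpace.proj (0 : Fin (n + 1)) : _ →L[ℝ] ℝ) := by fun_prop
  have h2 : Continuous fun t : EuclideanSpace ℝ (Fin n) =>
      (2 * Real.pi) • (innerSL ℝ t).comp (horizontalCLM n) :=
    continuous_const.smul (f := fun _ => 2 * Real.pi)
      (g := fun t => (innerSL ℝ t).comp (horizontalCLM n))
      ((innerSL ℝ).continuous.clm_comp continuous_const)
  exact (continuous_const.clm_comp h1).sub (continuous_const.smul (f := fun _ => Complex.I)
    (g := fun t => Complex.ofRealCLM.comp ((2 * Real.pi) • (innerSL ℝ t).comp (horizontalCLM n)))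
    (continuous_const.clm_comp h2))

/-- Symbols whose growth is beaten by every exponential `e^{-ε|t|}`. -/
def IsSymbol (g : EuclideanSpace ℝ (Fin n) → ℂ) : Prop :=
  AEStronglyMeasurable g ∧ ∀ ε : ℝ, 0 < ε → Integrable fun t => Real.exp (-(ε * ‖t‖)) * ‖g t‖

/-- `V_g(x, y) = ∫ e^{-2πi⟨t, x⟩ - 2π|t|y} g(t) dt`. -/
def fourierExtension (g : EuclideanSpace ℝ (Fin n) → ℂ) (p : EuclideanSpace ℝ (Fin (n + 1))) : ℂ :=
  ∫ t, Complex.exp (phase t p) * g t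

theorem norm_mul_exp_neg_le {ε : ℝ} (hε : 0 < ε) {s : ℝ} :
    s * Real.exp (-(ε * s)) ≤ 2 / ε * Real.exp (-(ε / 2 * s)) := by
  have h1 : ε / 2 * s ≤ Real.exp (ε / 2 * s) := by linarith [Real.add_one_le_exp (ε / 2 * s)]
  have h2 : Real.exp (-(ε / 2 * s)) = Real.exp (ε / 2 * s) * Real.exp (-(ε * s)) := by
    rw [← Real.exp_add]; ring_nf
  rw [h2, ← mul_assoc]
  refine mul_le_mul_of_nonneg_right ?_ (Real.exp_pos _).le
  have := mul_le_mul_of_nonneg_left h1 (by positivity : 0 ≤ 2 / ε)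
  calc s = 2 / ε * (ε / 2 * s) := by field_simp
    _ ≤ _ := this

/-- Half of the exponential weight absorbs the linear growth of `phase`, so the class of symbols is
stable under the multipliers produced by differentiation. -/
theorem IsSymbol.phase_mul {g : EuclideanSpace ℝ (Fin n) → ℂ} (hg : IsSymbol g)
    (v : EuclideanSpace ℝ (Fin (n + 1))) : IsSymbol fun t => phase t v * g t := by
  have hm : AEStronglyMeasurable (fun t => phase (n := n) t v * g t) :=
    (continuous_phase.clm_apply continuous_const).aestronglyMeasurable.mul hg.1
  refine ⟨hm, fun ε hε => ?_⟩
  refine Integrable.mono' ((hg.2 (ε / 2) (by positivity)).const_mul (4 * Real.pi * ‖v‖ * (2 / ε)))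
    ((Continuous.aestronglyMeasurable (by fun_prop)).mul hm.norm) (Eventually.of_forall fun t => ?_)
  rw [norm_mul, norm_norm, norm_mul, Real.norm_of_nonneg (Real.exp_pos _).le]
  have h1 : ‖phase t v‖ ≤ 4 * Real.pi * ‖t‖ * ‖v‖ :=
    ((phase t).le_opNorm v).trans (mul_le_mul_of_nonneg_right (norm_phase_le t) (norm_nonneg _))
  have h2 := norm_mul_exp_neg_le hε (s := ‖t‖)
  calc Real.exp (-(ε * ‖t‖)) * (‖phase t v‖ * ‖g t‖)
      ≤ Real.exp (-(ε * ‖t‖)) * (4 * Real.pi * ‖t‖ * ‖v‖ * ‖g t‖) := by gcongr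
    _ = 4 * Real.pi * ‖v‖ * ‖g t‖ * (‖t‖ * Real.exp (-(ε * ‖t‖))) := by ring
    _ ≤ 4 * Real.pi * ‖v‖ * ‖g t‖ * (2 / ε * Real.exp (-(ε / 2 * ‖t‖))) := by gcongr
    _ = _ := by ring

theorem IsSymbol.integrable {g : EuclideanSpace ℝ (Fin n) → ℂ} (hg : IsSymbol g)
    {p : EuclideanSpace ℝ (Fin (n + 1))} (hp : p ∈ upperHalf n) :
    Integrable fun t => Complex.exp (phase t p) * g t := by
  have hp0 : 0 < p 0 := hp
  have hc : Continuous fun t : EuclideanSpace ℝ (Fin n) => Complex.exp (phase t p) :=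
    Complex.continuous_exp.comp (continuous_phase.clm_apply continuous_const)
  refine Integrable.mono' (hg.2 (2 * Real.pi * p 0) (by positivity))
    (hc.aestronglyMeasurable.mul hg.1) (Eventually.of_forall fun t => ?_)
  rw [norm_mul, norm_exp_phase]
  exact le_of_eq (by ring_nf)

theorem hasFDerivAt_fourierExtension {g : EuclideanSpace ℝ (Fin n) → ℂ} (hg : IsSymbol g)
    {p : EuclideanSpace ℝ (Fin (n + 1))} (hp : p ∈ upperHalf n) :
    Integrable (fun t => (Complex.exp (phase t p) * g t) • phase t) ∧
    HasFDerivAt (fourierExtension g) (∫ t, (Complex.exp (phase t p) * g t) • phase t) p := by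
  have hp0 : 0 < p 0 := hp
  have hc : ∀ p : EuclideanSpace ℝ (Fin (n + 1)),
      Continuous fun t : EuclideanSpace ℝ (Fin n) => Complex.exp (phase t p) := fun p =>
    Complex.continuous_exp.comp (continuous_phase.clm_apply continuous_const)
  have hF' : ∀ q : EuclideanSpace ℝ (Fin (n + 1)),
      AEStronglyMeasurable (fun t => (Complex.exp (phase t q) * g t) • phase t) := fun q =>
    ((hc q).aestronglyMeasurable.mul hg.1).smul continuous_phase.aestronglyMeasurable
  -- On this ball the height stays above p 0 / 2, which leaves the factor e^{-πp₀|t|}, p₀ being the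
  -- height of p. Half of that decay pays for ‖`phase t`‖ and the rest is integrable against g.
  have hbound : ∀ t : EuclideanSpace ℝ (Fin n), ∀ q ∈ Metric.ball p (p 0 / 2),
      ‖(Complex.exp (phase t q) * g t) • phase t‖
        ≤ 4 * Real.pi * (2 / (Real.pi * p 0))
          * (Real.exp (-(Real.pi * p 0 / 2 * ‖t‖)) * ‖g t‖) := by
    intro t q hq
    have hq0 : p 0 / 2 ≤ q 0 := by
      have h1 : ‖(q - p) 0‖ ≤ ‖q - p‖ := PiLp.norm_apply_le (q - p) 0
      rw [Metric.mem_ball, dist_eq_norm] at hq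
      have := (abs_le.1 (h1.trans hq.le)).1
      simp only [PiLp.sub_apply] at this
      linarith
    rw [norm_smul, norm_mul, norm_exp_phase]
    calc Real.exp (-(2 * Real.pi * ‖t‖ * q 0)) * ‖g t‖ * ‖phase t‖
        ≤ Real.exp (-(Real.pi * p 0 * ‖t‖)) * ‖g t‖ * (4 * Real.pi * ‖t‖) := by
          refine mul_le_mul (mul_le_mul_of_nonneg_right (Real.exp_le_exp.2 ?_) (norm_nonneg _))
            (norm_phase_le t) (norm_nonneg _) (by positivity)
          have := mul_le_mul_of_nonneg_left hq0 (by positivity : 0 ≤ 2 * Real.pi * ‖t‖)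
          linarith
      _ = 4 * Real.pi * ‖g t‖ * (‖t‖ * Real.exp (-(Real.pi * p 0 * ‖t‖))) := by ring
      _ ≤ 4 * Real.pi * ‖g t‖
          * (2 / (Real.pi * p 0) * Real.exp (-(Real.pi * p 0 / 2 * ‖t‖))) := by
          exact mul_le_mul_of_nonneg_left (norm_mul_exp_neg_le (by positivity)) (by positivity)
      _ = _ := by ring
  have hbi : Integrable fun t => 4 * Real.pi * (2 / (Real.pi * p 0))
      * (Real.exp (-(Real.pi * p 0 / 2 * ‖t‖)) * ‖g t‖) :=
    (hg.2 (Real.pi * p 0 / 2) (by positivity)).const_mul _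
  refine ⟨hbi.mono' (hF' p) (Eventually.of_forall fun t =>
    hbound t p (Metric.mem_ball_self (by positivity))), ?_⟩
  refine hasFDerivAt_integral_of_dominated_of_fderiv_le
    (F' := fun q t => (Complex.exp (phase t q) * g t) • phase t)
    (Metric.ball_mem_nhds p (by positivity : 0 < p 0 / 2))
    (Eventually.of_forall fun q => (hc q).aestronglyMeasurable.mul hg.1) (hg.integrable hp)
    (hF' p) (Eventually.of_forall hbound) hbi (Eventually.of_forall fun t q _ => ?_)
  have h := ((phase t).hasFDerivAt (x := q)).cexp.mul_const (g t)
  refine h.congr_fderiv ?_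
  ext v
  simp; ring

/-- Since the derivative is again an extension of a symbol, smoothness of every order and the
Laplace equation follow by iteration. -/
theorem fderiv_fourierExtension_apply {g : EuclideanSpace ℝ (Fin n) → ℂ} (hg : IsSymbol g)
    (v : EuclideanSpace ℝ (Fin (n + 1))) {p : EuclideanSpace ℝ (Fin (n + 1))}
    (hp : p ∈ upperHalf n) :
    fderiv ℝ (fourierExtension g) p v = fourierExtension (fun t => phase t v * g t) p := by
  obtain ⟨hi, hd⟩ := hasFDerivAt_fourierExtension hg hp
  rw [hd.fderiv, ContinuousLinearMap.integral_apply hi]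
  refine integral_congr_ae (Eventually.of_forall fun t => ?_)
  simp; ring

theorem contDiffOn_fourierExtension {g : EuclideanSpace ℝ (Fin n) → ℂ} (hg : IsSymbol g) (m : ℕ) :
    ContDiffOn ℝ m (fourierExtension g) (upperHalf n) := by
  induction m generalizing g with
  | zero =>
    refine contDiffOn_zero.2 fun p hp => ?_
    exact (hasFDerivAt_fourierExtension hg hp).2.continuousAt.continuousWithinAt
  | succ m ih =>
    push_cast
    refine (contDiffOn_succ_iff_fderiv_of_isOpen isOpen_upperHalf).2 ⟨fun p hp =>
      (hasFDerivAt_fourierExtension hg hp).2.differentiableAt.differentiableWithinAt, by simp, ?_⟩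
    refine contDiffOn_clm_apply.2 fun v => ?_
    exact (ih (hg.phase_mul v)).congr fun p hp => fderiv_fourierExtension_apply hg v hp

/-- The vertical component contributes 4π²|t|² and the horizontal, imaginary ones -4π²|t|². Hence
every exponential e^{`phase t`} is harmonic. -/
theorem sum_phase_sq (t : EuclideanSpace ℝ (Fin n)) :
    ∑ i, phase t (EuclideanSpace.single i 1) * phase t (EuclideanSpace.single i 1) = 0 := by
  rw [Fin.sum_univ_succ, phase_single_zero]
  simp_rw [phase_single_succ]
  have h1 : ∀ k, -Complex.I * ((2 * Real.pi * t k : ℝ) : ℂ)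
      * (-Complex.I * ((2 * Real.pi * t k : ℝ) : ℂ))
      = ((-(4 * Real.pi ^ 2) * (t k) ^ 2 : ℝ) : ℂ) := fun k => by
    have := Complex.I_mul_I
    push_cast
    linear_combination (4 * (Real.pi : ℂ) ^ 2 * (t k : ℂ) ^ 2) * this
  simp_rw [h1]
  rw [← Complex.ofReal_sum, ← Finset.mul_sum, ← Complex.ofReal_mul, ← Complex.ofReal_add]
  have h2 : ∑ k, t k ^ 2 = ‖t‖ ^ 2 := (EuclideanSpace.real_norm_sq_eq t).symm
  rw [h2, Complex.ofReal_eq_zero]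
  ring

theorem sum_fderiv_fderiv_fourierExtension {g : EuclideanSpace ℝ (Fin n) → ℂ} (hg : IsSymbol g)
    {p : EuclideanSpace ℝ (Fin (n + 1))} (hp : p ∈ upperHalf n) :
    ∑ i, fderiv ℝ (fun z => fderiv ℝ (fourierExtension g) z (EuclideanSpace.single i 1)) p
      (EuclideanSpace.single i 1) = 0 := by
  have h : ∀ i : Fin (n + 1),
      fderiv ℝ (fun z => fderiv ℝ (fourierExtension g) z (EuclideanSpace.single i 1)) p
        (EuclideanSpace.single i 1)
      = ∫ t, Complex.exp (phase t p) * (phase t (EuclideanSpace.single i 1)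
          * (phase t (EuclideanSpace.single i 1) * g t)) := fun i => by
    have he : (fun z => fderiv ℝ (fourierExtension g) z (EuclideanSpace.single i 1)) =ᶠ[𝓝 p]
        fourierExtension (fun t => phase t (EuclideanSpace.single i 1) * g t) := by
      filter_upwards [isOpen_upperHalf.mem_nhds hp] with z hz
      exact fderiv_fourierExtension_apply hg _ hz
    rw [he.fderiv_eq, fderiv_fourierExtension_apply (hg.phase_mul _) _ hp]
    rfl
  simp_rw [h]
  rw [← integral_finsetSum _ fun i _ => ((hg.phase_mul _).phase_mul _).integrable hp]
  refine integral_eq_zero_of_ae (Eventually.of_forall fun t => ?_)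
  have : ∀ i : Fin (n + 1), Complex.exp (phase t p) * (phase t (EuclideanSpace.single i 1)
          * (phase t (EuclideanSpace.single i 1) * g t))
      = phase t (EuclideanSpace.single i 1) * phase t (EuclideanSpace.single i 1)
        * (Complex.exp (phase t p) * g t) := fun i => by ring
  simp only [this, ← Finset.sum_mul, sum_phase_sq, zero_mul, Pi.zero_apply]

end FourierExtension
/-! ### Plancherel on horizontal slices -/

section Slices

variable {n : ℕ}

theorem integrable_exp_neg_mul_norm {ε : ℝ} (hε : 0 < ε) :
    Integrable fun t : EuclideanSpace ℝ (Fin n) => Real.exp (-(ε * ‖t‖)) := by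
  have h0 : Integrable fun t : EuclideanSpace ℝ (Fin n) =>
      (1 + ‖t‖) ^ (-((n : ℝ) + 1)) := by
    refine integrable_one_add_norm ?_
    simp
  obtain ⟨C, hC⟩ : ∃ C : ℝ, ∀ s : ℝ, 0 ≤ s → Real.exp (-(ε * s)) * (1 + s) ^ (n + 1) ≤ C := by
    have hb : ∀ k : ℕ, ∀ s : ℝ, 0 ≤ s →
        Real.exp (-(ε * s)) * (1 + s) ^ k ≤ Real.exp ε * (k.factorial / ε ^ k) := by
      intro k s hs
      have h1 := Real.pow_div_factorial_le_exp (x := ε * (1 + s)) (by positivity) k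
      have h2 : Real.exp (-(ε * s)) = Real.exp ε * Real.exp (-(ε * (1 + s))) := by
        rw [← Real.exp_add]; ring_nf
      have h3 : Real.exp (-(ε * (1 + s))) * Real.exp (ε * (1 + s)) = 1 := by
        rw [← Real.exp_add]; simp
      rw [h2, mul_assoc]
      refine mul_le_mul_of_nonneg_left ?_ (Real.exp_pos _).le
      have h4 : (1 + s) ^ k = (ε * (1 + s)) ^ k / k.factorial * (k.factorial / ε ^ k) := by
        rw [mul_pow]
        have := Nat.factorial_ne_zero k
        field_simp
      rw [h4, ← mul_assoc]
      refine mul_le_of_le_one_left (by positivity) ?_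
      calc _ ≤ Real.exp (-(ε * (1 + s))) * Real.exp (ε * (1 + s)) :=
            mul_le_mul_of_nonneg_left h1 (Real.exp_pos _).le
        _ = 1 := h3
    exact ⟨_, hb (n + 1)⟩
  refine (h0.const_mul C).mono' (Continuous.aestronglyMeasurable (by fun_prop))
    (Eventually.of_forall fun t => ?_)
  rw [Real.norm_of_nonneg (Real.exp_pos _).le, Real.rpow_neg (by positivity),
    ← div_eq_mul_inv, le_div_iff₀ (by positivity)]
  have := hC ‖t‖ (norm_nonneg t)
  exact_mod_cast this

theorem memLp_two_exp_neg_mul_norm {ε : ℝ} (hε : 0 < ε) :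
    MemLp (fun t : EuclideanSpace ℝ (Fin n) => Real.exp (-(ε * ‖t‖))) 2 := by
  refine (memLp_two_iff_integrable_sq (Continuous.aestronglyMeasurable (by fun_prop))).2 ?_
  refine (integrable_exp_neg_mul_norm (n := n) (mul_pos two_pos hε)).congr
    (Eventually.of_forall fun t => ?_)
  simp only [← Real.exp_nat_mul]
  congr 1; push_cast; ring

/-- Cauchy-Schwarz, the exponential weight being itself square integrable. -/
theorem MeasureTheory.MemLp.isSymbol {g : EuclideanSpace ℝ (Fin n) → ℂ} (hg : MemLp g 2) :
    IsSymbol g :=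
  ⟨hg.1, fun _ hε => (memLp_two_exp_neg_mul_norm hε).integrable_mul hg.norm⟩

theorem memLp_exp_mul {g : EuclideanSpace ℝ (Fin n) → ℂ} (hg : MemLp g 2) {y : ℝ} (hy : 0 < y) :
    MemLp (fun t => (Real.exp (-(2 * Real.pi * y * ‖t‖)) : ℂ) * g t) 2 := by
  have hc : Continuous fun t : EuclideanSpace ℝ (Fin n) =>
      (Real.exp (-(2 * Real.pi * y * ‖t‖)) : ℂ) := by fun_prop
  refine hg.mono (hc.aestronglyMeasurable.mul hg.1) (Eventually.of_forall fun t => ?_)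
  rw [norm_mul, Complex.norm_real, Real.norm_of_nonneg (Real.exp_pos _).le]
  refine mul_le_of_le_one_left (norm_nonneg _) (Real.exp_le_one_iff.2 ?_)
  have : 0 ≤ 2 * Real.pi * y * ‖t‖ := by positivity
  linarith

theorem IsSymbol.integrable_exp_mul {g : EuclideanSpace ℝ (Fin n) → ℂ} (hg : IsSymbol g) {y : ℝ}
    (hy : 0 < y) : Integrable fun t => (Real.exp (-(2 * Real.pi * y * ‖t‖)) : ℂ) * g t := by
  have hc : Continuous fun t : EuclideanSpace ℝ (Fin n) =>
      (Real.exp (-(2 * Real.pi * y * ‖t‖)) : ℂ) := by fun_prop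
  refine (hg.2 (2 * Real.pi * y) (by positivity)).mono' (hc.aestronglyMeasurable.mul hg.1)
    (Eventually.of_forall fun t => ?_)
  rw [norm_mul, Complex.norm_real, Real.norm_of_nonneg (Real.exp_pos _).le]

theorem memLp_exp_mul_phase {g : EuclideanSpace ℝ (Fin n) → ℂ} (hg : MemLp g 2) {y : ℝ}
    (hy : 0 < y) (v : EuclideanSpace ℝ (Fin (n + 1))) :
    MemLp (fun t => (Real.exp (-(2 * Real.pi * y * ‖t‖)) : ℂ) * (phase t v * g t)) 2 := by
  have hc : Continuous fun t : EuclideanSpace ℝ (Fin n) =>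
      (Real.exp (-(2 * Real.pi * y * ‖t‖)) : ℂ) := by fun_prop
  refine hg.of_le_mul (c := 4 * Real.pi * ‖v‖ * (2 / (2 * Real.pi * y)))
    (hc.aestronglyMeasurable.mul
      ((continuous_phase.clm_apply continuous_const).aestronglyMeasurable.mul hg.1))
    (Eventually.of_forall fun t => ?_)
  rw [norm_mul, norm_mul, Complex.norm_real, Real.norm_of_nonneg (Real.exp_pos _).le]
  have h1 : ‖phase t v‖ ≤ 4 * Real.pi * ‖t‖ * ‖v‖ :=
    ((phase t).le_opNorm v).trans (mul_le_mul_of_nonneg_right (norm_phase_le t) (norm_nonneg _))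
  have h2 := norm_mul_exp_neg_le (by positivity : 0 < 2 * Real.pi * y) (s := ‖t‖)
  have h3 : Real.exp (-(2 * Real.pi * y / 2 * ‖t‖)) ≤ 1 := by
    refine Real.exp_le_one_iff.2 ?_
    have : 0 ≤ 2 * Real.pi * y / 2 * ‖t‖ := by positivity
    linarith
  calc Real.exp (-(2 * Real.pi * y * ‖t‖)) * (‖phase t v‖ * ‖g t‖)
      ≤ Real.exp (-(2 * Real.pi * y * ‖t‖)) * (4 * Real.pi * ‖t‖ * ‖v‖ * ‖g t‖) := by gcongr
    _ = 4 * Real.pi * ‖v‖ * ‖g t‖ * (‖t‖ * Real.exp (-(2 * Real.pi * y * ‖t‖))) := by ring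
    _ ≤ 4 * Real.pi * ‖v‖ * ‖g t‖ * (2 / (2 * Real.pi * y) * 1) := by
        refine mul_le_mul_of_nonneg_left (h2.trans ?_) (by positivity)
        exact mul_le_mul_of_nonneg_left h3 (by positivity)
    _ = _ := by ring

theorem fourierExtension_upperPoint (g : EuclideanSpace ℝ (Fin n) → ℂ)
    (x : EuclideanSpace ℝ (Fin n)) (y : ℝ) :
    fourierExtension g (upperPoint x y)
      = 𝓕 (fun t => (Real.exp (-(2 * Real.pi * y * ‖t‖)) : ℂ) * g t) x := by
  rw [Real.fourier_eq']
  refine integral_congr_ae (Eventually.of_forall fun t => ?_)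
  simp only [phase_apply, upperPoint_zero, horizontal_upperPoint, smul_eq_mul]
  rw [← mul_assoc, Complex.ofReal_exp, ← Complex.exp_add]
  congr 2
  push_cast
  ring

theorem lintegral_fourierExtension_slice {g : EuclideanSpace ℝ (Fin n) → ℂ} (hg : IsSymbol g)
    {y : ℝ} (hy : 0 < y)
    (h2 : MemLp (fun t => (Real.exp (-(2 * Real.pi * y * ‖t‖)) : ℂ) * g t) 2) :
    ∫⁻ x, ‖fourierExtension g (upperPoint x y)‖ₑ ^ 2
      = ∫⁻ t, ‖(Real.exp (-(2 * Real.pi * y * ‖t‖)) : ℂ) * g t‖ₑ ^ 2 := by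
  simp_rw [fourierExtension_upperPoint]
  exact lintegral_enorm_sq_fourier (hg.integrable_exp_mul hy) h2

theorem memLp_fourierL2 {f : EuclideanSpace ℝ (Fin n) → ℂ} (hf : MemLp f 2) :
    MemLp (fourierL2 f hf) 2 := Lp.memLp _

theorem fourierExtension_slice_ae_eq {g : EuclideanSpace ℝ (Fin n) → ℂ} (hg : MemLp g 2)
    {y : ℝ} (hy : 0 < y) :
    (fun x => fourierExtension g (upperPoint x y)) =ᵐ[volume]
      ((𝓕 ((memLp_exp_mul hg hy).toLp _) : Lp ℂ 2 (volume : Measure (EuclideanSpace ℝ (Fin n)))) :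
        EuclideanSpace ℝ (Fin n) → ℂ) := by
  simp_rw [fourierExtension_upperPoint]
  exact (fourier_toLp_ae_eq (hg.isSymbol.integrable_exp_mul hy) (memLp_exp_mul hg hy)).symm

/-- Both the slice and f are L² Fourier transforms, of e^{-2πy|t|} f̂ and of f̂; Plancherel applies
to the difference. -/
theorem lintegral_fourierExtension_sub {f : EuclideanSpace ℝ (Fin n) → ℂ} (hf : MemLp f 2)
    {y : ℝ} (hy : 0 < y) :
    ∫⁻ x, ‖fourierExtension (fourierL2 f hf) (upperPoint x y) - f x‖ₑ ^ 2
      = ∫⁻ t, ‖((Real.exp (-(2 * Real.pi * y * ‖t‖)) : ℂ) - 1) * fourierL2 f hf t‖ₑ ^ 2 := by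
  have hg := memLp_fourierL2 hf
  set H := (memLp_exp_mul hg hy).toLp _ with hH
  set G : Lp ℂ 2 (volume : Measure (EuclideanSpace ℝ (Fin n))) := 𝓕⁻ (hf.toLp f) with hG
  rw [← eLpNorm_two_sq, ← eLpNorm_two_sq]
  congr 1
  have e1 : (fun x => fourierExtension (fourierL2 f hf) (upperPoint x y) - f x) =ᵐ[volume]
      ((𝓕 (H - G) : Lp ℂ 2 (volume : Measure (EuclideanSpace ℝ (Fin n)))) :
        EuclideanSpace ℝ (Fin n) → ℂ) := by
    have : 𝓕 (H - G) = 𝓕 H - hf.toLp f := by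
      have hGf : 𝓕 G = hf.toLp f := (Lp.fourierTransformₗᵢ _ _).apply_symm_apply (hf.toLp f)
      rw [← hGf]
      exact (Lp.fourierTransformₗᵢ _ _).map_sub H G
    rw [this]
    filter_upwards [fourierExtension_slice_ae_eq hg hy, Lp.coeFn_sub (𝓕 H) (hf.toLp f),
      hf.coeFn_toLp] with x h1 h2 h3
    rw [h2, Pi.sub_apply, h3, h1]
  have e2 : (fun t => ((Real.exp (-(2 * Real.pi * y * ‖t‖)) : ℂ) - 1) * fourierL2 f hf t)
      =ᵐ[volume] (H - G : Lp ℂ 2 (volume : Measure (EuclideanSpace ℝ (Fin n)))) := by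
    filter_upwards [Lp.coeFn_sub H G, (memLp_exp_mul hg hy).coeFn_toLp] with t h1 h2
    rw [h1, Pi.sub_apply, h2, sub_mul, one_mul]
    rfl
  rw [eLpNorm_congr_ae e1, eLpNorm_congr_ae e2, ← Lp.enorm_def, ← Lp.enorm_def, ← ofReal_norm,
    ← ofReal_norm, Lp.norm_fourier_eq]

theorem enorm_mul_sq_le {a b : ℂ} (ha : ‖a‖ ≤ 1) : ‖a * b‖ₑ ^ 2 ≤ ‖b‖ₑ ^ 2 := by
  refine pow_le_pow_left₀ zero_le ?_ 2
  rw [← ofReal_norm, ← ofReal_norm, norm_mul]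
  exact ENNReal.ofReal_le_ofReal (mul_le_of_le_one_left (norm_nonneg _) ha)

theorem exp_neg_norm_le_one {y : ℝ} (hy : 0 ≤ y) (t : EuclideanSpace ℝ (Fin n)) :
    Real.exp (-(2 * Real.pi * y * ‖t‖)) ≤ 1 := by
  refine Real.exp_le_one_iff.2 ?_
  have : 0 ≤ 2 * Real.pi * y * ‖t‖ := by positivity
  linarith

theorem tendsto_lintegral_fourierExtension_sub {f : EuclideanSpace ℝ (Fin n) → ℂ}
    (hf : MemLp f 2) :
    Tendsto (fun y => ∫⁻ x, ‖fourierExtension (fourierL2 f hf) (upperPoint x y) - f x‖ₑ ^ 2)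
      (𝓝[>] 0) (𝓝 0) := by
  have hg := memLp_fourierL2 hf
  have h : Tendsto (fun y : ℝ => ∫⁻ t,
      ‖((Real.exp (-(2 * Real.pi * y * ‖t‖)) : ℂ) - 1) * fourierL2 f hf t‖ₑ ^ 2)
      (𝓝[>] 0) (𝓝 (∫⁻ _ : EuclideanSpace ℝ (Fin n), 0)) := by
    refine tendsto_lintegral_filter_of_dominated_convergence
      (fun t => ‖fourierL2 f hf t‖ₑ ^ 2) ?_ ?_ ?_ ?_
    · refine Eventually.of_forall fun y => ?_
      have hc : Continuous fun t : EuclideanSpace ℝ (Fin n) =>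
        (Real.exp (-(2 * Real.pi * y * ‖t‖)) : ℂ) - 1 := by fun_prop
      have hm : Measurable (fourierL2 f hf) := (Lp.stronglyMeasurable _).measurable
      exact (hc.measurable.mul hm).enorm.pow_const 2
    · filter_upwards [self_mem_nhdsWithin] with y (hy : 0 < y)
      refine Eventually.of_forall fun t => enorm_mul_sq_le ?_
      rw [← Complex.ofReal_one, ← Complex.ofReal_sub, Complex.norm_real, Real.norm_eq_abs, abs_le]
      have := Real.exp_pos (-(2 * Real.pi * y * ‖t‖))
      constructor <;> linarith [exp_neg_norm_le_one hy.le t]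
    · rw [← eLpNorm_two_sq]
      exact ENNReal.pow_ne_top hg.2.ne
    · refine Eventually.of_forall fun t => ?_
      have hc : Continuous fun y : ℝ =>
        ‖((Real.exp (-(2 * Real.pi * y * ‖t‖)) : ℂ) - 1) * fourierL2 f hf t‖ₑ ^ 2 :=
        (ENNReal.continuous_pow 2).comp (Continuous.enorm (by fun_prop))
      simpa using (hc.tendsto 0).mono_left nhdsWithin_le_nhds
  rw [lintegral_zero] at h
  refine h.congr' ?_
  filter_upwards [self_mem_nhdsWithin] with y (hy : 0 < y)
  exact (lintegral_fourierExtension_sub hf hy).symm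

theorem lintegral_fourierExtension_slice_le {g : EuclideanSpace ℝ (Fin n) → ℂ} (hg : MemLp g 2)
    {y : ℝ} (hy : 0 < y) :
    ∫⁻ x, ‖fourierExtension g (upperPoint x y)‖ₑ ^ 2 ≤ ∫⁻ t, ‖g t‖ₑ ^ 2 := by
  rw [lintegral_fourierExtension_slice hg.isSymbol hy (memLp_exp_mul hg hy)]
  refine lintegral_mono fun t => enorm_mul_sq_le ?_
  rw [Complex.norm_real, Real.norm_of_nonneg (Real.exp_pos _).le]
  exact exp_neg_norm_le_one hy.le t

/-- With moduli in place of squares, the vertical and horizontal contributions 4π²|t|² add up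
instead of cancelling as in `sum_phase_sq`. -/
theorem sum_norm_phase_sq (t : EuclideanSpace ℝ (Fin n)) :
    ∑ i, ‖phase t (EuclideanSpace.single i 1)‖ ^ 2 = 8 * Real.pi ^ 2 * ‖t‖ ^ 2 := by
  rw [Fin.sum_univ_succ, phase_single_zero]
  simp_rw [phase_single_succ, norm_mul, norm_neg, Complex.norm_I, Complex.norm_real, one_mul,
    Real.norm_eq_abs, sq_abs]
  have h2 : ∑ k, t k ^ 2 = ‖t‖ ^ 2 := (EuclideanSpace.real_norm_sq_eq t).symm
  simp_rw [mul_pow, ← Finset.mul_sum]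
  rw [h2]
  ring

/-- The origin of the weight 2π|t|: the energy density 8π²s² of a frequency is multiplied by ∫_0^∞
e^{-4πsy} dy = 1/(4πs). The frequency 0 has to be treated apart. -/
theorem lintegral_exp_Ioi {s : ℝ} (hs : 0 ≤ s) :
    ∫⁻ y in Set.Ioi (0 : ℝ), ENNReal.ofReal
      (8 * Real.pi ^ 2 * s ^ 2 * Real.exp (-(2 * Real.pi * y * s)) ^ 2)
      = ENNReal.ofReal (2 * Real.pi * s) := by
  rcases hs.eq_or_lt with rfl | hs
  · simp
  have hneg : -(4 * Real.pi * s) < 0 := by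
    have : 0 < 4 * Real.pi * s := by positivity
    linarith
  have e : ∀ y : ℝ, 8 * Real.pi ^ 2 * s ^ 2 * Real.exp (-(2 * Real.pi * y * s)) ^ 2
      = 8 * Real.pi ^ 2 * s ^ 2 * Real.exp (-(4 * Real.pi * s) * y) := fun y => by
    rw [← Real.exp_nat_mul]; congr 2; push_cast; ring
  simp_rw [e]
  rw [← ofReal_integral_eq_lintegral_ofReal ((integrableOn_exp_mul_Ioi hneg 0).const_mul _)
    (Eventually.of_forall fun y => by positivity), integral_const_mul, integral_exp_mul_Ioi hneg]
  congr 1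
  rw [mul_zero, Real.exp_zero]
  field_simp
  ring

/-- Tonelli reduces the energy to slices, Plancherel evaluates each derivative on a slice, and a
second use of Tonelli integrates out the height. The identity holds in [0, ∞] and needs no
finiteness. -/
theorem gradientEnergy_fourierExtension {g : EuclideanSpace ℝ (Fin n) → ℂ} (hg : MemLp g 2) :
    gradientEnergy (fourierExtension g)
      = ENNReal.ofReal (2 * Real.pi) * ∫⁻ t, ENNReal.ofReal (‖t‖ * ‖g t‖ ^ 2) := by
  have hpart : ∀ i : Fin (n + 1), ∀ p ∈ upperHalf n, partialD i (fourierExtension g) p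
      = fourierExtension (fun t => phase t (EuclideanSpace.single i 1) * g t) p := fun i p hp =>
    fderiv_fourierExtension_apply hg.isSymbol _ hp
  have hcont : ∀ i : Fin (n + 1), ContinuousOn
      (fourierExtension fun t => phase t (EuclideanSpace.single i 1) * g t) (upperHalf n) :=
    fun i => (contDiffOn_fourierExtension (hg.isSymbol.phase_mul _) 0).continuousOn
  have hofReal : ∀ F : Fin (n + 1) → ℂ,
      ENNReal.ofReal (∑ i, ‖F i‖ ^ 2) = ∑ i, ‖F i‖ₑ ^ 2 := fun F => by
    rw [ENNReal.ofReal_sum_of_nonneg fun i _ => by positivity]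
    refine Finset.sum_congr rfl fun i _ => ?_
    rw [ENNReal.ofReal_pow (norm_nonneg _), ofReal_norm]
  calc gradientEnergy (fourierExtension g)
      = ∫⁻ p in upperHalf n, ∑ i,
          ‖fourierExtension (fun t => phase t (EuclideanSpace.single i 1) * g t) p‖ₑ ^ 2 := by
        refine setLIntegral_congr_fun isOpen_upperHalf.measurableSet fun p hp => ?_
        simp only [hofReal, hpart _ p hp]
    _ = ∫⁻ y in Set.Ioi (0 : ℝ), ∫⁻ x, ∑ i, ‖fourierExtension
          (fun t => phase t (EuclideanSpace.single i 1) * g t) (upperPoint x y)‖ₑ ^ 2 := by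
        refine lintegral_upperHalf (Finset.aemeasurable_fun_sum _ fun i _ => ?_)
        exact ((hcont i).aestronglyMeasurable isOpen_upperHalf.measurableSet).enorm.pow_const 2
    _ = ∫⁻ y in Set.Ioi (0 : ℝ), ∫⁻ t, ENNReal.ofReal
          (8 * Real.pi ^ 2 * ‖t‖ ^ 2 * Real.exp (-(2 * Real.pi * y * ‖t‖)) ^ 2)
            * ‖g t‖ₑ ^ 2 := by
        refine setLIntegral_congr_fun measurableSet_Ioi fun y (hy : 0 < y) => ?_
        have hslice : ∀ i : Fin (n + 1), Continuous fun x : EuclideanSpace ℝ (Fin n) =>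
            fourierExtension (fun t => phase t (EuclideanSpace.single i 1) * g t)
              (upperPoint x y) := fun i =>
          (hcont i).comp_continuous (continuous_upperPoint.comp (continuous_const.prodMk
            continuous_id)) fun x => hy
        rw [lintegral_finsetSum' _ fun i _ => ((hslice i).enorm.measurable.pow_const 2).aemeasurable]
        simp_rw [lintegral_fourierExtension_slice (hg.isSymbol.phase_mul _) hy
          (memLp_exp_mul_phase hg hy _)]
        rw [← lintegral_finsetSum' _ fun i _ =>
          (memLp_exp_mul_phase hg hy _).1.enorm.pow_const 2]
        refine lintegral_congr fun t => ?_
        rw [← sum_norm_phase_sq, Finset.sum_mul, ← hofReal]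
        rw [← ofReal_norm, ← ENNReal.ofReal_pow (norm_nonneg _), ← ENNReal.ofReal_mul
          (by positivity), Finset.sum_mul]
        congr 1
        refine Finset.sum_congr rfl fun i _ => ?_
        rw [norm_mul, norm_mul, Complex.norm_real, Real.norm_of_nonneg (Real.exp_pos _).le]
        ring
    _ = ∫⁻ t, ∫⁻ y in Set.Ioi (0 : ℝ), ENNReal.ofReal
          (8 * Real.pi ^ 2 * ‖t‖ ^ 2 * Real.exp (-(2 * Real.pi * y * ‖t‖)) ^ 2)
            * ‖g t‖ₑ ^ 2 := by
        refine lintegral_lintegral_swap ?_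
        refine AEMeasurable.mul ?_ (hg.1.comp_snd.enorm.pow_const 2)
        exact Measurable.aemeasurable (by fun_prop)
    _ = ∫⁻ t, ENNReal.ofReal (2 * Real.pi) * ENNReal.ofReal (‖t‖ * ‖g t‖ ^ 2) := by
        refine lintegral_congr fun t => ?_
        rw [lintegral_mul_const _ (by fun_prop), lintegral_exp_Ioi (norm_nonneg t),
          ← ofReal_norm, ← ENNReal.ofReal_pow (norm_nonneg _),
          ← ENNReal.ofReal_mul (by positivity), ← ENNReal.ofReal_mul (by positivity)]
        congr 1; ring
    _ = _ := lintegral_const_mul' _ _ ENNReal.ofReal_ne_top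

end Slices
/-! ### Boundary values of functions of the Dirichlet space -/

section BoundaryValues

variable {n : ℕ}

theorem sum_fderiv_fderiv_of_harmonicOnNhd {F : Type*} [NormedAddCommGroup F] [NormedSpace ℝ F]
    {u : EuclideanSpace ℝ (Fin n) → F} {U : Set (EuclideanSpace ℝ (Fin n))}
    (hu : InnerProductSpace.HarmonicOnNhd u U) {p : EuclideanSpace ℝ (Fin n)} (hp : p ∈ U) :
    ∑ i, fderiv ℝ (fun z => fderiv ℝ u z (EuclideanSpace.single i 1)) p
      (EuclideanSpace.single i 1) = 0 := by
  obtain ⟨h1, h2⟩ := hu p hp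
  have h3 := h2.self_of_nhds
  rw [InnerProductSpace.laplacian_eq_iteratedFDeriv_orthonormalBasis u
    (EuclideanSpace.basisFun (Fin n) ℝ)] at h3
  simp only [iteratedFDeriv_two_apply, EuclideanSpace.basisFun_apply, Pi.zero_apply] at h3
  rw [← h3]
  refine Finset.sum_congr rfl fun i _ => ?_
  have hd : DifferentiableAt ℝ (fderiv ℝ u) p :=
    (h1.fderiv_right (m := 1) (by norm_num)).differentiableAt one_ne_zero
  rw [fderiv_clm_apply hd (differentiableAt_const _)]
  simp

theorem hasDerivAt_vertical {u : EuclideanSpace ℝ (Fin (n + 1)) → ℂ}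
    (hu : ContDiffOn ℝ 2 u (upperHalf n)) (x : EuclideanSpace ℝ (Fin n)) {s : ℝ} (hs : 0 < s) :
    HasDerivAt (fun s => u (upperPoint x s)) (partialD 0 u (upperPoint x s)) s := by
  have h1 : HasFDerivAt u (fderiv ℝ u (upperPoint x s)) (upperPoint x s) :=
    ((hu.differentiableOn two_ne_zero).differentiableAt
      (isOpen_upperHalf.mem_nhds (by simpa using hs))).hasFDerivAt
  have h2 : HasDerivAt (fun s : ℝ => upperPoint x s) (EuclideanSpace.single 0 1) s := by
    have e : (fun s : ℝ => upperPoint x s)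
        = fun s : ℝ => upperPoint x 0 + s • EuclideanSpace.single (0 : Fin (n + 1)) (1 : ℝ) := by
      funext s
      ext i
      refine Fin.cases ?_ (fun k => ?_) i <;> simp
    rw [e]
    simpa using ((hasDerivAt_id s).smul_const
      (EuclideanSpace.single (0 : Fin (n + 1)) (1 : ℝ))).const_add (upperPoint x 0)
  exact h1.comp_hasDerivAt s h2

theorem continuousOn_partialD {u : EuclideanSpace ℝ (Fin (n + 1)) → ℂ}
    (hu : ContDiffOn ℝ 2 u (upperHalf n)) (i : Fin (n + 1)) :
    ContinuousOn (partialD i u) (upperHalf n) :=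
  (contDiffOn_fderiv_apply isOpen_upperHalf hu _).continuousOn

theorem measurable_partialD (u : EuclideanSpace ℝ (Fin (n + 1)) → ℂ) (i : Fin (n + 1)) :
    Measurable (partialD i u) :=
  measurable_fderiv_apply_const ℝ u _

theorem continuous_slice {u : EuclideanSpace ℝ (Fin (n + 1)) → ℂ}
    (hu : ContDiffOn ℝ 2 u (upperHalf n)) {y : ℝ} (hy : 0 < y) :
    Continuous fun x : EuclideanSpace ℝ (Fin n) => u (upperPoint x y) :=
  hu.continuousOn.comp_continuous
    (continuous_upperPoint.comp (continuous_const.prodMk continuous_id)) fun _ => hy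

theorem enorm_integral_sq_le {φ : ℝ → ℂ} {a b : ℝ} (hab : a ≤ b)
    (hφ : ContinuousOn φ (Set.Icc a b)) :
    ‖∫ s in a..b, φ s‖ₑ ^ 2 ≤ ENNReal.ofReal (b - a) * ∫⁻ s in Set.Ioc a b, ‖φ s‖ₑ ^ 2 := by
  have hm : AEStronglyMeasurable φ (volume.restrict (Set.Ioc a b)) :=
    (hφ.mono Set.Ioc_subset_Icc_self).aestronglyMeasurable measurableSet_Ioc
  have h := eLpNorm_le_eLpNorm_mul_rpow_measure_univ (p := 1) (q := 2) (by norm_num) hm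
  have hr : (1 / (1 : ℝ≥0∞).toReal - 1 / (2 : ℝ≥0∞).toReal) = 1 / 2 := by norm_num
  rw [eLpNorm_one_eq_lintegral_enorm, hr, Measure.restrict_apply_univ, Real.volume_Ioc] at h
  have h2 : ‖∫ s in a..b, φ s‖ₑ ≤ ∫⁻ s in Set.Ioc a b, ‖φ s‖ₑ := by
    rw [intervalIntegral.integral_of_le hab]
    exact enorm_integral_le_lintegral_enorm _
  calc ‖∫ s in a..b, φ s‖ₑ ^ 2
      ≤ (eLpNorm φ 2 (volume.restrict (Set.Ioc a b)) * ENNReal.ofReal (b - a) ^ (1 / 2 : ℝ)) ^ 2 :=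
        pow_le_pow_left₀ zero_le (h2.trans h) 2
    _ = _ := by
        rw [mul_pow, eLpNorm_two_sq, ← ENNReal.rpow_natCast (_ ^ (1 / 2 : ℝ)), ← ENNReal.rpow_mul]
        norm_num [mul_comm]

/-- The fundamental theorem of calculus on vertical segments and Cauchy-Schwarz. When the energy is
finite, the slices are therefore Cauchy in L² at the boundary. -/
theorem lintegral_vertical_difference_le {u : EuclideanSpace ℝ (Fin (n + 1)) → ℂ}
    (hu : ContDiffOn ℝ 2 u (upperHalf n)) {a b : ℝ} (ha : 0 < a) (hab : a ≤ b) :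
    ∫⁻ x, ‖u (upperPoint x b) - u (upperPoint x a)‖ₑ ^ 2
      ≤ ENNReal.ofReal (b - a) * gradientEnergy u := by
  have hmeas : Measurable fun p => ‖partialD 0 u p‖ₑ ^ 2 :=
    (measurable_partialD u 0).enorm.pow_const 2
  calc ∫⁻ x, ‖u (upperPoint x b) - u (upperPoint x a)‖ₑ ^ 2
      ≤ ∫⁻ x, ENNReal.ofReal (b - a)
          * ∫⁻ s in Set.Ioc a b, ‖partialD 0 u (upperPoint x s)‖ₑ ^ 2 := by
        refine lintegral_mono fun x => ?_
        have hc : ContinuousOn (fun s => partialD 0 u (upperPoint x s)) (Set.Icc a b) :=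
          (continuousOn_partialD hu 0).comp (continuous_upperPoint.comp
            (continuous_id.prodMk continuous_const)).continuousOn fun s hs => ha.trans_le hs.1
        have := intervalIntegral.integral_eq_sub_of_hasDerivAt
          (f := fun s => u (upperPoint x s)) (f' := fun s => partialD 0 u (upperPoint x s))
          (a := a) (b := b) (fun s hs => hasDerivAt_vertical hu x (by
            rw [Set.uIcc_of_le hab] at hs; exact ha.trans_le hs.1))
          (ContinuousOn.intervalIntegrable (by rwa [Set.uIcc_of_le hab]))
        rw [← this]
        exact enorm_integral_sq_le hab hc
    _ = ENNReal.ofReal (b - a)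
          * ∫⁻ x, ∫⁻ s in Set.Ioc a b, ‖partialD 0 u (upperPoint x s)‖ₑ ^ 2 :=
        lintegral_const_mul' _ _ ENNReal.ofReal_ne_top
    _ = ENNReal.ofReal (b - a)
          * ∫⁻ s in Set.Ioc a b, ∫⁻ x, ‖partialD 0 u (upperPoint x s)‖ₑ ^ 2 := by
        congr 1
        refine lintegral_lintegral_swap (Measurable.aemeasurable ?_)
        exact hmeas.comp (continuous_upperPoint.comp continuous_swap).measurable
    _ ≤ ENNReal.ofReal (b - a)
          * ∫⁻ s in Set.Ioi (0 : ℝ), ∫⁻ x, ‖partialD 0 u (upperPoint x s)‖ₑ ^ 2 := by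
        gcongr
        exact fun s hs => ha.trans hs.1
    _ = ENNReal.ofReal (b - a) * ∫⁻ p in upperHalf n, ‖partialD 0 u p‖ₑ ^ 2 := by
        rw [lintegral_upperHalf hmeas.aemeasurable]
    _ ≤ _ := by
        refine mul_le_mul_right (lintegral_mono fun p => ?_) _
        rw [← ofReal_norm, ← ENNReal.ofReal_pow (norm_nonneg _)]
        exact ENNReal.ofReal_le_ofReal
          (Finset.single_le_sum (f := fun i => ‖partialD i u p‖ ^ 2) (fun i _ => by positivity)
            (Finset.mem_univ 0))

theorem IsBoundaryFunction.aestronglyMeasurable {u : EuclideanSpace ℝ (Fin (n + 1)) → ℂ}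
    (hu : ContDiffOn ℝ 2 u (upperHalf n)) {f : EuclideanSpace ℝ (Fin n) → ℂ}
    (hf : IsBoundaryFunction u f) : AEStronglyMeasurable f := by
  have ht : Tendsto (fun m : ℕ => 1 / ((m : ℝ) + 1)) atTop (𝓝[>] 0) :=
    tendsto_nhdsWithin_iff.2 ⟨tendsto_one_div_add_atTop_nhds_zero_nat,
      Eventually.of_forall fun m => by simp only [Set.mem_Ioi]; positivity⟩
  refine aestronglyMeasurable_of_tendsto_ae atTop
    (f := fun (m : ℕ) x => u (upperPoint x (1 / ((m : ℝ) + 1))))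
    (fun m => (continuous_slice hu (by positivity)).aestronglyMeasurable) ?_
  filter_upwards [hf] with x hx using hx.comp ht

/-- Fatou's lemma along the heights 1/(m+1) upgrades the almost everywhere limit to convergence in
L² with a rate. -/
theorem lintegral_slice_sub_boundary_le {u : EuclideanSpace ℝ (Fin (n + 1)) → ℂ}
    (hu : ContDiffOn ℝ 2 u (upperHalf n)) {f : EuclideanSpace ℝ (Fin n) → ℂ}
    (hf : IsBoundaryFunction u f) {b : ℝ} (hb : 0 < b) :
    ∫⁻ x, ‖u (upperPoint x b) - f x‖ₑ ^ 2 ≤ ENNReal.ofReal b * gradientEnergy u := by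
  have ht : Tendsto (fun m : ℕ => 1 / ((m : ℝ) + 1)) atTop (𝓝[>] 0) :=
    tendsto_nhdsWithin_iff.2 ⟨tendsto_one_div_add_atTop_nhds_zero_nat,
      Eventually.of_forall fun m => by simp only [Set.mem_Ioi]; positivity⟩
  have hpos : ∀ m : ℕ, 0 < 1 / ((m : ℝ) + 1) := fun m => by positivity
  calc ∫⁻ x, ‖u (upperPoint x b) - f x‖ₑ ^ 2
      = ∫⁻ x, liminf (fun m : ℕ =>
          ‖u (upperPoint x b) - u (upperPoint x (1 / ((m : ℝ) + 1)))‖ₑ ^ 2) atTop := by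
        refine lintegral_congr_ae ?_
        filter_upwards [hf] with x hx
        have h1 : Tendsto (fun m : ℕ =>
            ‖u (upperPoint x b) - u (upperPoint x (1 / ((m : ℝ) + 1)))‖ₑ ^ 2) atTop
            (𝓝 (‖u (upperPoint x b) - f x‖ₑ ^ 2)) :=
          ((ENNReal.continuous_pow 2).tendsto _).comp
            ((tendsto_const_nhds.sub (hx.comp ht)).enorm)
        exact h1.liminf_eq.symm
    _ ≤ liminf (fun m : ℕ =>
          ∫⁻ x, ‖u (upperPoint x b) - u (upperPoint x (1 / ((m : ℝ) + 1)))‖ₑ ^ 2) atTop :=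
        lintegral_liminf_le fun m => (((continuous_slice hu hb).sub
          (continuous_slice hu (hpos m))).enorm.measurable.pow_const 2)
    _ ≤ ENNReal.ofReal b * gradientEnergy u := by
        refine liminf_le_of_le (by isBoundedDefault) fun c hc => ?_
        have hev : ∀ᶠ m : ℕ in atTop, 1 / ((m : ℝ) + 1) < b :=
          tendsto_one_div_add_atTop_nhds_zero_nat.eventually_lt_const hb
        obtain ⟨m, hm, hm'⟩ := (hc.and hev).exists
        refine hm.trans ((lintegral_vertical_difference_le hu (hpos m) hm'.le).trans ?_)
        gcongr
        linarith [hpos m]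

theorem ennreal_add_sq_le (a b : ℝ≥0∞) : (a + b) ^ 2 ≤ 2 * (a ^ 2 + b ^ 2) := by
  have := ENNReal.rpow_add_le_mul_rpow_add_rpow a b (p := 2) (by norm_num)
  norm_num at this
  exact this

/-- f is the slice at height 1, square integrable by the Hardy condition, minus its difference from
f, square integrable by finite energy. -/
theorem MemDirichlet.memLp_boundary {u : EuclideanSpace ℝ (Fin (n + 1)) → ℂ}
    (hu : MemDirichlet u) {f : EuclideanSpace ℝ (Fin n) → ℂ} (hf : IsBoundaryFunction u f) :
    MemLp f 2 := by
  have hc := hu.harmonic.contDiffOn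
  have h1 : MemLp (fun x : EuclideanSpace ℝ (Fin n) => u (upperPoint x 1)) 2 :=
    ⟨(continuous_slice hc one_pos).aestronglyMeasurable,
      (le_iSup₂ (f := fun (y : ℝ) (_ : 0 < y) =>
        eLpNorm (fun x : EuclideanSpace ℝ (Fin n) => u (upperPoint x y)) 2 volume) 1 one_pos).trans_lt
        hu.hardy⟩
  have h2 : MemLp (fun x : EuclideanSpace ℝ (Fin n) => u (upperPoint x 1) - f x) 2 := by
    refine ⟨h1.1.sub (hf.aestronglyMeasurable hc), ?_⟩
    have h3 := lintegral_slice_sub_boundary_le hc hf one_pos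
    rw [← eLpNorm_two_sq] at h3
    have h4 := h3.trans_lt (ENNReal.mul_lt_top ENNReal.ofReal_lt_top hu.energy)
    by_contra h5
    rw [not_lt_top_iff] at h5
    simp [h5] at h4
  refine (h1.sub h2).ae_eq (Eventually.of_forall fun x => ?_)
  simp

/-- A function of the Dirichlet space is the harmonic extension of its boundary function. -/
theorem MemDirichlet.eq_fourierExtension {u : EuclideanSpace ℝ (Fin (n + 1)) → ℂ}
    (hu : MemDirichlet u) {f : EuclideanSpace ℝ (Fin n) → ℂ} (hf : IsBoundaryFunction u f)
    (hf2 : MemLp f 2) :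
    ∀ p ∈ upperHalf n, u p = fourierExtension (fourierL2 f hf2) p := by
  have hg := memLp_fourierL2 hf2
  have hc := hu.harmonic.contDiffOn
  set V := fourierExtension (fourierL2 f hf2) with hV
  have hVc : ContDiffOn ℝ 2 V (upperHalf n) := contDiffOn_fourierExtension hg.isSymbol 2
  have hD : ContDiffOn ℝ 2 (fun p => u p - V p) (upperHalf n) := hc.sub hVc
  have hfm := hf.aestronglyMeasurable hc
  have hd : ∀ {h : EuclideanSpace ℝ (Fin (n + 1)) → ℂ}, ContDiffOn ℝ 2 h (upperHalf n) →
      ∀ z ∈ upperHalf n, DifferentiableAt ℝ h z := fun h z hz =>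
    (h.differentiableOn two_ne_zero).differentiableAt (isOpen_upperHalf.mem_nhds hz)
  have hd2 : ∀ {h : EuclideanSpace ℝ (Fin (n + 1)) → ℂ}, ContDiffOn ℝ 2 h (upperHalf n) →
      ∀ v, ∀ z ∈ upperHalf n, DifferentiableAt ℝ (fun z => fderiv ℝ h z v) z := fun h v z hz =>
    ((contDiffOn_fderiv_apply isOpen_upperHalf h v).differentiableOn one_ne_zero).differentiableAt
      (isOpen_upperHalf.mem_nhds hz)
  set N : ℝ → ℝ≥0∞ := fun y =>
    eLpNorm (fun x : EuclideanSpace ℝ (Fin n) => u (upperPoint x y) - V (upperPoint x y)) 2 with hN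
  have hN1 : ∀ y, 0 < y → N y ≤ (⨆ y : ℝ, ⨆ _ : 0 < y,
      eLpNorm (fun x : EuclideanSpace ℝ (Fin n) => u (upperPoint x y)) 2 volume)
      + eLpNorm (fourierL2 f hf2) 2 := by
    intro y hy
    refine (eLpNorm_sub_le (continuous_slice hc hy).aestronglyMeasurable
      (continuous_slice hVc hy).aestronglyMeasurable one_le_two).trans (add_le_add ?_ ?_)
    · exact le_iSup₂ (f := fun (y : ℝ) (_ : 0 < y) =>
        eLpNorm (fun x : EuclideanSpace ℝ (Fin n) => u (upperPoint x y)) 2 volume) y hy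
    · have := lintegral_fourierExtension_slice_le hg hy
      rw [← eLpNorm_two_sq, ← eLpNorm_two_sq] at this
      exact (ENNReal.pow_le_pow_left_iff two_ne_zero).1 this
  -- Both u(·,y) and V(·,y) converge to f in L², the first by finite energy and the second by
  -- Plancherel.
  have hN0 : Tendsto (fun y => N y ^ 2) (𝓝[>] 0) (𝓝 0) := by
    have t1 : Tendsto (fun y : ℝ => ENNReal.ofReal y * gradientEnergy u) (𝓝[>] 0) (𝓝 0) := by
      have : Tendsto (fun y : ℝ => ENNReal.ofReal y * gradientEnergy u) (𝓝 0)
          (𝓝 (ENNReal.ofReal 0 * gradientEnergy u)) :=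
        ENNReal.Tendsto.mul_const (ENNReal.continuous_ofReal.tendsto 0) (Or.inr hu.energy.ne)
      rw [ENNReal.ofReal_zero, zero_mul] at this
      exact this.mono_left nhdsWithin_le_nhds
    have t2 := tendsto_lintegral_fourierExtension_sub hf2
    have t3 := ENNReal.Tendsto.const_mul (a := 2) (t1.add t2) (Or.inr (by norm_num))
    rw [add_zero, mul_zero] at t3
    refine tendsto_of_tendsto_of_tendsto_of_le_of_le' tendsto_const_nhds t3
      (Eventually.of_forall fun y => zero_le) ?_
    filter_upwards [self_mem_nhdsWithin] with y (hy : 0 < y)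
    have h1 : N y ≤ eLpNorm (fun x : EuclideanSpace ℝ (Fin n) => u (upperPoint x y) - f x) 2
        + eLpNorm (fun x : EuclideanSpace ℝ (Fin n) => V (upperPoint x y) - f x) 2 := by
      have := eLpNorm_sub_le (p := 2) ((continuous_slice hc hy).aestronglyMeasurable.sub hfm)
        ((continuous_slice hVc hy).aestronglyMeasurable.sub hfm) one_le_two
      refine le_trans (le_of_eq ?_) this
      simp only [hN]
      congr 1
      funext x
      simp
    refine (pow_le_pow_left₀ zero_le h1 2).trans ((ennreal_add_sq_le _ _).trans ?_)
    rw [eLpNorm_two_sq, eLpNorm_two_sq]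
    gcongr
    exact lintegral_slice_sub_boundary_le hc hf hy
  -- The uniqueness theorem concerns real functions. It is applied to L(u - V) for a contraction L,
  -- later the real and the imaginary part.
  have main : ∀ L : ℂ →L[ℝ] ℝ, (∀ z, ‖L z‖ ≤ ‖z‖) → ∀ p ∈ upperHalf n, L (u p - V p) = 0 := by
    intro L hL
    have hle : ∀ y, ∫⁻ x : EuclideanSpace ℝ (Fin n),
        ‖L (u (upperPoint x y) - V (upperPoint x y))‖ₑ ^ 2 ≤ N y ^ 2 := fun y => by
      rw [eLpNorm_two_sq]
      refine lintegral_mono fun x => pow_le_pow_left₀ zero_le ?_ 2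
      rw [← ofReal_norm, ← ofReal_norm]
      exact ENNReal.ofReal_le_ofReal (hL _)
    refine eq_zero_of_harmonic_of_tendsto_zero (w := fun p => L (u p - V p))
      (L.contDiff.comp_contDiffOn hD) (fun p hp => ?_)
      (ENNReal.pow_ne_top (ENNReal.add_lt_top.2 ⟨hu.hardy, hg.2⟩).ne : _ ^ 2 ≠ ∞)
      (fun y hy => (hle y).trans (pow_le_pow_left₀ zero_le (hN1 y hy) 2)) ?_
    · have h1 : ∀ v, (fun z => fderiv ℝ (fun p => L (u p - V p)) z v) =ᶠ[𝓝 p]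
          fun z => L (fderiv ℝ u z v - fderiv ℝ V z v) := fun v => by
        filter_upwards [isOpen_upperHalf.mem_nhds hp] with z hz
        have := (L.hasFDerivAt.comp z ((hd hc z hz).hasFDerivAt.sub (hd hVc z hz).hasFDerivAt)).fderiv
        change fderiv ℝ (L ∘ (fun p => u p - V p)) z v = _
        erw [this]
        rfl
      have h2 : ∀ v, fderiv ℝ (fun z => fderiv ℝ (fun p => L (u p - V p)) z v) p v
          = L (fderiv ℝ (fun z => fderiv ℝ u z v) p v - fderiv ℝ (fun z => fderiv ℝ V z v) p v) :=
          fun v => by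
        rw [(h1 v).fderiv_eq]
        have := (L.hasFDerivAt.comp p ((hd2 hc v p hp).hasFDerivAt.sub
          (hd2 hVc v p hp).hasFDerivAt)).fderiv
        change fderiv ℝ (L ∘ (fun z => fderiv ℝ u z v - fderiv ℝ V z v)) p v = _
        erw [this]
        rfl
      simp_rw [h2]
      rw [← map_sum, Finset.sum_sub_distrib, sum_fderiv_fderiv_of_harmonicOnNhd hu.harmonic hp,
        sum_fderiv_fderiv_fourierExtension hg.isSymbol hp, sub_zero, map_zero]
    · exact tendsto_of_tendsto_of_tendsto_of_le_of_le tendsto_const_nhds hN0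
        (fun y => zero_le) hle
  intro p hp
  rw [← sub_eq_zero]
  exact Complex.ext (main Complex.reCLM (fun z => Complex.abs_re_le_norm z) p hp)
    (main Complex.imCLM (fun z => Complex.abs_im_le_norm z) p hp)

end BoundaryValues
/-! ### The Poisson kernel -/

section Subordination

theorem integral_eq_zero_of_neg_eq_neg {h : ℝ → ℝ} (hh : ∀ x, h (-x) = -h x) : ∫ x, h x = 0 := by
  have h1 := integral_neg_eq_self h volume
  simp_rw [hh, integral_neg] at h1
  linarith

/-- The subordination identity `e^{-2ab} = (a/√π) ∫_0^∞ s^{-1/2} e^{-sa² - b²/s} ds`, `b > 0`. -/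
theorem integral_subordination_of_pos {a b : ℝ} (ha : 0 < a) (hb : 0 < b) :
    ∫ s in Set.Ioi (0 : ℝ), s ^ (-(1 / 2) : ℝ) * Real.exp (-(s * a ^ 2) - b ^ 2 / s)
      = Real.sqrt Real.pi / a * Real.exp (-(2 * a * b)) := by
  set R : ℝ → ℝ := fun x => Real.sqrt (x ^ 2 + 4 * a * b) with hR
  have hab : 0 < 4 * a * b := by positivity
  have hR0 : ∀ x, 0 < R x := fun x => Real.sqrt_pos.2 (by positivity)
  have hR2 : ∀ x, R x ^ 2 = x ^ 2 + 4 * a * b := fun x => Real.sq_sqrt (by positivity)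
  have hRx : ∀ x, 0 < x + R x := fun x => by
    have h1 : |x| < R x := by
      rw [← Real.sqrt_sq_eq_abs]
      exact Real.sqrt_lt_sqrt (sq_nonneg x) (by linarith)
    linarith [neg_abs_le x]
  -- ψ x is the positive root of aψ - b/ψ = x. The substitution s = ψ(x)² maps ℝ onto (0,∞) and
  -- turns the exponent -(sa²) - b²/s into -x² - 2ab.
  set ψ : ℝ → ℝ := fun x => (x + R x) / (2 * a) with hψ
  have hψ0 : ∀ x, 0 < ψ x := fun x => div_pos (hRx x) (by positivity)
  have hψx : ∀ x, a * ψ x - b / ψ x = x := fun x => by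
    have h1 := (hRx x).ne'
    have h2 := hR2 x
    simp only [hψ]
    field_simp
    linear_combination h2
  have hRd : ∀ x, HasDerivAt R (x / R x) x := fun x => by
    have h1 : HasDerivAt (fun x : ℝ => x ^ 2 + 4 * a * b) (2 * x) x := by
      simpa using (hasDerivAt_pow 2 x).add_const (4 * a * b)
    have h2 := h1.sqrt (by positivity)
    refine h2.congr_deriv ?_
    rw [mul_div_mul_left _ _ two_ne_zero]
  have hψd : ∀ x, HasDerivAt ψ ((1 + x / R x) / (2 * a)) x := fun x =>
    ((hasDerivAt_id x).add (hRd x)).div_const _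
  have hd : ∀ x ∈ Set.univ, HasDerivWithinAt (fun x => ψ x ^ 2)
      (2 * ψ x * ((1 + x / R x) / (2 * a))) Set.univ x := fun x _ => by
    exact ((hψd x).pow 2).hasDerivWithinAt.congr_deriv (by simp)
  have hinj : Set.InjOn (fun x => ψ x ^ 2) Set.univ := by
    intro x _ z _ hxz
    have h1 : ψ x = ψ z := (pow_left_inj₀ (hψ0 x).le (hψ0 z).le two_ne_zero).1 hxz
    rw [← hψx x, ← hψx z, h1]
  have himg : (fun x => ψ x ^ 2) '' Set.univ = Set.Ioi (0 : ℝ) := by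
    ext s
    constructor
    · rintro ⟨x, -, rfl⟩
      exact pow_pos (hψ0 x) 2
    · intro (hs : 0 < s)
      have hq := Real.sqrt_pos.2 hs
      refine ⟨a * Real.sqrt s - b / Real.sqrt s, trivial, ?_⟩
      have h1 : R (a * Real.sqrt s - b / Real.sqrt s) = a * Real.sqrt s + b / Real.sqrt s := by
        rw [hR]
        refine Real.sqrt_eq_iff_mul_self_eq_of_pos (by positivity) |>.2 ?_
        field_simp
        ring
      have h2 : ψ (a * Real.sqrt s - b / Real.sqrt s) = Real.sqrt s := by
        simp only [hψ, h1]
        field_simp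
        ring
      simp only [h2]
      exact Real.sq_sqrt hs.le
  have hcv := integral_image_eq_integral_abs_deriv_smul MeasurableSet.univ hd hinj
    (fun s => s ^ (-(1 / 2) : ℝ) * Real.exp (-(s * a ^ 2) - b ^ 2 / s))
  rw [himg] at hcv
  rw [hcv, Measure.restrict_univ]
  -- After the substitution the integrand is a Gaussian plus an odd function, and the odd part
  -- integrates to zero.
  have hpt : ∀ x, |2 * ψ x * ((1 + x / R x) / (2 * a))| •
      ((ψ x ^ 2) ^ (-(1 / 2) : ℝ) * Real.exp (-(ψ x ^ 2 * a ^ 2) - b ^ 2 / ψ x ^ 2))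
      = Real.exp (-(2 * a * b)) / a
        * (Real.exp (-1 * x ^ 2) + Real.exp (-1 * x ^ 2) * (x / R x)) := by
    intro x
    have hpos : 0 ≤ 2 * ψ x * ((1 + x / R x) / (2 * a)) := by
      have : 1 + x / R x = (x + R x) / R x := by field_simp [(hR0 x).ne']; ring
      rw [this]
      have := hψ0 x; have := hRx x; have := hR0 x
      positivity
    have h1 : (ψ x ^ 2) ^ (-(1 / 2) : ℝ) = (ψ x)⁻¹ := by
      rw [← Real.rpow_natCast, ← Real.rpow_mul (hψ0 x).le, ← Real.rpow_neg_one]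
      norm_num
    have h2 : -(ψ x ^ 2 * a ^ 2) - b ^ 2 / ψ x ^ 2 = -(2 * a * b) + -1 * x ^ 2 := by
      have h3 := hψx x
      have h4 := (hψ0 x).ne'
      have h5 : a * ψ x * (b / ψ x) = a * b := by field_simp
      have h6 : b ^ 2 / ψ x ^ 2 = (b / ψ x) ^ 2 := (div_pow _ _ _).symm
      rw [h6]
      have h7 : x ^ 2 = (a * ψ x - b / ψ x) ^ 2 := by rw [h3]
      rw [h7]
      linear_combination (-2) * h5
    rw [abs_of_nonneg hpos, h1, h2, Real.exp_add, smul_eq_mul]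
    have := (hψ0 x).ne'
    field_simp
  simp_rw [hpt]
  have hi1 : Integrable fun x : ℝ => Real.exp (-1 * x ^ 2) := integrable_exp_neg_mul_sq one_pos
  have hRc : Continuous R := continuous_iff_continuousAt.2 fun x => (hRd x).continuousAt
  have hi2 : Integrable fun x : ℝ => Real.exp (-1 * x ^ 2) * (x / R x) := by
    refine hi1.mul_bdd (c := 1) (Continuous.aestronglyMeasurable
      (continuous_id.div hRc fun x => (hR0 x).ne')) (Eventually.of_forall fun x => ?_)
    rw [norm_div, Real.norm_of_nonneg (hR0 x).le, div_le_one (hR0 x), Real.norm_eq_abs,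
      ← Real.sqrt_sq_eq_abs]
    exact Real.sqrt_le_sqrt (by linarith)
  rw [integral_const_mul, integral_add hi1 hi2, integral_gaussian, div_one,
    integral_eq_zero_of_neg_eq_neg (h := fun x => Real.exp (-1 * x ^ 2) * (x / R x)), add_zero]
  · ring
  · intro x
    simp only [hR, neg_sq]
    ring

/-- The degenerate case b = 0, which occurs at the frequency t = 0, is not reached by the
substitution; there the integral is Γ(1/2) up to scaling. -/
theorem integral_subordination {a b : ℝ} (ha : 0 < a) (hb : 0 ≤ b) :
    ∫ s in Set.Ioi (0 : ℝ), s ^ (-(1 / 2) : ℝ) * Real.exp (-(s * a ^ 2) - b ^ 2 / s)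
      = Real.sqrt Real.pi / a * Real.exp (-(2 * a * b)) := by
  rcases hb.eq_or_lt with rfl | hb
  · have h := Real.integral_rpow_mul_exp_neg_mul_Ioi (a := 1 / 2) (r := a ^ 2) (by norm_num)
      (by positivity)
    rw [Real.Gamma_one_half_eq, one_div (a ^ 2), Real.inv_rpow (by positivity),
      ← Real.sqrt_eq_rpow, Real.sqrt_sq ha.le] at h
    have e : (1 / 2 - 1 : ℝ) = -(1 / 2) := by norm_num
    rw [e] at h
    simp only [mul_zero, neg_zero, Real.exp_zero, mul_one, ne_eq, OfNat.ofNat_ne_zero,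
      not_false_eq_true, zero_pow, zero_div, sub_zero]
    simp_rw [mul_comm _ (a ^ 2)]
    rw [h]
    ring
  · exact integral_subordination_of_pos ha hb

/-- The integral of a non-integrable function is zero by convention, so its nonzero value already
proves integrability. -/
theorem integrableOn_subordination {a b : ℝ} (ha : 0 < a) (hb : 0 ≤ b) :
    IntegrableOn (fun s : ℝ => s ^ (-(1 / 2) : ℝ) * Real.exp (-(s * a ^ 2) - b ^ 2 / s))
      (Set.Ioi 0) := by
  refine Integrable.of_integral_ne_zero ?_
  rw [integral_subordination ha hb]
  have := Real.pi_pos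
  positivity

end Subordination
-- The Poisson kernel as a Fourier transform, and the Poisson integral
section PoissonKernel

variable {n : ℕ}

/-- The Poisson kernel `P_y(x) = (2/ω_n) y / (y² + |x|²)^{(n+1)/2}` of the half-space. -/
def halfSpacePoissonKernel (y : ℝ) (x : EuclideanSpace ℝ (Fin n)) : ℝ :=
  2 / sphereArea n * (y / (y ^ 2 + ‖x‖ ^ 2) ^ (((n : ℝ) + 1) / 2))

theorem sphereArea_pos (n : ℕ) : 0 < sphereArea n := by
  have := Real.Gamma_pos_of_pos (by positivity : (0 : ℝ) < ((n : ℝ) + 1) / 2)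
  have := Real.pi_pos
  unfold sphereArea
  positivity

theorem halfSpacePoissonKernel_nonneg {y : ℝ} (hy : 0 ≤ y) (x : EuclideanSpace ℝ (Fin n)) :
    0 ≤ halfSpacePoissonKernel y x := by
  have := sphereArea_pos n
  unfold halfSpacePoissonKernel
  positivity

theorem halfSpacePoissonKernel_neg (y : ℝ) (x : EuclideanSpace ℝ (Fin n)) :
    halfSpacePoissonKernel y (-x) = halfSpacePoissonKernel y x := by
  simp [halfSpacePoissonKernel]

theorem continuous_halfSpacePoissonKernel {y : ℝ} (hy : 0 < y) :
    Continuous (halfSpacePoissonKernel (n := n) y) := by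
  unfold halfSpacePoissonKernel
  refine continuous_const.mul (continuous_const.div (Continuous.rpow_const (by fun_prop)
    fun x => Or.inl (by positivity)) fun x => by positivity)

theorem fourier_gaussian_rexp {s : ℝ} (hs : 0 < s) (x : EuclideanSpace ℝ (Fin n)) :
    𝓕 (fun t : EuclideanSpace ℝ (Fin n) => (Real.exp (-((Real.pi * ‖t‖) ^ 2 / s)) : ℂ)) x
      = (((s / Real.pi) ^ ((n : ℝ) / 2) * Real.exp (-(s * ‖x‖ ^ 2)) : ℝ) : ℂ) := by
  have hpi := Real.pi_pos
  have hb : 0 < (((Real.pi ^ 2 / s : ℝ)) : ℂ).re := by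
    rw [Complex.ofReal_re]; positivity
  have h := fourier_gaussian_innerProductSpace hb x
  have e : (fun t : EuclideanSpace ℝ (Fin n) => (Real.exp (-((Real.pi * ‖t‖) ^ 2 / s)) : ℂ))
      = fun t => Complex.exp (-((Real.pi ^ 2 / s : ℝ) : ℂ) * (‖t‖ : ℂ) ^ 2) := by
    funext t
    rw [Complex.ofReal_exp]
    congr 1
    push_cast
    ring
  rw [e, h, finrank_euclideanSpace_fin, Complex.ofReal_mul, Complex.ofReal_cpow (by positivity),
    Complex.ofReal_exp]
  congr 1
  · congr 1
    · push_cast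
      field_simp
    · push_cast; ring
  · congr 1
    push_cast
    field_simp

/-- The Fourier transform of `e^{-2πy|t|}` is the Poisson kernel. -/
theorem fourier_exp_neg_norm {y : ℝ} (hy : 0 < y) (x : EuclideanSpace ℝ (Fin n)) :
    𝓕 (fun t : EuclideanSpace ℝ (Fin n) => (Real.exp (-(2 * Real.pi * y * ‖t‖)) : ℂ)) x
      = (halfSpacePoissonKernel y x : ℂ) := by
  have hpi := Real.pi_pos
  -- By subordination with a = y and b = π|t|, the exponential e^{-2πy|t|} is a superposition over s
  -- of the Gaussians e^{-π²|t|²/s}.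
  set H : EuclideanSpace ℝ (Fin n) → ℝ → ℝ := fun t s =>
    s ^ (-(1 / 2) : ℝ) * Real.exp (-(s * y ^ 2) - (Real.pi * ‖t‖) ^ 2 / s) with hH
  have hHint : ∀ t, IntegrableOn (H t) (Set.Ioi 0) := fun t =>
    integrableOn_subordination hy (by positivity)
  have hHval : ∀ t, Real.exp (-(2 * Real.pi * y * ‖t‖))
      = y / Real.sqrt Real.pi * ∫ s in Set.Ioi (0 : ℝ), H t s := fun t => by
    rw [hH, integral_subordination hy (by positivity : 0 ≤ Real.pi * ‖t‖)]
    have : Real.sqrt Real.pi ≠ 0 := (Real.sqrt_pos.2 hpi).ne'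
    field_simp
  have hHm : Measurable (Function.uncurry H) := by
    simp only [hH, Function.uncurry_def]
    fun_prop
  have hHnn : ∀ t, ∀ s ∈ Set.Ioi (0 : ℝ), 0 ≤ H t s := fun t s (hs : 0 < s) => by
    simp only [hH]; positivity
  have hprod : Integrable (Function.uncurry H)
      ((volume : Measure (EuclideanSpace ℝ (Fin n))).prod (volume.restrict (Set.Ioi 0))) := by
    refine (integrable_prod_iff hHm.aestronglyMeasurable).2
      ⟨Eventually.of_forall hHint, ?_⟩
    have e : (fun t : EuclideanSpace ℝ (Fin n) => ∫ s in Set.Ioi (0 : ℝ),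
        ‖Function.uncurry H (t, s)‖)
        = fun t => Real.sqrt Real.pi / y * Real.exp (-(2 * Real.pi * y * ‖t‖)) := by
      funext t
      have e1 : ∫ s in Set.Ioi (0 : ℝ), ‖Function.uncurry H (t, s)‖
          = ∫ s in Set.Ioi (0 : ℝ), H t s :=
        setIntegral_congr_fun measurableSet_Ioi fun s hs => Real.norm_of_nonneg (hHnn t s hs)
      rw [hHval t, e1]
      have : Real.sqrt Real.pi ≠ 0 := (Real.sqrt_pos.2 hpi).ne'
      field_simp
    rw [e]
    exact (integrable_exp_neg_mul_norm (by positivity)).const_mul _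
  set c : EuclideanSpace ℝ (Fin n) → ℂ := fun t =>
    Complex.exp ((-2 * Real.pi * inner ℝ t x : ℝ) * Complex.I) with hc
  have hcn : ∀ t, ‖c t‖ = 1 := fun t => Complex.norm_exp_ofReal_mul_I _
  have hcc : Continuous c := by
    simp only [hc]; fun_prop
  have hprod2 : Integrable (Function.uncurry fun (t : EuclideanSpace ℝ (Fin n)) (s : ℝ) =>
      c t * (H t s : ℂ)) ((volume : Measure (EuclideanSpace ℝ (Fin n))).prod
        (volume.restrict (Set.Ioi 0))) := by
    refine hprod.ofReal.bdd_mul (c := 1) (hcc.comp continuous_fst).aestronglyMeasurable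
      (Eventually.of_forall fun q => (hcn q.1).le)
  calc 𝓕 (fun t : EuclideanSpace ℝ (Fin n) => (Real.exp (-(2 * Real.pi * y * ‖t‖)) : ℂ)) x
      = ∫ t : EuclideanSpace ℝ (Fin n), ((y / Real.sqrt Real.pi : ℝ) : ℂ)
          * ∫ s in Set.Ioi (0 : ℝ), c t * (H t s : ℂ) := by
        rw [Real.fourier_eq']
        refine integral_congr_ae (Eventually.of_forall fun t => ?_)
        simp only [hHval t, smul_eq_mul]
        rw [integral_const_mul, integral_complex_ofReal]
        simp only [hc]
        push_cast
        ring
    _ = ((y / Real.sqrt Real.pi : ℝ) : ℂ)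
          * ∫ s in Set.Ioi (0 : ℝ), ∫ t : EuclideanSpace ℝ (Fin n), c t * (H t s : ℂ) := by
        -- Fubini brings the Fourier integral inside, where it acts on a Gaussian for each fixed s.
        rw [integral_const_mul, integral_integral_swap hprod2]
    _ = ((y / Real.sqrt Real.pi : ℝ) : ℂ)
          * ∫ s in Set.Ioi (0 : ℝ), ((Real.pi ^ (-((n : ℝ) / 2)) * (s ^ (((n : ℝ) + 1) / 2 - 1)
            * Real.exp (-((y ^ 2 + ‖x‖ ^ 2) * s))) : ℝ) : ℂ) := by
        congr 1
        refine setIntegral_congr_fun measurableSet_Ioi fun s (hs : 0 < s) => ?_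
        have e1 : ∀ t : EuclideanSpace ℝ (Fin n), c t * (H t s : ℂ)
            = ((s ^ (-(1 / 2) : ℝ) * Real.exp (-(s * y ^ 2)) : ℝ) : ℂ)
              * (c t • (Real.exp (-((Real.pi * ‖t‖) ^ 2 / s)) : ℂ)) := fun t => by
          simp only [hH, sub_eq_add_neg, Real.exp_add, smul_eq_mul]
          push_cast
          ring
        have h := fourier_gaussian_rexp hs x
        rw [Real.fourier_eq'] at h
        simp only [e1]
        rw [integral_const_mul]
        simp only [hc]
        rw [h, ← Complex.ofReal_mul]
        congr 1
        rw [Real.div_rpow hs.le hpi.le, Real.rpow_neg hpi.le]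
        have e2 : s ^ (((n : ℝ) + 1) / 2 - 1) = s ^ (-(1 / 2) : ℝ) * s ^ ((n : ℝ) / 2) := by
          rw [← Real.rpow_add hs]; congr 1; ring
        have e3 : Real.exp (-((y ^ 2 + ‖x‖ ^ 2) * s))
            = Real.exp (-(s * y ^ 2)) * Real.exp (-(s * ‖x‖ ^ 2)) := by
          rw [← Real.exp_add]; congr 1; ring
        rw [e2, e3]
        ring
    _ = (halfSpacePoissonKernel y x : ℂ) := by
        -- What remains is a Gamma integral with parameter (n+1)/2 and rate y² + |x|²; its value
        -- Γ((n+1)/2), with the powers of π, produces the constant 2/ω_n.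
        rw [integral_complex_ofReal, integral_const_mul, Real.integral_rpow_mul_exp_neg_mul_Ioi
          (by positivity) (by positivity), ← Complex.ofReal_mul]
        congr 1
        have hΓ := (Real.Gamma_pos_of_pos (by positivity : (0 : ℝ) < ((n : ℝ) + 1) / 2)).ne'
        have e1 : Real.pi ^ (((n : ℝ) + 1) / 2) = Real.sqrt Real.pi * Real.pi ^ ((n : ℝ) / 2) := by
          rw [Real.sqrt_eq_rpow, ← Real.rpow_add hpi]; congr 1; ring
        unfold halfSpacePoissonKernel sphereArea
        rw [e1, Real.rpow_neg hpi.le, one_div, Real.inv_rpow (by positivity)]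
        have h1 : Real.sqrt Real.pi ≠ 0 := (Real.sqrt_pos.2 hpi).ne'
        have h2 : Real.pi ^ ((n : ℝ) / 2) ≠ 0 := (Real.rpow_pos_of_pos hpi _).ne'
        field_simp

theorem integrable_halfSpacePoissonKernel {y : ℝ} (hy : 0 < y) :
    Integrable (halfSpacePoissonKernel (n := n) y) := by
  have h0 : Integrable fun x : EuclideanSpace ℝ (Fin n) =>
      (1 + ‖x‖ ^ 2) ^ (-((n : ℝ) + 1) / 2) := integrable_rpow_neg_one_add_norm_sq (by simp)
  set m := min (y ^ 2) 1 with hm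
  have hm0 : 0 < m := by positivity
  refine (h0.const_mul (2 / sphereArea n * (y * (m ^ (((n : ℝ) + 1) / 2))⁻¹))).mono'
    (continuous_halfSpacePoissonKernel hy).aestronglyMeasurable (Eventually.of_forall fun x => ?_)
  rw [Real.norm_of_nonneg (halfSpacePoissonKernel_nonneg hy.le x)]
  have := sphereArea_pos n
  have h1 : m * (1 + ‖x‖ ^ 2) ≤ y ^ 2 + ‖x‖ ^ 2 := by
    have h2 : m ≤ y ^ 2 := min_le_left _ _
    have h3 : m ≤ 1 := min_le_right _ _
    nlinarith [mul_le_mul_of_nonneg_right h3 (sq_nonneg ‖x‖)]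
  have h4 : m ^ (((n : ℝ) + 1) / 2) * (1 + ‖x‖ ^ 2) ^ (((n : ℝ) + 1) / 2)
      ≤ (y ^ 2 + ‖x‖ ^ 2) ^ (((n : ℝ) + 1) / 2) := by
    rw [← Real.mul_rpow hm0.le (by positivity)]
    exact Real.rpow_le_rpow (by positivity) h1 (by positivity)
  unfold halfSpacePoissonKernel
  rw [neg_div, Real.rpow_neg (by positivity), mul_assoc (2 / sphereArea n), mul_assoc y, ← mul_inv,
    ← div_eq_mul_inv]
  refine mul_le_mul_of_nonneg_left ?_ (by positivity)
  exact div_le_div_of_nonneg_left hy.le (by positivity) h4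

/-- Fourier inversion for e^{-2πy|t|}, evaluated at t = 0 where this function equals 1. -/
theorem integral_halfSpacePoissonKernel {y : ℝ} (hy : 0 < y) :
    ∫ x : EuclideanSpace ℝ (Fin n), halfSpacePoissonKernel y x = 1 := by
  have hE : Continuous fun t : EuclideanSpace ℝ (Fin n) =>
      (Real.exp (-(2 * Real.pi * y * ‖t‖)) : ℂ) := by fun_prop
  have hEi : Integrable fun t : EuclideanSpace ℝ (Fin n) =>
      (Real.exp (-(2 * Real.pi * y * ‖t‖)) : ℂ) :=
    (integrable_exp_neg_mul_norm (by positivity)).ofReal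
  have hF : 𝓕 (fun t : EuclideanSpace ℝ (Fin n) => (Real.exp (-(2 * Real.pi * y * ‖t‖)) : ℂ))
      = fun x => (halfSpacePoissonKernel y x : ℂ) := funext (fourier_exp_neg_norm hy)
  have h := congrFun (hE.fourierInv_fourier_eq hEi (by
    rw [hF]; exact (integrable_halfSpacePoissonKernel hy).ofReal)) 0
  rw [hF, Real.fourierInv_eq'] at h
  simp only [inner_zero_right, mul_zero, Complex.ofReal_zero, zero_mul, Complex.exp_zero, one_smul,
    norm_zero, neg_zero, Real.exp_zero, Complex.ofReal_one, integral_complex_ofReal] at h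
  exact_mod_cast h

/-- The harmonic extension is given by the Poisson integral. -/
theorem fourierExtension_fourierL2 {f : EuclideanSpace ℝ (Fin n) → ℂ} (hf : MemLp f 2)
    {p : EuclideanSpace ℝ (Fin (n + 1))} (hp : p ∈ upperHalf n) :
    fourierExtension (fourierL2 f hf) p
      = ∫ s, (halfSpacePoissonKernel (p 0) (s - horizontal p) : ℂ) * f s := by
  have hp0 : 0 < p 0 := hp
  -- The conjugate of the exponential, so that Parseval pairs it with f̂ into the integral defining
  -- the extension. Its transform is the real Poisson kernel centred at the horizontal part of p.
  set b : EuclideanSpace ℝ (Fin n) → ℂ := fun t => (starRingEnd ℂ) (Complex.exp (phase t p)) with hb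
  have hbc : Continuous b := Complex.continuous_conj.comp
    (Complex.continuous_exp.comp (continuous_phase.clm_apply continuous_const))
  have hbn : ∀ t, ‖b t‖ = ‖Real.exp (-(2 * Real.pi * p 0 * ‖t‖))‖ := fun t => by
    rw [hb, RCLike.norm_conj, norm_exp_phase, Real.norm_of_nonneg (Real.exp_pos _).le]
    ring_nf
  have hb1 : Integrable b :=
    (integrable_exp_neg_mul_norm (by positivity : 0 < 2 * Real.pi * p 0)).mono
      hbc.aestronglyMeasurable (Eventually.of_forall fun t => (hbn t).le)
  have hb2 : MemLp b 2 :=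
    (memLp_two_exp_neg_mul_norm (by positivity : 0 < 2 * Real.pi * p 0)).mono
      hbc.aestronglyMeasurable (Eventually.of_forall fun t => (hbn t).le)
  have hFb : ∀ s, 𝓕 b s = (halfSpacePoissonKernel (p 0) (s - horizontal p) : ℂ) := fun s => by
    rw [← fourier_exp_neg_norm hp0, Real.fourier_eq', Real.fourier_eq']
    refine integral_congr_ae (Eventually.of_forall fun t => ?_)
    simp only [hb, smul_eq_mul, ← Complex.exp_conj, Complex.ofReal_exp, ← Complex.exp_add,
      phase_apply, map_sub, map_mul, Complex.conj_ofReal, Complex.conj_I, inner_sub_right]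
    congr 1
    push_cast
    ring
  have h := integral_conj_fourier_mul hb1 hb2 hf
  simp only [hFb, Complex.conj_ofReal] at h
  rw [h]
  refine integral_congr_ae (Eventually.of_forall fun t => ?_)
  simp only [hb, Complex.conj_conj]
  rfl

end PoissonKernel
/-! ### The system of conjugate kernels -/

section ConjugateKernels

variable {n : ℕ}

/-- The kernels `q_i / |q|^{n+1}` of the conjugate harmonic system on `ℝ^{n+1}`. -/
def rieszKernel (i : Fin (n + 1)) (q : EuclideanSpace ℝ (Fin (n + 1))) : ℝ :=
  q i * (‖q‖ ^ 2) ^ (-(((n : ℝ) + 1) / 2))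

/-- The derivative of `rieszKernel`. -/
def rieszKernelDeriv (i : Fin (n + 1)) (q : EuclideanSpace ℝ (Fin (n + 1))) :
    EuclideanSpace ℝ (Fin (n + 1)) →L[ℝ] ℝ :=
  ((‖q‖ ^ 2) ^ (-(((n : ℝ) + 1) / 2))) • EuclideanSpace.proj i
    - (((n : ℝ) + 1) * q i * (‖q‖ ^ 2) ^ (-(((n : ℝ) + 1) / 2) - 1)) • innerSL ℝ q

theorem rieszKernelDeriv_apply (i : Fin (n + 1)) (q v : EuclideanSpace ℝ (Fin (n + 1))) :
    rieszKernelDeriv i q v = (‖q‖ ^ 2) ^ (-(((n : ℝ) + 1) / 2)) * v i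
      - (((n : ℝ) + 1) * q i * (‖q‖ ^ 2) ^ (-(((n : ℝ) + 1) / 2) - 1)) * inner ℝ q v := rfl

theorem hasFDerivAt_rieszKernel (i : Fin (n + 1)) {q : EuclideanSpace ℝ (Fin (n + 1))}
    (hq : q ≠ 0) : HasFDerivAt (rieszKernel i) (rieszKernelDeriv i q) q := by
  have hpos : 0 < ‖q‖ ^ 2 := by positivity
  have h1 : HasFDerivAt (fun q : EuclideanSpace ℝ (Fin (n + 1)) => q i)
      (EuclideanSpace.proj i : EuclideanSpace ℝ (Fin (n + 1)) →L[ℝ] ℝ) q :=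
    (EuclideanSpace.proj i : EuclideanSpace ℝ (Fin (n + 1)) →L[ℝ] ℝ).hasFDerivAt
  have h2 := (hasStrictFDerivAt_norm_sq q).hasFDerivAt.rpow_const
    (p := -(((n : ℝ) + 1) / 2)) (Or.inl hpos.ne')
  refine (h1.mul h2).congr_fderiv ?_
  ext v
  simp only [rieszKernelDeriv, add_apply, sub_apply,
    smul_apply, smul_eq_mul, nsmul_eq_mul]
  push_cast
  ring

theorem continuousAt_rieszKernelDeriv (i : Fin (n + 1)) {q : EuclideanSpace ℝ (Fin (n + 1))}
    (hq : q ≠ 0) : ContinuousAt (rieszKernelDeriv i) q := by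
  have hpos : ‖q‖ ^ 2 ≠ 0 := by positivity
  have hr : ∀ r : ℝ, ContinuousAt (fun q : EuclideanSpace ℝ (Fin (n + 1)) => (‖q‖ ^ 2) ^ r) q :=
    fun r => ContinuousAt.rpow_const (by fun_prop) (Or.inl hpos)
  have hi : Continuous fun q : EuclideanSpace ℝ (Fin (n + 1)) => q i :=
    (EuclideanSpace.proj i : EuclideanSpace ℝ (Fin (n + 1)) →L[ℝ] ℝ).continuous
  exact ((hr _).smul continuousAt_const).sub
    (((continuousAt_const.mul hi.continuousAt).mul (hr _)).smul (innerSL ℝ).continuous.continuousAt)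

theorem abs_apply_le_norm (q : EuclideanSpace ℝ (Fin n)) (i : Fin n) : |q i| ≤ ‖q‖ := by
  simpa using PiLp.norm_apply_le q i

theorem norm_rieszKernelDeriv_le (i : Fin (n + 1)) {q : EuclideanSpace ℝ (Fin (n + 1))}
    (hq : q ≠ 0) :
    ‖rieszKernelDeriv i q‖ ≤ ((n : ℝ) + 2) * (‖q‖ ^ 2) ^ (-(((n : ℝ) + 1) / 2)) := by
  have hpos : 0 < ‖q‖ ^ 2 := by positivity
  refine ContinuousLinearMap.opNorm_le_bound _ (by positivity) fun v => ?_
  set A := (‖q‖ ^ 2) ^ (-(((n : ℝ) + 1) / 2)) with hA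
  have hA0 : 0 ≤ A := by positivity
  have hB : (‖q‖ ^ 2) ^ (-(((n : ℝ) + 1) / 2) - 1) = A / ‖q‖ ^ 2 := Real.rpow_sub_one hpos.ne' _
  have h1 := abs_apply_le_norm v i
  have h2 := abs_apply_le_norm q i
  have h3 := abs_real_inner_le_norm q v
  have e : rieszKernelDeriv i q v
      = A * v i - ((n : ℝ) + 1) * A * ((q i * inner ℝ q v) / ‖q‖ ^ 2) := by
    rw [rieszKernelDeriv_apply, hB]
    ring
  have h4 : |(q i * inner ℝ q v) / ‖q‖ ^ 2| ≤ ‖v‖ := by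
    rw [abs_div, abs_of_pos hpos, div_le_iff₀ hpos, abs_mul]
    calc |q i| * |inner ℝ q v| ≤ ‖q‖ * (‖q‖ * ‖v‖) := by gcongr
      _ = ‖v‖ * ‖q‖ ^ 2 := by ring
  rw [e, Real.norm_eq_abs]
  refine (abs_sub _ _).trans ?_
  rw [abs_mul, abs_mul, abs_mul, abs_of_nonneg hA0, abs_of_nonneg (by positivity : 0 ≤ (n : ℝ) + 1)]
  calc A * |v i| + ((n : ℝ) + 1) * A * |(q i * inner ℝ q v) / ‖q‖ ^ 2|
      ≤ A * ‖v‖ + ((n : ℝ) + 1) * A * ‖v‖ := by gcongr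
    _ = ((n : ℝ) + 2) * A * ‖v‖ := by ring

theorem rieszKernelDeriv_single (i j : Fin (n + 1)) (q : EuclideanSpace ℝ (Fin (n + 1))) :
    rieszKernelDeriv i q (EuclideanSpace.single j 1)
      = (‖q‖ ^ 2) ^ (-(((n : ℝ) + 1) / 2)) * (if i = j then 1 else 0)
        - ((n : ℝ) + 1) * (‖q‖ ^ 2) ^ (-(((n : ℝ) + 1) / 2) - 1) * (q i * q j) := by
  rw [rieszKernelDeriv_apply, EuclideanSpace.inner_single_right, PiLp.single_apply]
  simp only [conj_trivial]
  ring

/-- Up to a constant the kernels form the gradient of the fundamental solution of the Laplacian on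
ℝ^{n+1}, so their Jacobian is a Hessian. -/
theorem rieszKernelDeriv_single_comm (i j : Fin (n + 1)) (q : EuclideanSpace ℝ (Fin (n + 1))) :
    rieszKernelDeriv i q (EuclideanSpace.single j 1)
      = rieszKernelDeriv j q (EuclideanSpace.single i 1) := by
  rw [rieszKernelDeriv_single, rieszKernelDeriv_single, mul_comm (q i)]
  simp only [eq_comm]

/-- The trace of that Hessian is the Laplacian of the fundamental solution: the dimension n+1
balances the homogeneity exponent n+1. -/
theorem sum_rieszKernelDeriv_single {q : EuclideanSpace ℝ (Fin (n + 1))} (hq : q ≠ 0) :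
    ∑ i, rieszKernelDeriv i q (EuclideanSpace.single i 1) = 0 := by
  have hpos : ‖q‖ ^ 2 ≠ 0 := by positivity
  simp only [rieszKernelDeriv_single, if_true, mul_one, Finset.sum_sub_distrib, Finset.sum_const,
    Finset.card_univ, Fintype.card_fin, nsmul_eq_mul, ← Finset.mul_sum]
  have : ∑ i, q i * q i = ‖q‖ ^ 2 := by
    rw [EuclideanSpace.real_norm_sq_eq]
    exact Finset.sum_congr rfl fun i _ => (sq _).symm
  rw [this, Real.rpow_sub_one hpos]
  field_simp
  push_cast
  ring

theorem norm_sub_upperPoint_sq (p : EuclideanSpace ℝ (Fin (n + 1))) (t : EuclideanSpace ℝ (Fin n)) :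
    ‖p - upperPoint t 0‖ ^ 2 = p 0 ^ 2 + ‖t - horizontal p‖ ^ 2 := by
  rw [norm_sub_rev t, EuclideanSpace.real_norm_sq_eq, EuclideanSpace.real_norm_sq_eq,
    Fin.sum_univ_succ]
  simp

theorem sub_upperPoint_ne_zero {p : EuclideanSpace ℝ (Fin (n + 1))} (hp : p ∈ upperHalf n)
    (t : EuclideanSpace ℝ (Fin n)) : p - upperPoint t 0 ≠ 0 := fun h => by
  have h1 : p 0 - 0 = 0 := congrArg (fun q : EuclideanSpace ℝ (Fin (n + 1)) => q 0) h
  have h2 : 0 < p 0 := hp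
  linarith

theorem continuous_sub_upperPoint (p : EuclideanSpace ℝ (Fin (n + 1))) :
    Continuous fun t : EuclideanSpace ℝ (Fin n) => p - upperPoint t 0 :=
  continuous_const.sub (continuous_upperPoint.comp (continuous_const.prodMk continuous_id))

/-- The decaying majorant of the differentiated kernels. -/
def kernelMajorant (y : ℝ) (x : EuclideanSpace ℝ (Fin n)) : ℝ :=
  (y ^ 2 + ‖x‖ ^ 2) ^ (-(((n : ℝ) + 1) / 2))

theorem continuous_kernelMajorant {y : ℝ} (hy : 0 < y) :
    Continuous (kernelMajorant (n := n) y) :=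
  Continuous.rpow_const (by fun_prop) fun x => Or.inl (by positivity)

theorem kernelMajorant_nonneg (y : ℝ) (x : EuclideanSpace ℝ (Fin n)) : 0 ≤ kernelMajorant y x := by
  unfold kernelMajorant
  positivity

theorem halfSpacePoissonKernel_eq (y : ℝ) (x : EuclideanSpace ℝ (Fin n)) :
    halfSpacePoissonKernel y x = 2 / sphereArea n * (y * kernelMajorant y x) := by
  rw [halfSpacePoissonKernel, kernelMajorant, Real.rpow_neg (by positivity)]
  rfl

theorem integrable_kernelMajorant {y : ℝ} (hy : 0 < y) :
    Integrable (kernelMajorant (n := n) y) := by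
  have hω := (sphereArea_pos n).ne'
  refine ((integrable_halfSpacePoissonKernel (n := n) hy).const_mul (sphereArea n / (2 * y))).congr
    (Eventually.of_forall fun x => ?_)
  simp only [halfSpacePoissonKernel_eq]
  field_simp

theorem kernelMajorant_le {y : ℝ} (hy : 0 < y) (x : EuclideanSpace ℝ (Fin n)) :
    kernelMajorant y x ≤ (y ^ 2) ^ (-(((n : ℝ) + 1) / 2)) :=
  Real.rpow_le_rpow_of_nonpos (by positivity) (by nlinarith [sq_nonneg ‖x‖])
    (neg_nonpos.2 (by positivity))

theorem memLp_kernelMajorant {y : ℝ} (hy : 0 < y) (a : EuclideanSpace ℝ (Fin n)) :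
    MemLp (fun t => kernelMajorant y (t - a)) 2 := by
  have hc : Continuous fun t : EuclideanSpace ℝ (Fin n) => kernelMajorant y (t - a) :=
    (continuous_kernelMajorant hy).comp (continuous_id.sub continuous_const)
  rw [memLp_two_iff_integrable_sq_norm hc.aestronglyMeasurable]
  refine Integrable.mono' (((integrable_kernelMajorant hy).comp_sub_right a).const_mul
    ((y ^ 2) ^ (-(((n : ℝ) + 1) / 2)))) (hc.norm.pow 2).aestronglyMeasurable
    (Eventually.of_forall fun t => ?_)
  have h0 := kernelMajorant_nonneg y (t - a)
  rw [Real.norm_of_nonneg (by positivity), Real.norm_of_nonneg h0, sq]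
  exact mul_le_mul_of_nonneg_right (kernelMajorant_le hy _) h0

/-- The conjugate kernels decay only like |t|^{-n}, so pairing them with f requires their square
integrability. Here |q|^{-2n} is split into |q|^{-(n-1)}, bounded through the height because n ≥ 1,
and the integrable |q|^{-(n+1)}. -/
theorem norm_rieszKernel_sq_le (hn : 1 ≤ n) (i : Fin (n + 1)) {p : EuclideanSpace ℝ (Fin (n + 1))}
    (hp : p ∈ upperHalf n) (t : EuclideanSpace ℝ (Fin n)) :
    ‖rieszKernel i (p - upperPoint t 0)‖ ^ 2
      ≤ ((p 0) ^ 2) ^ (-(((n : ℝ) - 1) / 2)) * kernelMajorant (p 0) (t - horizontal p) := by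
  have hp0 : 0 < p 0 := hp
  set q := p - upperPoint t 0 with hq
  have hpos : 0 < ‖q‖ ^ 2 := by
    have := sub_upperPoint_ne_zero hp t
    positivity
  have h1 : (q i) ^ 2 ≤ ‖q‖ ^ 2 := sq_le_sq' (by linarith [neg_abs_le (q i), abs_apply_le_norm q i])
    ((le_abs_self _).trans (abs_apply_le_norm q i))
  have h2 : (p 0) ^ 2 ≤ ‖q‖ ^ 2 := by
    rw [hq, norm_sub_upperPoint_sq]; nlinarith [sq_nonneg ‖t - horizontal p‖]
  have h3 : (‖q‖ ^ 2) ^ (-(((n : ℝ) - 1) / 2)) ≤ ((p 0) ^ 2) ^ (-(((n : ℝ) - 1) / 2)) :=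
    Real.rpow_le_rpow_of_nonpos (by positivity) h2 (by
      have : (1 : ℝ) ≤ n := by exact_mod_cast hn
      linarith)
  rw [kernelMajorant, ← norm_sub_upperPoint_sq, ← hq]
  calc ‖rieszKernel i q‖ ^ 2
      = (q i) ^ 2 * ((‖q‖ ^ 2) ^ (-(((n : ℝ) + 1) / 2))) ^ 2 := by
        rw [rieszKernel, Real.norm_eq_abs, sq_abs, mul_pow]
    _ ≤ ‖q‖ ^ 2 * ((‖q‖ ^ 2) ^ (-(((n : ℝ) + 1) / 2))) ^ 2 := by gcongr
    _ = (‖q‖ ^ 2) ^ (-(((n : ℝ) - 1) / 2)) * (‖q‖ ^ 2) ^ (-(((n : ℝ) + 1) / 2)) := by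
        rw [show -(((n : ℝ) - 1) / 2) = 1 + -(((n : ℝ) + 1) / 2) by ring, Real.rpow_add hpos,
          Real.rpow_one]
        ring
    _ ≤ _ := by gcongr

theorem continuous_rieszKernel_sub (i : Fin (n + 1)) {p : EuclideanSpace ℝ (Fin (n + 1))}
    (hp : p ∈ upperHalf n) :
    Continuous fun t : EuclideanSpace ℝ (Fin n) => rieszKernel i (p - upperPoint t 0) :=
  continuous_iff_continuousAt.2 fun t =>
    ((hasFDerivAt_rieszKernel i (sub_upperPoint_ne_zero hp t)).continuousAt).comp
      (f := fun t => p - upperPoint t 0) (continuous_sub_upperPoint p).continuousAt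

theorem memLp_rieszKernel (hn : 1 ≤ n) (i : Fin (n + 1)) {p : EuclideanSpace ℝ (Fin (n + 1))}
    (hp : p ∈ upperHalf n) :
    MemLp (fun t : EuclideanSpace ℝ (Fin n) => rieszKernel i (p - upperPoint t 0)) 2 := by
  have hc := continuous_rieszKernel_sub i hp
  rw [memLp_two_iff_integrable_sq_norm hc.aestronglyMeasurable]
  refine Integrable.mono' (((integrable_kernelMajorant (y := p 0) hp).comp_sub_right
    (horizontal p)).const_mul (((p 0) ^ 2) ^ (-(((n : ℝ) - 1) / 2))))
    (hc.norm.pow 2).aestronglyMeasurable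
    (Eventually.of_forall fun t => ?_)
  rw [Real.norm_of_nonneg (by positivity)]
  exact norm_rieszKernel_sq_le hn i hp t

/-- A bound uniform in p on a ball, as differentiation under the integral requires: moving p inside
the ball changes the height and the horizontal distance by at most p₀ 0 / 2. The constant 1/8 is a
convenient, not optimal, comparison factor for the squared distances. -/
theorem norm_sq_rpow_le_kernelMajorant {p₀ p : EuclideanSpace ℝ (Fin (n + 1))}
    (hp₀ : p₀ ∈ upperHalf n) (hp : p ∈ Metric.ball p₀ (p₀ 0 / 2)) (t : EuclideanSpace ℝ (Fin n)) :
    (‖p - upperPoint t 0‖ ^ 2) ^ (-(((n : ℝ) + 1) / 2))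
      ≤ (1 / 8 : ℝ) ^ (-(((n : ℝ) + 1) / 2)) * kernelMajorant (p₀ 0 / 2) (t - horizontal p₀) := by
  have h0 : 0 < p₀ 0 := hp₀
  have hd : ‖p - p₀‖ < p₀ 0 / 2 := mem_ball_iff_norm.1 hp
  have h1 := (abs_apply_le_norm (p - p₀) 0).trans_lt hd
  rw [PiLp.sub_apply, abs_lt] at h1
  have hh : ‖horizontal p - horizontal p₀‖ ≤ ‖p - p₀‖ := norm_horizontal_le (p - p₀)
  have h2 : ‖t - horizontal p₀‖ ≤ ‖t - horizontal p‖ + p₀ 0 / 2 := by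
    have := norm_sub_le_norm_sub_add_norm_sub t (horizontal p) (horizontal p₀)
    linarith
  have hy : p₀ 0 / 2 ≤ p 0 := by linarith
  have ha := norm_nonneg (t - horizontal p)
  have hb := norm_nonneg (t - horizontal p₀)
  rw [kernelMajorant, norm_sub_upperPoint_sq, ← Real.mul_rpow (by norm_num) (by positivity)]
  refine Real.rpow_le_rpow_of_nonpos (by positivity) ?_ (neg_nonpos.2 (by positivity))
  have h3 : ‖t - horizontal p₀‖ ^ 2 ≤ 2 * ‖t - horizontal p‖ ^ 2 + 2 * (p₀ 0 / 2) ^ 2 := by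
    nlinarith [sq_nonneg (‖t - horizontal p‖ - p₀ 0 / 2)]
  have h4 : (p₀ 0 / 2) ^ 2 ≤ p 0 ^ 2 := by gcongr
  nlinarith [sq_nonneg ‖t - horizontal p‖]

theorem ball_subset_upperHalf {p₀ : EuclideanSpace ℝ (Fin (n + 1))} (hp₀ : p₀ ∈ upperHalf n) :
    Metric.ball p₀ (p₀ 0 / 2) ⊆ upperHalf n := fun p hp => by
  have h0 : 0 < p₀ 0 := hp₀
  have h1 := (abs_apply_le_norm (p - p₀) 0).trans_lt (mem_ball_iff_norm.1 hp)
  rw [PiLp.sub_apply, abs_lt] at h1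
  change 0 < p 0
  linarith

variable {𝕜 : Type*} [RCLike 𝕜]

/-- The `i`-th member of the system of conjugate harmonic functions with boundary datum `f`. -/
def conjugateSystem (f : EuclideanSpace ℝ (Fin n) → 𝕜) (i : Fin (n + 1))
    (p : EuclideanSpace ℝ (Fin (n + 1))) : 𝕜 :=
  (2 / sphereArea n) • ∫ t, rieszKernel i (p - upperPoint t 0) • f t

theorem conjugateSystem_zero (f : EuclideanSpace ℝ (Fin n) → 𝕜)
    (p : EuclideanSpace ℝ (Fin (n + 1))) :
    conjugateSystem f 0 p = ∫ t, halfSpacePoissonKernel (p 0) (t - horizontal p) • f t := by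
  rw [conjugateSystem, ← integral_smul]
  refine integral_congr_ae (Eventually.of_forall fun t => ?_)
  simp only [rieszKernel, smul_smul, norm_sub_upperPoint_sq, halfSpacePoissonKernel_eq,
    kernelMajorant, PiLp.sub_apply, upperPoint_zero, sub_zero]

/-- The sign arises because v_k is written with t - x while the kernel is evaluated at p - (t, 0),
with horizontal part x - t. -/
theorem rieszConjugate_eq (f : EuclideanSpace ℝ (Fin n) → 𝕜) (k : Fin n)
    (p : EuclideanSpace ℝ (Fin (n + 1))) :
    rieszConjugate f k p = -conjugateSystem f k.succ p := by
  rw [conjugateSystem, rieszConjugate, ← smul_neg, ← integral_neg]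
  congr 1
  refine integral_congr_ae (Eventually.of_forall fun t => ?_)
  simp only [rieszKernel, norm_sub_upperPoint_sq, PiLp.sub_apply, upperPoint_succ,
    Real.rpow_neg (by positivity : 0 ≤ p 0 ^ 2 + ‖t - horizontal p‖ ^ 2), ← neg_smul]
  congr 1
  rw [div_eq_mul_inv]
  ring

theorem integrable_rieszKernelDeriv_bound {f : EuclideanSpace ℝ (Fin n) → 𝕜} (hf : MemLp f 2)
    (c : ℝ) {y : ℝ} (hy : 0 < y) (a : EuclideanSpace ℝ (Fin n)) :
    Integrable fun t => c * kernelMajorant y (t - a) * ‖f t‖ := by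
  have := ((memLp_kernelMajorant hy a).integrable_mul hf.norm).const_mul c
  refine this.congr (Eventually.of_forall fun t => ?_)
  simp [mul_assoc]

theorem norm_smulRight_rieszKernelDeriv_le (f : EuclideanSpace ℝ (Fin n) → 𝕜) (i : Fin (n + 1))
    {p₀ p : EuclideanSpace ℝ (Fin (n + 1))} (hp₀ : p₀ ∈ upperHalf n)
    (hp : p ∈ Metric.ball p₀ (p₀ 0 / 2)) (t : EuclideanSpace ℝ (Fin n)) :
    ‖(rieszKernelDeriv i (p - upperPoint t 0)).smulRight (f t)‖
      ≤ (((n : ℝ) + 2) * (1 / 8 : ℝ) ^ (-(((n : ℝ) + 1) / 2)))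
        * kernelMajorant (p₀ 0 / 2) (t - horizontal p₀) * ‖f t‖ := by
  rw [ContinuousLinearMap.norm_smulRight_apply, mul_assoc ((n : ℝ) + 2)]
  refine mul_le_mul_of_nonneg_right ((norm_rieszKernelDeriv_le i (sub_upperPoint_ne_zero
    (ball_subset_upperHalf hp₀ hp) t)).trans ?_) (norm_nonneg _)
  exact mul_le_mul_of_nonneg_left (norm_sq_rpow_le_kernelMajorant hp₀ hp t) (by positivity)

theorem continuous_rieszKernelDeriv_sub (i : Fin (n + 1)) {p : EuclideanSpace ℝ (Fin (n + 1))}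
    (hp : p ∈ upperHalf n) :
    Continuous fun t : EuclideanSpace ℝ (Fin n) => rieszKernelDeriv i (p - upperPoint t 0) :=
  continuous_iff_continuousAt.2 fun t =>
    (continuousAt_rieszKernelDeriv i (sub_upperPoint_ne_zero hp t)).comp
      (f := fun t => p - upperPoint t 0) (continuous_sub_upperPoint p).continuousAt

theorem aestronglyMeasurable_smulRight_rieszKernelDeriv {f : EuclideanSpace ℝ (Fin n) → 𝕜}
    (hf : MemLp f 2) (i : Fin (n + 1)) {p : EuclideanSpace ℝ (Fin (n + 1))}
    (hp : p ∈ upperHalf n) :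
    AEStronglyMeasurable (fun t => (rieszKernelDeriv i (p - upperPoint t 0)).smulRight (f t)) :=
  (ContinuousLinearMap.smulRightL ℝ (EuclideanSpace ℝ (Fin (n + 1))) 𝕜).aestronglyMeasurable_comp₂
    (continuous_rieszKernelDeriv_sub i hp).aestronglyMeasurable hf.1

theorem integrable_smulRight_rieszKernelDeriv {f : EuclideanSpace ℝ (Fin n) → 𝕜}
    (hf : MemLp f 2) (i : Fin (n + 1)) {p : EuclideanSpace ℝ (Fin (n + 1))}
    (hp : p ∈ upperHalf n) :
    Integrable (fun t => (rieszKernelDeriv i (p - upperPoint t 0)).smulRight (f t)) := by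
  have h0 : 0 < p 0 := hp
  exact (integrable_rieszKernelDeriv_bound hf _ (half_pos h0) (horizontal p)).mono'
    (aestronglyMeasurable_smulRight_rieszKernelDeriv hf i hp)
    (Eventually.of_forall fun t => norm_smulRight_rieszKernelDeriv_le f i hp
      (Metric.mem_ball_self (half_pos h0)) t)

theorem hasFDerivAt_conjugateSystem (hn : 1 ≤ n) {f : EuclideanSpace ℝ (Fin n) → 𝕜}
    (hf : MemLp f 2) (i : Fin (n + 1)) {p : EuclideanSpace ℝ (Fin (n + 1))}
    (hp : p ∈ upperHalf n) :
    HasFDerivAt (conjugateSystem f i) ((2 / sphereArea n) •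
      ∫ t, (rieszKernelDeriv i (p - upperPoint t 0)).smulRight (f t)) p := by
  have h0 : 0 < p 0 := hp
  suffices HasFDerivAt (fun p => ∫ t, rieszKernel i (p - upperPoint t 0) • f t)
      (∫ t, (rieszKernelDeriv i (p - upperPoint t 0)).smulRight (f t)) p from
    this.const_smul (2 / sphereArea n)
  refine hasFDerivAt_integral_of_dominated_of_fderiv_le
    (F' := fun p t => (rieszKernelDeriv i (p - upperPoint t 0)).smulRight (f t))
    (Metric.ball_mem_nhds p (half_pos h0)) ?_ ?_
    (aestronglyMeasurable_smulRight_rieszKernelDeriv hf i hp)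
    (Eventually.of_forall fun t q hq => norm_smulRight_rieszKernelDeriv_le f i hp hq t)
    (integrable_rieszKernelDeriv_bound hf _ (half_pos h0) (horizontal p))
    (Eventually.of_forall fun t q hq => ?_)
  · filter_upwards [isOpen_upperHalf.mem_nhds hp] with q hq
    exact (continuous_rieszKernel_sub i hq).aestronglyMeasurable.smul hf.1
  · exact memLp_one_iff_integrable.1 (hf.smul (memLp_rieszKernel hn i hp))
  · have h1 := (hasFDerivAt_rieszKernel i
      (sub_upperPoint_ne_zero (ball_subset_upperHalf hp hq) t)).comp q
      ((hasFDerivAt_id q).sub_const (upperPoint t 0))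
    exact h1.smul_const (f t)

theorem continuousOn_fderiv_conjugateSystem (hn : 1 ≤ n) {f : EuclideanSpace ℝ (Fin n) → 𝕜}
    (hf : MemLp f 2) (i : Fin (n + 1)) :
    ContinuousOn (fderiv ℝ (conjugateSystem f i)) (upperHalf n) := by
  refine ContinuousOn.congr (f := fun p => (2 / sphereArea n) •
      ∫ t, (rieszKernelDeriv i (p - upperPoint t 0)).smulRight (f t)) ?_
    fun p hp => (hasFDerivAt_conjugateSystem hn hf i hp).fderiv
  intro p hp
  have h0 : 0 < p 0 := hp
  suffices ContinuousAt
      (fun p => ∫ t, (rieszKernelDeriv i (p - upperPoint t 0)).smulRight (f t)) p from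
    (this.const_smul (2 / sphereArea n)).continuousWithinAt
  refine continuousAt_of_dominated
    (bound := fun t => (((n : ℝ) + 2) * (1 / 8 : ℝ) ^ (-(((n : ℝ) + 1) / 2)))
        * kernelMajorant (p 0 / 2) (t - horizontal p) * ‖f t‖) ?_ ?_ ?_ ?_
  · filter_upwards [isOpen_upperHalf.mem_nhds hp] with q hq
    exact aestronglyMeasurable_smulRight_rieszKernelDeriv hf i hq
  · filter_upwards [Metric.ball_mem_nhds p (half_pos h0)] with q hq
    exact Eventually.of_forall fun t => norm_smulRight_rieszKernelDeriv_le f i hp hq t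
  · exact integrable_rieszKernelDeriv_bound hf _ (half_pos h0) (horizontal p)
  · refine Eventually.of_forall fun t => ?_
    have h1 : ContinuousAt (fun q => rieszKernelDeriv i (q - upperPoint t 0)) p :=
      (continuousAt_rieszKernelDeriv i (sub_upperPoint_ne_zero hp t)).comp
        (f := fun q => q - upperPoint t 0) (by fun_prop)
    exact ((ContinuousLinearMap.smulRightL ℝ (EuclideanSpace ℝ (Fin (n + 1))) 𝕜).flip
      (f t)).continuous.continuousAt.comp h1

theorem contDiffOn_conjugateSystem (hn : 1 ≤ n) {f : EuclideanSpace ℝ (Fin n) → 𝕜}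
    (hf : MemLp f 2) (i : Fin (n + 1)) : ContDiffOn ℝ 1 (conjugateSystem f i) (upperHalf n) := by
  rw [show (1 : WithTop ℕ∞) = 0 + 1 from (zero_add 1).symm,
    contDiffOn_succ_iff_fderiv_of_isOpen isOpen_upperHalf, contDiffOn_zero]
  exact ⟨fun p hp => (hasFDerivAt_conjugateSystem hn hf i hp).differentiableAt.differentiableWithinAt,
    by simp, continuousOn_fderiv_conjugateSystem hn hf i⟩

theorem partialD_conjugateSystem (hn : 1 ≤ n) {f : EuclideanSpace ℝ (Fin n) → 𝕜}
    (hf : MemLp f 2) (i j : Fin (n + 1)) {p : EuclideanSpace ℝ (Fin (n + 1))}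
    (hp : p ∈ upperHalf n) :
    partialD j (conjugateSystem f i) p = (2 / sphereArea n) •
      ∫ t, rieszKernelDeriv i (p - upperPoint t 0) (EuclideanSpace.single j 1) • f t := by
  rw [partialD, (hasFDerivAt_conjugateSystem hn hf i hp).fderiv, smul_apply,
    ContinuousLinearMap.integral_apply (integrable_smulRight_rieszKernelDeriv hf i hp)]
  rfl

theorem partialD_conjugateSystem_comm (hn : 1 ≤ n) {f : EuclideanSpace ℝ (Fin n) → 𝕜}
    (hf : MemLp f 2) (i j : Fin (n + 1)) {p : EuclideanSpace ℝ (Fin (n + 1))}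
    (hp : p ∈ upperHalf n) :
    partialD j (conjugateSystem f i) p = partialD i (conjugateSystem f j) p := by
  simp_rw [partialD_conjugateSystem hn hf _ _ hp, rieszKernelDeriv_single_comm i j]

theorem sum_partialD_conjugateSystem (hn : 1 ≤ n) {f : EuclideanSpace ℝ (Fin n) → 𝕜}
    (hf : MemLp f 2) {p : EuclideanSpace ℝ (Fin (n + 1))} (hp : p ∈ upperHalf n) :
    ∑ i, partialD i (conjugateSystem f i) p = 0 := by
  simp_rw [partialD_conjugateSystem hn hf _ _ hp]
  rw [← Finset.smul_sum, ← integral_finsetSum]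
  · simp_rw [← Finset.sum_smul, sum_rieszKernelDeriv_single (sub_upperPoint_ne_zero hp _)]
    simp
  · intro i _
    exact (integrable_smulRight_rieszKernelDeriv hf i hp).apply_continuousLinearMap
      (EuclideanSpace.single i 1)

end ConjugateKernels
/-! ### The Gagliardo seminorm -/

section Gagliardo

variable {n : ℕ}

/-- Parseval's identity for the cross term that appears when |f(t₁) - f(t₂)|² is expanded. -/
theorem integral_conj_mul_fourierExtension {f : EuclideanSpace ℝ (Fin n) → ℂ} (hf : MemLp f 2)
    {y : ℝ} (hy : 0 < y) :
    ∫ x, (starRingEnd ℂ) (f x) * fourierExtension (fourierL2 f hf) (upperPoint x y)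
      = ((∫ t : EuclideanSpace ℝ (Fin n),
          Real.exp (-(2 * Real.pi * y * ‖t‖)) * ‖fourierL2 f hf t‖ ^ 2 : ℝ) : ℂ) := by
  have hg := memLp_fourierL2 hf
  set H := (memLp_exp_mul hg hy).toLp _ with hH
  set G : Lp ℂ 2 (volume : Measure (EuclideanSpace ℝ (Fin n))) := 𝓕⁻ (hf.toLp f) with hG
  have hGf : 𝓕 G = hf.toLp f := (Lp.fourierTransformₗᵢ _ _).apply_symm_apply (hf.toLp f)
  have h := Lp.inner_fourier_eq G H
  rw [hGf, L2.inner_def, L2.inner_def] at h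
  rw [← integral_complex_ofReal]
  refine (integral_congr_ae ?_).trans (h.trans (integral_congr_ae ?_))
  · filter_upwards [fourierExtension_slice_ae_eq hg hy, hf.coeFn_toLp] with x h1 h2
    rw [h1, h2, RCLike.inner_apply, mul_comm]
  · filter_upwards [(memLp_exp_mul hg hy).coeFn_toLp] with t h1
    rw [h1, RCLike.inner_apply]
    have : (starRingEnd ℂ) (G t) * fourierL2 f hf t = ((‖fourierL2 f hf t‖ ^ 2 : ℝ) : ℂ) := by
      rw [Complex.ofReal_pow]
      exact RCLike.conj_mul (fourierL2 f hf t)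
    rw [Complex.ofReal_mul, ← this]
    ring

theorem integral_norm_sq_fourierL2 {f : EuclideanSpace ℝ (Fin n) → ℂ} (hf : MemLp f 2) :
    ∫ t, ‖fourierL2 f hf t‖ ^ 2 = ∫ x, ‖f x‖ ^ 2 := by
  have h1 : ∀ {h : EuclideanSpace ℝ (Fin n) → ℂ} (hh : MemLp h 2),
      ∫ x, ‖h x‖ ^ 2 = (eLpNorm h 2 ^ 2).toReal := fun {h} hh => by
    have hm : AEStronglyMeasurable (fun x => ‖h x‖ ^ 2) := hh.1.norm.pow 2
    rw [eLpNorm_two_sq, integral_eq_lintegral_of_nonneg_ae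
      (Eventually.of_forall fun _ => by positivity) hm]
    congr 2 with x
    rw [ENNReal.ofReal_pow (norm_nonneg _), ofReal_norm]
  rw [h1 (memLp_fourierL2 hf), h1 hf]
  congr 2
  have h2 : ‖(𝓕⁻ (hf.toLp f) : Lp ℂ 2 (volume : Measure (EuclideanSpace ℝ (Fin n))))‖
      = ‖hf.toLp f‖ := (Lp.fourierTransformₗᵢ _ _).symm.norm_map _
  rw [← eLpNorm_congr_ae hf.coeFn_toLp]
  change eLpNorm (𝓕⁻ (hf.toLp f) : Lp ℂ 2 (volume : Measure (EuclideanSpace ℝ (Fin n)))) 2 _ = _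
  rw [← Lp.enorm_def, ← Lp.enorm_def, ← ofReal_norm, ← ofReal_norm, h2]

theorem integrable_poisson_mul_sq_snd {f : EuclideanSpace ℝ (Fin n) → ℂ} (hf : MemLp f 2) {y : ℝ}
    (hy : 0 < y) : Integrable (fun q : EuclideanSpace ℝ (Fin n) × EuclideanSpace ℝ (Fin n) =>
      halfSpacePoissonKernel y (q.1 - q.2) * ‖f q.2‖ ^ 2) (volume.prod volume) := by
  have hf2 : Integrable fun x => ‖f x‖ ^ 2 := (memLp_two_iff_integrable_sq_norm hf.1).1 hf
  have h := hf2.convolution_integrand (ContinuousLinearMap.mul ℝ ℝ)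
    (integrable_halfSpacePoissonKernel (n := n) hy)
  refine h.congr (Eventually.of_forall fun q => ?_)
  simp [mul_comm]

theorem integrable_poisson_mul_sq_fst {f : EuclideanSpace ℝ (Fin n) → ℂ} (hf : MemLp f 2) {y : ℝ}
    (hy : 0 < y) : Integrable (fun q : EuclideanSpace ℝ (Fin n) × EuclideanSpace ℝ (Fin n) =>
      halfSpacePoissonKernel y (q.1 - q.2) * ‖f q.1‖ ^ 2) (volume.prod volume) := by
  refine (integrable_poisson_mul_sq_snd hf hy).swap.congr (Eventually.of_forall fun q => ?_)
  simp only [Function.comp_apply, Prod.fst_swap, Prod.snd_swap]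
  rw [← halfSpacePoissonKernel_neg, neg_sub]

/-- Expand the square. As the kernel is even with mass one, each pure square contributes ‖f‖² =
‖f̂‖². The cross term is the pairing of f with its own Poisson extension at height y, which is ∫
e^{-2πy|t|}|f̂|². -/
theorem integral_poisson_mul_sq {f : EuclideanSpace ℝ (Fin n) → ℂ} (hf : MemLp f 2) {y : ℝ}
    (hy : 0 < y) :
    Integrable (fun q : EuclideanSpace ℝ (Fin n) × EuclideanSpace ℝ (Fin n) =>
      halfSpacePoissonKernel y (q.1 - q.2) * ‖f q.1 - f q.2‖ ^ 2) (volume.prod volume) ∧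
    ∫ q : EuclideanSpace ℝ (Fin n) × EuclideanSpace ℝ (Fin n),
        halfSpacePoissonKernel y (q.1 - q.2) * ‖f q.1 - f q.2‖ ^ 2 ∂(volume.prod volume)
      = 2 * ∫ t, (1 - Real.exp (-(2 * Real.pi * y * ‖t‖))) * ‖fourierL2 f hf t‖ ^ 2 := by
  have hg := memLp_fourierL2 hf
  have i1 := integrable_poisson_mul_sq_fst hf hy
  have i2 := integrable_poisson_mul_sq_snd hf hy
  have hPm : Continuous fun q : EuclideanSpace ℝ (Fin n) × EuclideanSpace ℝ (Fin n) =>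
      halfSpacePoissonKernel y (q.1 - q.2) :=
    (continuous_halfSpacePoissonKernel hy).comp (continuous_fst.sub continuous_snd)
  have i3 : Integrable (fun q : EuclideanSpace ℝ (Fin n) × EuclideanSpace ℝ (Fin n) =>
      (halfSpacePoissonKernel y (q.1 - q.2) : ℂ) * (f q.1 * (starRingEnd ℂ) (f q.2)))
      (volume.prod volume) := by
    refine (i1.add i2).mono' ((Complex.continuous_ofReal.comp hPm).aestronglyMeasurable.mul
      (hf.1.comp_fst.mul (Complex.continuous_conj.comp_aestronglyMeasurable hf.1.comp_snd)))
      (Eventually.of_forall fun q => ?_)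
    have hP := halfSpacePoissonKernel_nonneg hy.le (q.1 - q.2)
    rw [norm_mul, norm_mul, Complex.norm_real, Real.norm_of_nonneg hP, RCLike.norm_conj,
      Pi.add_apply, ← mul_add]
    refine mul_le_mul_of_nonneg_left ?_ hP
    nlinarith [sq_nonneg (‖f q.1‖ - ‖f q.2‖), sq_nonneg ‖f q.1‖, sq_nonneg ‖f q.2‖]
  have hexp : (fun q : EuclideanSpace ℝ (Fin n) × EuclideanSpace ℝ (Fin n) =>
      halfSpacePoissonKernel y (q.1 - q.2) * ‖f q.1 - f q.2‖ ^ 2)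
      = fun q => (halfSpacePoissonKernel y (q.1 - q.2) * ‖f q.1‖ ^ 2
        + halfSpacePoissonKernel y (q.1 - q.2) * ‖f q.2‖ ^ 2)
        - 2 * Complex.re ((halfSpacePoissonKernel y (q.1 - q.2) : ℂ)
          * (f q.1 * (starRingEnd ℂ) (f q.2))) := by
    funext q
    rw [Complex.re_ofReal_mul, ← Complex.normSq_eq_norm_sq, ← Complex.normSq_eq_norm_sq,
      ← Complex.normSq_eq_norm_sq, Complex.normSq_sub]
    ring
  have i12 : Integrable (fun q : EuclideanSpace ℝ (Fin n) × EuclideanSpace ℝ (Fin n) =>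
      halfSpacePoissonKernel y (q.1 - q.2) * ‖f q.1‖ ^ 2
        + halfSpacePoissonKernel y (q.1 - q.2) * ‖f q.2‖ ^ 2) (volume.prod volume) := i1.add i2
  have i3' : Integrable (fun q : EuclideanSpace ℝ (Fin n) × EuclideanSpace ℝ (Fin n) =>
      2 * Complex.re ((halfSpacePoissonKernel y (q.1 - q.2) : ℂ)
        * (f q.1 * (starRingEnd ℂ) (f q.2)))) (volume.prod volume) := i3.re.const_mul 2
  have e2 : ∫ q : EuclideanSpace ℝ (Fin n) × EuclideanSpace ℝ (Fin n),
      halfSpacePoissonKernel y (q.1 - q.2) * ‖f q.2‖ ^ 2 ∂(volume.prod volume)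
      = ∫ x, ‖f x‖ ^ 2 := by
    rw [integral_prod_symm _ i2]
    refine integral_congr_ae (Eventually.of_forall fun t => ?_)
    simp only
    rw [integral_mul_const, integral_sub_right_eq_self (fun x => halfSpacePoissonKernel y x) t,
      integral_halfSpacePoissonKernel hy, one_mul]
  have e1 : ∫ q : EuclideanSpace ℝ (Fin n) × EuclideanSpace ℝ (Fin n),
      halfSpacePoissonKernel y (q.1 - q.2) * ‖f q.1‖ ^ 2 ∂(volume.prod volume)
      = ∫ x, ‖f x‖ ^ 2 := by
    rw [← e2, ← integral_prod_swap]
    refine integral_congr_ae (Eventually.of_forall fun q => ?_)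
    simp only [Prod.fst_swap, Prod.snd_swap]
    rw [← halfSpacePoissonKernel_neg, neg_sub]
  have e3 : ∫ q : EuclideanSpace ℝ (Fin n) × EuclideanSpace ℝ (Fin n),
      (halfSpacePoissonKernel y (q.1 - q.2) : ℂ) * (f q.1 * (starRingEnd ℂ) (f q.2))
        ∂(volume.prod volume)
      = ((∫ t : EuclideanSpace ℝ (Fin n),
          Real.exp (-(2 * Real.pi * y * ‖t‖)) * ‖fourierL2 f hf t‖ ^ 2 : ℝ) : ℂ) := by
    rw [integral_prod_symm _ i3, ← integral_conj_mul_fourierExtension hf hy]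
    refine integral_congr_ae (Eventually.of_forall fun t => ?_)
    simp only
    rw [fourierExtension_fourierL2 hf (p := upperPoint t y) hy, ← integral_const_mul]
    refine integral_congr_ae (Eventually.of_forall fun s => ?_)
    simp only [upperPoint_zero, horizontal_upperPoint]
    ring
  refine ⟨hexp ▸ i12.sub i3', ?_⟩
  have j1 : Integrable fun t => ‖fourierL2 f hf t‖ ^ 2 :=
    (memLp_two_iff_integrable_sq_norm hg.1).1 hg
  have j2 : Integrable fun t : EuclideanSpace ℝ (Fin n) =>
      Real.exp (-(2 * Real.pi * y * ‖t‖)) * ‖fourierL2 f hf t‖ ^ 2 := by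
    refine j1.bdd_mul (c := 1) (Continuous.aestronglyMeasurable (by fun_prop))
      (Eventually.of_forall fun t => ?_)
    rw [Real.norm_of_nonneg (Real.exp_pos _).le]
    exact exp_neg_norm_le_one hy.le t
  have e3' : ∫ q : EuclideanSpace ℝ (Fin n) × EuclideanSpace ℝ (Fin n),
      Complex.re ((halfSpacePoissonKernel y (q.1 - q.2) : ℂ) * (f q.1 * (starRingEnd ℂ) (f q.2)))
        ∂(volume.prod volume)
      = ∫ t : EuclideanSpace ℝ (Fin n),
          Real.exp (-(2 * Real.pi * y * ‖t‖)) * ‖fourierL2 f hf t‖ ^ 2 := by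
    have := integral_re i3
    rw [e3] at this
    exact this.trans (Complex.ofReal_re _)
  rw [hexp, integral_sub i12 i3', integral_add i1 i2, e1, e2, integral_const_mul,
    e3']
  simp_rw [sub_mul, one_mul]
  rw [integral_sub j1 j2, integral_norm_sq_fourierL2 hf]
  ring

theorem lintegral_poisson_mul_sq {f : EuclideanSpace ℝ (Fin n) → ℂ} (hf : MemLp f 2) {y : ℝ}
    (hy : 0 < y) :
    ∫⁻ q : EuclideanSpace ℝ (Fin n) × EuclideanSpace ℝ (Fin n), ENNReal.ofReal
        (halfSpacePoissonKernel y (q.1 - q.2) / y * ‖f q.1 - f q.2‖ ^ 2) ∂(volume.prod volume)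
      = 2 * ∫⁻ t, ENNReal.ofReal ((1 - Real.exp (-(2 * Real.pi * y * ‖t‖))) / y
          * ‖fourierL2 f hf t‖ ^ 2) := by
  obtain ⟨h1, h2⟩ := integral_poisson_mul_sq hf hy
  have hg := memLp_fourierL2 hf
  have hnn : ∀ t : EuclideanSpace ℝ (Fin n), 0 ≤ (1 - Real.exp (-(2 * Real.pi * y * ‖t‖))) / y
      * ‖fourierL2 f hf t‖ ^ 2 := fun t =>
    mul_nonneg (div_nonneg (sub_nonneg.2 (exp_neg_norm_le_one hy.le t)) hy.le) (sq_nonneg _)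
  have j1 : Integrable fun t => ‖fourierL2 f hf t‖ ^ 2 :=
    (memLp_two_iff_integrable_sq_norm hg.1).1 hg
  have j2 : Integrable fun t : EuclideanSpace ℝ (Fin n) =>
      (1 - Real.exp (-(2 * Real.pi * y * ‖t‖))) * ‖fourierL2 f hf t‖ ^ 2 := by
    refine j1.bdd_mul (c := 1) (Continuous.aestronglyMeasurable (by fun_prop))
      (Eventually.of_forall fun t => ?_)
    rw [Real.norm_of_nonneg (sub_nonneg.2 (exp_neg_norm_le_one hy.le t))]
    linarith [Real.exp_pos (-(2 * Real.pi * y * ‖t‖))]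
  have k1 : Integrable (fun q : EuclideanSpace ℝ (Fin n) × EuclideanSpace ℝ (Fin n) =>
      halfSpacePoissonKernel y (q.1 - q.2) / y * ‖f q.1 - f q.2‖ ^ 2) (volume.prod volume) :=
    (h1.div_const y).congr (Eventually.of_forall fun q => by ring)
  have k2 : Integrable fun t : EuclideanSpace ℝ (Fin n) =>
      (1 - Real.exp (-(2 * Real.pi * y * ‖t‖))) / y * ‖fourierL2 f hf t‖ ^ 2 :=
    (j2.div_const y).congr (Eventually.of_forall fun q => by ring)
  rw [← ofReal_integral_eq_lintegral_ofReal k1 (Eventually.of_forall fun q => mul_nonneg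
    (div_nonneg (halfSpacePoissonKernel_nonneg hy.le _) hy.le) (sq_nonneg _)),
    ← ofReal_integral_eq_lintegral_ofReal k2 (Eventually.of_forall hnn)]
  have two : ∀ a : ℝ, 2 * ENNReal.ofReal a = ENNReal.ofReal (2 * a) := fun a => by
    rw [ENNReal.ofReal_mul two_pos.le]
    simp
  rw [two]
  congr 1
  have l1 : ∀ q : EuclideanSpace ℝ (Fin n) × EuclideanSpace ℝ (Fin n),
      halfSpacePoissonKernel y (q.1 - q.2) / y * ‖f q.1 - f q.2‖ ^ 2
        = halfSpacePoissonKernel y (q.1 - q.2) * ‖f q.1 - f q.2‖ ^ 2 / y := fun q => by ring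
  have l2 : ∀ t : EuclideanSpace ℝ (Fin n),
      (1 - Real.exp (-(2 * Real.pi * y * ‖t‖))) / y * ‖fourierL2 f hf t‖ ^ 2
        = (1 - Real.exp (-(2 * Real.pi * y * ‖t‖))) * ‖fourierL2 f hf t‖ ^ 2 / y := fun q => by ring
  simp_rw [l1, l2]
  rw [integral_div, integral_div, h2]
  ring

theorem one_sub_exp_div_le {a y : ℝ} (hy : 0 < y) : (1 - Real.exp (-(a * y))) / y ≤ a := by
  rw [div_le_iff₀ hy]
  linarith [Real.add_one_le_exp (-(a * y))]

theorem tendsto_one_sub_exp_div (a : ℝ) :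
    Tendsto (fun y => (1 - Real.exp (-(a * y))) / y) (𝓝[>] 0) (𝓝 a) := by
  have h : HasDerivAt (fun y => 1 - Real.exp (-(a * y))) a 0 := by
    have h1 : HasDerivAt (fun y : ℝ => -(a * y)) (-a) 0 :=
      ((hasDerivAt_id (0 : ℝ)).const_mul a).neg.congr_deriv (by simp)
    have := h1.exp.const_sub 1
    simpa using this
  have h2 := h.tendsto_slope_zero_right
  simpa [div_eq_inv_mul] using h2

/-- The Gagliardo seminorm in terms of the Fourier transform. -/
theorem gagliardo_eq_fourier {f : EuclideanSpace ℝ (Fin n) → ℂ} (hf : MemLp f 2)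
    (hfin : ∫⁻ t, ENNReal.ofReal (‖t‖ * ‖fourierL2 f hf t‖ ^ 2) ≠ ∞) :
    ENNReal.ofReal (1 / sphereArea n) * ∫⁻ t₁, ∫⁻ t₂,
        ENNReal.ofReal (‖f t₁ - f t₂‖ ^ 2 / ‖t₁ - t₂‖ ^ (n + 1))
      = ENNReal.ofReal (2 * Real.pi) * ∫⁻ t, ENNReal.ofReal (‖t‖ * ‖fourierL2 f hf t‖ ^ 2) := by
  have hω := sphereArea_pos n
  have hg := memLp_fourierL2 hf
  set ym : ℕ → ℝ := fun m => 1 / ((m : ℝ) + 1) with hym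
  have hy0 : ∀ m, 0 < ym m := fun m => by positivity
  have hyt : Tendsto ym atTop (𝓝[>] 0) :=
    tendsto_nhdsWithin_iff.2 ⟨tendsto_one_div_add_atTop_nhds_zero_nat, Eventually.of_forall hy0⟩
  have hyanti : Antitone ym := fun a b hab => by
    simp only [hym]
    gcongr
  have hform : ∀ m, ∀ h : EuclideanSpace ℝ (Fin n), halfSpacePoissonKernel (ym m) h / ym m
      = 2 / sphereArea n * ((ym m ^ 2 + ‖h‖ ^ 2) ^ (((n : ℝ) + 1) / 2))⁻¹ := fun m h => by
    have := (hy0 m).ne'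
    unfold halfSpacePoissonKernel
    field_simp
  have hdm : AEMeasurable (fun q : EuclideanSpace ℝ (Fin n) × EuclideanSpace ℝ (Fin n) =>
      ‖f q.1 - f q.2‖ ^ 2) (volume.prod volume) :=
    (hf.1.comp_fst.sub hf.1.comp_snd).norm.aemeasurable.pow_const 2
  -- Monotone convergence: P_y(x)/y increases to (2/ω_n)|x|^{-(n+1)} as y decreases to 0.
  have hL := lintegral_tendsto_of_tendsto_of_monotone (μ := (volume.prod volume :
      Measure (EuclideanSpace ℝ (Fin n) × EuclideanSpace ℝ (Fin n))))
    (f := fun m q => ENNReal.ofReal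
      (halfSpacePoissonKernel (ym m) (q.1 - q.2) / ym m * ‖f q.1 - f q.2‖ ^ 2))
    (F := fun q => ENNReal.ofReal
      (2 / sphereArea n * (‖f q.1 - f q.2‖ ^ 2 / ‖q.1 - q.2‖ ^ (n + 1))))
    (fun m => by
      have hc : Continuous fun q : EuclideanSpace ℝ (Fin n) × EuclideanSpace ℝ (Fin n) =>
          halfSpacePoissonKernel (ym m) (q.1 - q.2) / ym m :=
        ((continuous_halfSpacePoissonKernel (hy0 m)).comp
          (continuous_fst.sub continuous_snd)).div_const _
      exact (hc.measurable.aemeasurable.mul hdm).ennreal_ofReal)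
    (Eventually.of_forall fun q a b hab => by
      refine ENNReal.ofReal_le_ofReal (mul_le_mul_of_nonneg_right ?_ (sq_nonneg _))
      rw [hform, hform]
      have h0 := hy0 a
      have h1 := hy0 b
      have h2 := hyanti hab
      gcongr)
    (Eventually.of_forall fun q => by
      refine (ENNReal.continuous_ofReal.tendsto _).comp ?_
      simp_rw [hform]
      by_cases hq : q.1 = q.2
      -- On the diagonal the numerator vanishes, and the convention 0/0 = 0 matches the limit.
      · simp [hq]
      · have hpos : 0 < ‖q.1 - q.2‖ := norm_pos_iff.2 (sub_ne_zero.2 hq)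
        have e : ‖q.1 - q.2‖ ^ (n + 1)
            = (0 ^ 2 + ‖q.1 - q.2‖ ^ 2) ^ (((n : ℝ) + 1) / 2) := by
          rw [zero_pow two_ne_zero, zero_add, ← Real.rpow_natCast, ← Real.rpow_natCast,
            ← Real.rpow_mul hpos.le]
          congr 1
          push_cast
          ring
        have hc : ContinuousAt (fun y : ℝ => 2 / sphereArea n
            * ((y ^ 2 + ‖q.1 - q.2‖ ^ 2) ^ (((n : ℝ) + 1) / 2))⁻¹ * ‖f q.1 - f q.2‖ ^ 2) 0 := by
          refine ContinuousAt.mul (continuousAt_const.mul (ContinuousAt.inv₀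
            (ContinuousAt.rpow_const (by fun_prop) (Or.inl ?_)) ?_)) continuousAt_const <;>
          positivity
        have := hc.tendsto.comp (hyt.mono_right nhdsWithin_le_nhds)
        rw [div_eq_mul_inv (‖f q.1 - f q.2‖ ^ 2), mul_comm (‖f q.1 - f q.2‖ ^ 2), ← mul_assoc, e]
        exact this)
  -- Dominated convergence: (1 - e^{-ay})/y tends to a and stays below it. This is where the
  -- finiteness of the Fourier integral enters.
  have hR : Tendsto (fun m => 2 * ∫⁻ t, ENNReal.ofReal
      ((1 - Real.exp (-(2 * Real.pi * ym m * ‖t‖))) / ym m * ‖fourierL2 f hf t‖ ^ 2)) atTop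
      (𝓝 (2 * ∫⁻ t, ENNReal.ofReal (2 * Real.pi * ‖t‖ * ‖fourierL2 f hf t‖ ^ 2))) := by
    have hgm : Measurable (fourierL2 f hf) := (Lp.stronglyMeasurable _).measurable
    have hrw : ∀ m, ∀ t : EuclideanSpace ℝ (Fin n),
        2 * Real.pi * ym m * ‖t‖ = 2 * Real.pi * ‖t‖ * ym m := fun m t => by ring
    simp_rw [hrw]
    refine ENNReal.Tendsto.const_mul (tendsto_lintegral_of_dominated_convergence
      (fun t => ENNReal.ofReal (2 * Real.pi * ‖t‖ * ‖fourierL2 f hf t‖ ^ 2)) (fun m => ?_)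
      (fun m => Eventually.of_forall fun t => ?_) ?_ (Eventually.of_forall fun t => ?_))
      (Or.inr (by norm_num))
    · exact Measurable.ennreal_ofReal (by fun_prop)
    · exact ENNReal.ofReal_le_ofReal (mul_le_mul_of_nonneg_right
        (one_sub_exp_div_le (hy0 m)) (sq_nonneg _))
    · simp_rw [mul_assoc (2 * Real.pi), ENNReal.ofReal_mul (by positivity : 0 ≤ 2 * Real.pi)]
      rw [lintegral_const_mul' _ _ ENNReal.ofReal_ne_top]
      exact ENNReal.mul_ne_top ENNReal.ofReal_ne_top hfin
    · refine (ENNReal.continuous_ofReal.tendsto _).comp (Tendsto.mul_const _ ?_)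
      exact (tendsto_one_sub_exp_div _).comp hyt
  simp_rw [lintegral_poisson_mul_sq hf (hy0 _)] at hL
  have key := tendsto_nhds_unique hL hR
  have hpm : AEMeasurable (fun q : EuclideanSpace ℝ (Fin n) × EuclideanSpace ℝ (Fin n) =>
      ENNReal.ofReal (‖f q.1 - f q.2‖ ^ 2 / ‖q.1 - q.2‖ ^ (n + 1))) (volume.prod volume) :=
    (hdm.div (Measurable.aemeasurable (by fun_prop))).ennreal_ofReal
  simp_rw [mul_assoc (2 * Real.pi), ENNReal.ofReal_mul (by positivity : 0 ≤ 2 * Real.pi),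
    ENNReal.ofReal_mul (by positivity : 0 ≤ 2 / sphereArea n)] at key
  rw [lintegral_const_mul' _ _ ENNReal.ofReal_ne_top,
    lintegral_const_mul' _ _ ENNReal.ofReal_ne_top,
    lintegral_prod _ hpm] at key
  -- The factor 2 of the kernel constant 2/ω_n cancels the 2 that comes from the two pure squares.
  have e2 : ENNReal.ofReal (2 / sphereArea n) = 2 * ENNReal.ofReal (1 / sphereArea n) := by
    rw [show (2 : ℝ≥0∞) = ENNReal.ofReal 2 by simp, ← ENNReal.ofReal_mul two_pos.le]
    congr 1; ring
  rw [e2, mul_assoc] at key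
  exact (ENNReal.mul_right_inj two_ne_zero (by norm_num)).1 key

end Gagliardo
/-! ### The Clifford algebra -/

section Clifford

variable {n : ℕ} {𝕜 : Type*} [RCLike 𝕜]

theorem cliffBasis_empty : cliffBasis 𝕜 n ∅ = 1 := by
  rw [cliffBasis_apply]
  simp

theorem cliffBasis_singleton (k : Fin n) : cliffBasis 𝕜 n {k} = cliffE 𝕜 k := by
  rw [cliffBasis_apply]
  simp

theorem negSumSq_apply (x : Fin n → 𝕜) : negSumSq 𝕜 n x = -∑ i, x i * x i := by
  simp [negSumSq, QuadraticMap.weightedSumSquares_apply]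

theorem cliffE_mul_self (k : Fin n) : cliffE 𝕜 k * cliffE 𝕜 k = -1 := by
  have h : negSumSq 𝕜 n (Pi.single k 1) = -1 := by
    simp [negSumSq_apply, Pi.single_apply]
  rw [cliffE, CliffordAlgebra.ι_sq_scalar, h, map_neg, map_one]

theorem cliffE_mul_add_swap {j k : Fin n} (h : j ≠ k) :
    cliffE 𝕜 j * cliffE 𝕜 k + cliffE 𝕜 k * cliffE 𝕜 j = 0 := by
  have hp : QuadraticMap.polar (negSumSq 𝕜 n) (Pi.single j 1) (Pi.single k 1) = 0 := by
    rw [QuadraticMap.polar, negSumSq_apply, negSumSq_apply, negSumSq_apply, sub_neg_eq_add,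
      sub_neg_eq_add, ← Finset.sum_neg_distrib, ← Finset.sum_add_distrib,
      ← Finset.sum_add_distrib]
    refine Finset.sum_eq_zero fun i _ => ?_
    by_cases hj : i = j
    · subst hj
      simp [h]
    · simp [Pi.single_apply, hj]
  rw [cliffE, cliffE, CliffordAlgebra.ι_mul_ι_add_swap, hp, map_zero]

theorem cliffCoord_sum_smul (c : Finset (Fin n) → 𝕜) (A : Finset (Fin n)) :
    cliffCoord A (∑ B, c B • cliffBasis 𝕜 n B) = c A := by
  rw [cliffCoord, Module.Basis.repr_sum_self]

theorem cliffCoord_paravector (a : 𝕜) (b : Fin n → 𝕜) (A : Finset (Fin n)) :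
    cliffCoord A (algebraMap 𝕜 (Cl 𝕜 n) a + ∑ k, b k • cliffE 𝕜 k)
      = (if A = ∅ then a else 0) + ∑ k, if A = {k} then b k else 0 := by
  simp only [cliffCoord, Algebra.algebraMap_eq_smul_one, ← cliffBasis_empty,
    ← cliffBasis_singleton, map_add, map_sum, map_smul, Module.Basis.repr_self,
    Finsupp.add_apply, Finsupp.coe_finsetSum, Finset.sum_apply, Finsupp.smul_apply,
    Finsupp.single_apply, smul_eq_mul, mul_ite, mul_one, mul_zero, @eq_comm _ _ A]

theorem cliffCoord_paravector_empty (a : 𝕜) (b : Fin n → 𝕜) :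
    cliffCoord ∅ (algebraMap 𝕜 (Cl 𝕜 n) a + ∑ k, b k • cliffE 𝕜 k) = a := by
  rw [cliffCoord_paravector, if_pos rfl, Finset.sum_eq_zero, add_zero]
  exact fun k _ => if_neg (Finset.singleton_ne_empty k).symm

theorem cliffCoord_paravector_singleton (a : 𝕜) (b : Fin n → 𝕜) (j : Fin n) :
    cliffCoord {j} (algebraMap 𝕜 (Cl 𝕜 n) a + ∑ k, b k • cliffE 𝕜 k) = b j := by
  rw [cliffCoord_paravector, if_neg (Finset.singleton_ne_empty j), zero_add]
  simp [Finset.singleton_inj]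

theorem cliffCoord_paravector_of_ne (a : 𝕜) (b : Fin n → 𝕜) {A : Finset (Fin n)} (hA : A ≠ ∅)
    (hA' : ∀ k, A ≠ {k}) :
    cliffCoord A (algebraMap 𝕜 (Cl 𝕜 n) a + ∑ k, b k • cliffE 𝕜 k) = 0 := by
  rw [cliffCoord_paravector, if_neg hA, zero_add]
  exact Finset.sum_eq_zero fun k _ => if_neg (hA' k)

theorem cliff_ext {x y : Cl 𝕜 n} (h : ∀ A, cliffCoord A x = cliffCoord A y) : x = y :=
  (cliffBasis 𝕜 n).repr.injective (Finsupp.ext h)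

/-- A coordinatewise operation on paravectors is a paravector. -/
theorem cliffPartial_paravector (i : Fin (n + 1)) (a : EuclideanSpace ℝ (Fin (n + 1)) → 𝕜)
    (b : Fin n → EuclideanSpace ℝ (Fin (n + 1)) → 𝕜) (p : EuclideanSpace ℝ (Fin (n + 1))) :
    cliffPartial i (fun q => algebraMap 𝕜 (Cl 𝕜 n) (a q) + ∑ k, b k q • cliffE 𝕜 k) p
      = algebraMap 𝕜 (Cl 𝕜 n) (partialD i a p) + ∑ k, partialD i (b k) p • cliffE 𝕜 k := by
  refine cliff_ext fun A => ?_
  rw [cliffPartial, cliffCoord_sum_smul]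
  by_cases hA : A = ∅
  · subst hA
    simp only [cliffCoord_paravector_empty]
  by_cases hA' : ∃ k, A = {k}
  · obtain ⟨k, rfl⟩ := hA'
    simp only [cliffCoord_paravector_singleton]
  · push Not at hA'
    simp only [cliffCoord_paravector_of_ne _ _ hA hA', partialD, fderiv_fun_const, Pi.zero_apply,
      zero_apply]

theorem cliffNorm_paravector_sq (a : 𝕜) (b : Fin n → 𝕜) :
    cliffNorm (algebraMap 𝕜 (Cl 𝕜 n) a + ∑ k, b k • cliffE 𝕜 k) ^ 2
      = ‖a‖ ^ 2 + ∑ k, ‖b k‖ ^ 2 := by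
  classical
  rw [cliffNorm, Real.sq_sqrt (Finset.sum_nonneg fun _ _ => sq_nonneg _)]
  have h0 : (∅ : Finset (Fin n)) ∉ Finset.univ.image fun k : Fin n => ({k} : Finset (Fin n)) := by
    simp
  rw [← Finset.sum_subset (Finset.subset_univ
    (insert ∅ (Finset.univ.image fun k : Fin n => ({k} : Finset (Fin n))))),
    Finset.sum_insert h0, Finset.sum_image fun _ _ _ _ h => Finset.singleton_injective h]
  · simp only [cliffCoord_paravector_empty, cliffCoord_paravector_singleton]
  · intro A _ hA
    simp only [Finset.mem_insert, Finset.mem_image, Finset.mem_univ, true_and, not_or,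
      not_exists] at hA
    rw [cliffCoord_paravector_of_ne _ _ hA.1 fun k h => hA.2 k h.symm]
    simp

/-- The Dirac product `∑_j e_j (a_j + ∑_k b_{jk} e_k)` with symmetric `b`. -/
theorem sum_cliffE_mul_paravector (a : Fin n → 𝕜) (b : Fin n → Fin n → 𝕜)
    (hb : ∀ j k, b j k = b k j) :
    ∑ j, cliffE 𝕜 j * (algebraMap 𝕜 (Cl 𝕜 n) (a j) + ∑ k, b j k • cliffE 𝕜 k)
      = -algebraMap 𝕜 (Cl 𝕜 n) (∑ j, b j j) + ∑ j, a j • cliffE 𝕜 j := by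
  have h1 : ∑ j, ∑ k, b j k • (cliffE 𝕜 j * cliffE 𝕜 k)
      = -algebraMap 𝕜 (Cl 𝕜 n) (∑ j, b j j) := by
    -- Symmetrise in j and k: anticommutation kills the off-diagonal pairs, and e_j² = -1 leaves
    -- minus the trace of b, twice.
    have h2 : (2 : 𝕜) • ∑ j, ∑ k, b j k • (cliffE 𝕜 j * cliffE 𝕜 k)
        = (2 : 𝕜) • -algebraMap 𝕜 (Cl 𝕜 n) (∑ j, b j j) := by
      calc (2 : 𝕜) • ∑ j, ∑ k, b j k • (cliffE 𝕜 j * cliffE 𝕜 k)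
          = ∑ j, ∑ k, b j k • (cliffE 𝕜 j * cliffE 𝕜 k + cliffE 𝕜 k * cliffE 𝕜 j) := by
            rw [two_smul]
            nth_rewrite 2 [Finset.sum_comm]
            simp only [← Finset.sum_add_distrib, smul_add]
            simp_rw [fun j k => hb k j]
        _ = ∑ j, b j j • (-(2 : Cl 𝕜 n)) := by
            refine Finset.sum_congr rfl fun j _ => ?_
            rw [Finset.sum_eq_single j
              (fun k _ hk => by rw [cliffE_mul_add_swap hk.symm, smul_zero])
              (by simp), cliffE_mul_self]
            congr 1
            norm_num
        _ = _ := by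
            rw [← Finset.sum_smul, Algebra.algebraMap_eq_smul_one, smul_neg, smul_neg, smul_smul,
              mul_comm, ← smul_smul, two_smul 𝕜 (1 : Cl 𝕜 n), one_add_one_eq_two]
    exact smul_right_injective _ (two_ne_zero (α := 𝕜)) h2
  simp only [mul_add, Finset.mul_sum, mul_smul_comm, Finset.sum_add_distrib, h1]
  rw [add_comm]
  congr 1
  refine Finset.sum_congr rfl fun j _ => ?_
  rw [← Algebra.commutes, Algebra.smul_def]

variable {a : EuclideanSpace ℝ (Fin (n + 1)) → 𝕜} {b : Fin n → EuclideanSpace ℝ (Fin (n + 1)) → 𝕜}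
  {p : EuclideanSpace ℝ (Fin (n + 1))}

/-- The hypotheses are the Riesz system. They annihilate in turn the scalar, the vector and the
bivector part of D applied to a paravector. -/
theorem cauchyRiemann_paravector (h0 : partialD 0 a p = ∑ k, partialD k.succ (b k) p)
    (h1 : ∀ k, partialD 0 (b k) p = -partialD k.succ a p)
    (h2 : ∀ j k, partialD j.succ (b k) p = partialD k.succ (b j) p) :
    cauchyRiemann (fun q => algebraMap 𝕜 (Cl 𝕜 n) (a q) + ∑ k, b k q • cliffE 𝕜 k) p = 0 := by
  simp only [cauchyRiemann, cliffPartial_paravector]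
  rw [sum_cliffE_mul_paravector _ _ h2, h0]
  simp only [h1, neg_smul, Finset.sum_neg_distrib]
  rw [show ∀ x y : Cl 𝕜 n, x + -y + (-x + y) = 0 from fun x y => by abel, smul_zero]

/-- With the opposite sign, the relations that cancel in D double the scalar and vector parts. The
factor 1/2 restores ∂_0 a - ∑ e_k ∂_k a, a paravector whose coordinates are the partial derivatives
of a up to sign. -/
theorem cliffNorm_cauchyRiemannBar_paravector
    (h0 : partialD 0 a p = ∑ k, partialD k.succ (b k) p)
    (h1 : ∀ k, partialD 0 (b k) p = -partialD k.succ a p)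
    (h2 : ∀ j k, partialD j.succ (b k) p = partialD k.succ (b j) p) :
    cliffNorm (cauchyRiemannBar
        (fun q => algebraMap 𝕜 (Cl 𝕜 n) (a q) + ∑ k, b k q • cliffE 𝕜 k) p) ^ 2
      = ∑ i, ‖partialD i a p‖ ^ 2 := by
  have e : cauchyRiemannBar
      (fun q => algebraMap 𝕜 (Cl 𝕜 n) (a q) + ∑ k, b k q • cliffE 𝕜 k) p
      = algebraMap 𝕜 (Cl 𝕜 n) (partialD 0 a p) + ∑ k, (-partialD k.succ a p) • cliffE 𝕜 k := by
    simp only [cauchyRiemannBar, cliffPartial_paravector]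
    rw [sum_cliffE_mul_paravector _ _ h2, ← h0]
    simp only [h1, neg_smul, Finset.sum_neg_distrib]
    rw [show ∀ x y : Cl 𝕜 n, x + -y - (-x + y) = (2 : 𝕜) • (x + -y) from
      fun x y => by rw [two_smul]; abel, smul_smul]
    norm_num
  rw [e, cliffNorm_paravector_sq, Fin.sum_univ_succ]
  simp only [norm_neg]

end Clifford
/-! ### Reduction to complex-valued functions -/

section Complexification

variable {n : ℕ} {𝕜 : Type*} [RCLike 𝕜]

/-- The inclusion of `𝕜` in `ℂ` as a linear isometry. -/
def mapLinearIsometry (𝕜 : Type*) [RCLike 𝕜] : 𝕜 →ₗᵢ[ℝ] ℂ where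
  toLinearMap := (RCLike.map 𝕜 ℂ : 𝕜 →L[ℝ] ℂ).toLinearMap
  norm_map' x := by
    rw [← sq_eq_sq₀ (norm_nonneg _) (norm_nonneg _), RCLike.norm_sq_eq_def (z := x),
      ← Complex.normSq_eq_norm_sq, Complex.normSq_apply]
    simp

theorem partialD_mapLinearIsometry {u : EuclideanSpace ℝ (Fin (n + 1)) → 𝕜}
    {p : EuclideanSpace ℝ (Fin (n + 1))} (hu : DifferentiableAt ℝ u p) (i : Fin (n + 1)) :
    partialD i (fun q => mapLinearIsometry 𝕜 (u q)) p = mapLinearIsometry 𝕜 (partialD i u p) := by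
  have h := ((mapLinearIsometry 𝕜).toContinuousLinearMap.hasFDerivAt.comp p hu.hasFDerivAt).fderiv
  exact congrArg (fun L => L (EuclideanSpace.single i 1)) h

theorem MemDirichlet.differentiableAt {u : EuclideanSpace ℝ (Fin (n + 1)) → 𝕜}
    (hu : MemDirichlet u) {p : EuclideanSpace ℝ (Fin (n + 1))} (hp : p ∈ upperHalf n) :
    DifferentiableAt ℝ u p :=
  (hu.harmonic p hp).1.differentiableAt two_ne_zero

theorem gradientEnergy_mapLinearIsometry {u : EuclideanSpace ℝ (Fin (n + 1)) → 𝕜}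
    (hu : MemDirichlet u) :
    gradientEnergy (fun q => mapLinearIsometry 𝕜 (u q)) = gradientEnergy u := by
  refine setLIntegral_congr_fun isOpen_upperHalf.measurableSet fun p hp => ?_
  simp only [partialD_mapLinearIsometry (hu.differentiableAt hp), LinearIsometry.norm_map]

theorem MemDirichlet.mapLinearIsometry {u : EuclideanSpace ℝ (Fin (n + 1)) → 𝕜}
    (hu : MemDirichlet u) : MemDirichlet fun q => mapLinearIsometry 𝕜 (u q) where
  harmonic := hu.harmonic.comp_CLM (_root_.mapLinearIsometry 𝕜).toContinuousLinearMap
  hardy := by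
    have h : ∀ y : ℝ, eLpNorm (fun x : EuclideanSpace ℝ (Fin n) =>
        _root_.mapLinearIsometry 𝕜 (u (upperPoint x y))) 2 volume
        = eLpNorm (fun x : EuclideanSpace ℝ (Fin n) => u (upperPoint x y)) 2 volume := fun y =>
      eLpNorm_congr_norm_ae (Eventually.of_forall fun x => LinearIsometry.norm_map _ _)
    simp_rw [h]
    exact hu.hardy
  energy := (gradientEnergy_mapLinearIsometry hu).trans_lt hu.energy

theorem IsBoundaryFunction.mapLinearIsometry {u : EuclideanSpace ℝ (Fin (n + 1)) → 𝕜}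
    {f : EuclideanSpace ℝ (Fin n) → 𝕜} (hf : IsBoundaryFunction u f) :
    IsBoundaryFunction (fun q => mapLinearIsometry 𝕜 (u q))
      (fun x => mapLinearIsometry 𝕜 (f x)) := by
  filter_upwards [hf] with x hx
  exact ((_root_.mapLinearIsometry 𝕜).continuous.tendsto _).comp hx

theorem memLp_of_mapLinearIsometry {f : EuclideanSpace ℝ (Fin n) → 𝕜}
    (hf : MemLp (fun x => mapLinearIsometry 𝕜 (f x)) 2) : MemLp f 2 :=
  hf.of_le ((mapLinearIsometry 𝕜).isEmbedding.aestronglyMeasurable_comp_iff.1 hf.1)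
    (Eventually.of_forall fun _ => (LinearIsometry.norm_map _ _).ge)

/-- A function of the Dirichlet space is the Poisson integral of its boundary function. -/
theorem MemDirichlet.eq_conjugateSystem_zero {u : EuclideanSpace ℝ (Fin (n + 1)) → 𝕜}
    (hu : MemDirichlet u) {f : EuclideanSpace ℝ (Fin n) → 𝕜} (hf : IsBoundaryFunction u f)
    {p : EuclideanSpace ℝ (Fin (n + 1))} (hp : p ∈ upperHalf n) :
    u p = conjugateSystem f 0 p := by
  have hf2 := hu.mapLinearIsometry.memLp_boundary hf.mapLinearIsometry
  refine (_root_.mapLinearIsometry 𝕜).injective ?_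
  rw [hu.mapLinearIsometry.eq_fourierExtension hf.mapLinearIsometry hf2 p hp,
    fourierExtension_fourierL2 hf2 hp, conjugateSystem_zero,
    ← LinearIsometry.integral_comp_comm]
  refine integral_congr_ae (Eventually.of_forall fun t => ?_)
  simp only [map_smul, Complex.real_smul]

theorem partialD_congr {u v : EuclideanSpace ℝ (Fin (n + 1)) → 𝕜}
    (h : ∀ p ∈ upperHalf n, u p = v p) {p : EuclideanSpace ℝ (Fin (n + 1))}
    (hp : p ∈ upperHalf n) (i : Fin (n + 1)) : partialD i u p = partialD i v p := by
  have : u =ᶠ[𝓝 p] v := by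
    filter_upwards [isOpen_upperHalf.mem_nhds hp] with q hq using h q hq
  rw [partialD, partialD, this.fderiv_eq]

theorem partialD_rieszConjugate (f : EuclideanSpace ℝ (Fin n) → 𝕜) (k : Fin n) (i : Fin (n + 1))
    (p : EuclideanSpace ℝ (Fin (n + 1))) :
    partialD i (rieszConjugate f k) p = -partialD i (conjugateSystem f k.succ) p := by
  rw [show rieszConjugate f k = fun p => -conjugateSystem f k.succ p from
    funext fun p => rieszConjugate_eq f k p, partialD, partialD, fderiv_fun_neg]
  rfl

variable {u : EuclideanSpace ℝ (Fin (n + 1)) → 𝕜} {f : EuclideanSpace ℝ (Fin n) → 𝕜}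
  {p : EuclideanSpace ℝ (Fin (n + 1))}

/-- On the half-space u is the zeroth member of the conjugate system and each v_k is minus the
corresponding member, so the vanishing trace of the Jacobian gives this relation; its symmetry gives
the other two. -/
theorem MemDirichlet.partialD_zero_eq_sum (hn : 1 ≤ n) (hu : MemDirichlet u)
    (hf : IsBoundaryFunction u f) (hf2 : MemLp f 2) (hp : p ∈ upperHalf n) :
    partialD 0 u p = ∑ k, partialD k.succ (rieszConjugate f k) p := by
  have h := sum_partialD_conjugateSystem hn hf2 hp
  rw [Fin.sum_univ_succ] at h
  rw [partialD_congr (fun p hp => hu.eq_conjugateSystem_zero hf hp) hp,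
    eq_neg_of_add_eq_zero_left h]
  simp only [partialD_rieszConjugate, Finset.sum_neg_distrib]

theorem MemDirichlet.partialD_zero_rieszConjugate (hn : 1 ≤ n) (hu : MemDirichlet u)
    (hf : IsBoundaryFunction u f) (hf2 : MemLp f 2) (hp : p ∈ upperHalf n) (k : Fin n) :
    partialD 0 (rieszConjugate f k) p = -partialD k.succ u p := by
  rw [partialD_rieszConjugate, partialD_conjugateSystem_comm hn hf2 _ _ hp,
    partialD_congr (fun p hp => hu.eq_conjugateSystem_zero hf hp) hp]

theorem partialD_rieszConjugate_comm (hn : 1 ≤ n) (hf2 : MemLp f 2) (hp : p ∈ upperHalf n)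
    (j k : Fin n) :
    partialD j.succ (rieszConjugate f k) p = partialD k.succ (rieszConjugate f j) p := by
  rw [partialD_rieszConjugate, partialD_rieszConjugate, partialD_conjugateSystem_comm hn hf2 _ _ hp]

theorem leftMonogenicOn_canonicalExtension (hn : 1 ≤ n) (hu : MemDirichlet u)
    (hf : IsBoundaryFunction u f) (hf2 : MemLp f 2) :
    LeftMonogenicOn (canonicalExtension u f) (upperHalf n) := by
  refine ⟨fun A => ?_, fun p hp => cauchyRiemann_paravector
    (hu.partialD_zero_eq_sum hn hf hf2 hp) (hu.partialD_zero_rieszConjugate hn hf hf2 hp)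
    (partialD_rieszConjugate_comm hn hf2 hp)⟩
  unfold canonicalExtension
  by_cases hA : A = ∅
  · subst hA
    simp only [cliffCoord_paravector_empty]
    exact hu.harmonic.contDiffOn.of_le one_le_two
  by_cases hA' : ∃ k, A = {k}
  · obtain ⟨k, rfl⟩ := hA'
    simp only [cliffCoord_paravector_singleton, rieszConjugate_eq]
    exact (contDiffOn_conjugateSystem hn hf2 _).neg
  · push Not at hA'
    simp only [cliffCoord_paravector_of_ne _ _ hA hA']
    exact contDiffOn_const

end Complexification

end

/-! ### Assembly of the identities -/

theorem mainTheorem1 {𝕜 : Type*} [RCLike 𝕜] (n : ℕ) (hn : 1 ≤ n)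
    (u : EuclideanSpace ℝ (Fin (n + 1)) → 𝕜) (f : EuclideanSpace ℝ (Fin n) → 𝕜)
    (hu : MemDirichlet u) (hf : IsBoundaryFunction u f) :
    (LeftMonogenicOn (canonicalExtension u f) (upperHalf n) ∧
      ∀ p ∈ upperHalf n, cliffSc (canonicalExtension u f p) = u p) ∧
    ∃ hf2 : MemLp (fun x => RCLike.map 𝕜 ℂ (f x)) 2 volume,
      gradientEnergy u
        = ENNReal.ofReal (2 * Real.pi) *
          ∫⁻ t : EuclideanSpace ℝ (Fin n), ENNReal.ofReal (‖t‖ * ‖fourierL2 _ hf2 t‖ ^ 2) ∧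
      gradientEnergy u
        = ∫⁻ p in upperHalf n,
            ENNReal.ofReal (cliffNorm (cauchyRiemannBar (canonicalExtension u f) p) ^ 2) ∧
      gradientEnergy u
        = ENNReal.ofReal (1 / sphereArea n) *
          ∫⁻ t₁ : EuclideanSpace ℝ (Fin n), ∫⁻ t₂ : EuclideanSpace ℝ (Fin n),
            ENNReal.ofReal (‖f t₁ - f t₂‖ ^ 2 / ‖t₁ - t₂‖ ^ (n + 1)) := by
  -- `mapLinearIsometry` has the same underlying function as `RCLike.map`, so this proof also serves
  -- as the witness in the conclusion.
  have hfC : MemLp (fun x => mapLinearIsometry 𝕜 (f x)) 2 volume :=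
    hu.mapLinearIsometry.memLp_boundary hf.mapLinearIsometry
  have hf2 : MemLp f 2 := memLp_of_mapLinearIsometry hfC
  have hE : gradientEnergy u = ENNReal.ofReal (2 * Real.pi) *
      ∫⁻ t : EuclideanSpace ℝ (Fin n), ENNReal.ofReal (‖t‖ * ‖fourierL2 _ hfC t‖ ^ 2) := by
    rw [← gradientEnergy_fourierExtension (memLp_fourierL2 hfC),
      ← gradientEnergy_mapLinearIsometry hu]
    refine setLIntegral_congr_fun isOpen_upperHalf.measurableSet fun p hp => ?_
    simp only [partialD_congr (hu.mapLinearIsometry.eq_fourierExtension hf.mapLinearIsometry hfC) hp]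
  refine ⟨⟨leftMonogenicOn_canonicalExtension hn hu hf hf2,
    fun p _ => cliffCoord_paravector_empty _ _⟩, hfC, hE, ?_, ?_⟩
  · refine setLIntegral_congr_fun isOpen_upperHalf.measurableSet fun p hp => ?_
    exact congrArg ENNReal.ofReal (cliffNorm_cauchyRiemannBar_paravector
      (hu.partialD_zero_eq_sum hn hf hf2 hp) (hu.partialD_zero_rieszConjugate hn hf hf2 hp)
      (partialD_rieszConjugate_comm hn hf2 hp)).symm
  -- The energy is finite by assumption, so the Fourier formula `hE` forces its integral to be
  -- finite, since 2π > 0. The double integral over 𝕜-valued f then agrees with the complex one by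
  -- isometry.
  · have hfin : ∫⁻ t, ENNReal.ofReal (‖t‖ * ‖fourierL2 _ hfC t‖ ^ 2) ≠ ∞ := fun h => by
      have h1 := hu.energy
      rw [hE, h, ENNReal.mul_top (by simpa using Real.pi_pos)] at h1
      exact lt_irrefl _ h1
    rw [hE, ← gagliardo_eq_fourier hfC hfin]
    simp only [← map_sub, LinearIsometry.norm_map]
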